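/- All Borel spaces are standard and all Hilbert spaces are complex and separable; measures are $\sigma$-finite. Let $G$ be a Borel groupoid with unit space $G^{(0)}$, range and source maps $r,s$, and a Haar system $\lambda=\{\lambda^x\}_{x\in G^{(0)}}$, i.e. a Borel family of measures $\lambda^x$ on $G^x=r^{-1}(x)$ with $\gamma\lambda^{s(\gamma)}=\lambda^{r(\gamma)}$ for all $\gamma$, for which there is a strictly positive Borel function $f$ on $G$ with $\int f\,d\lambda^x=1$ for all $x$. A measure $\mu$ on $G^{(0)}$ is quasi-invariant if $\mu\circ\lambda=\int\lambda^x\,d\mu(x)$ is equivalent to its image under $\gamma\mapsto\gamma^{-1}$; then $(G,\lambda,\mu)$ is ergodic if every Borel $A\subset G^{(0)}$ such that $r(\gamma)\in A\Leftrightarrow s(\gamma)\in A$ for all $\gamma\in G$ is $\mu$-null or $\mu$-conull. A representation $L$ of $(G,\lambda,\mu)$ is a Hilbert bundle $\{\mathcal H(x)\}_{x\in G^{(0)}}$ with a Borel field of operators $L(\gamma):\mathcal H(s(\gamma))\to\mathcal H(r(\gamma))$ for which there is a $\mu$-conull Borel set $U\subset G^{(0)}$ such that, for all arrows with range and source in $U$,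 the operators $L(\gamma)$ are surjective isometries and $L(\gamma_1\gamma_2)=L(\gamma_1)L(\gamma_2)$ whenever $s(\gamma_1)=r(\gamma_2)$. A unit section is a Borel section $\xi$ with $\|\xi(x)\|=1$ for $\mu$-a.e. $x$. The groupoid $(G,\lambda,\mu)$ has property $T$ if every representation $L$ that admits a sequence of unit sections $\xi_n$ with $\|\xi_n(r(\gamma))-L(\gamma)\xi_n(s(\gamma))\|\to0$ for $\mu\circ\lambda$-a.e. $\gamma$ admits a unit section $\xi$ with $\xi(r(\gamma))=L(\gamma)\xi(s(\gamma))$ for $\mu\circ\lambda$-a.e. $\gamma$. A Borel left $G$-space is a Borel space $X$ with a Borel surjection $r_X:X\to G^{(0)}$ and a Borel action $(\gamma,x)\mapsto\gamma x$, defined for $s(\gamma)=r_X(x)$. Its semi-direct groupoid $X\rtimes G=\{(x,\gamma): r_X(x)=r(\gamma)\}$ has unit space $X$, range $(x,\gamma)\mapsto x$, source $(x,\gamma)\mapsto\gamma^{-1}x$, product $(x,\gamma_1)(\gamma_1^{-1}x,\gamma_2)=(x,\gamma_1\gamma_2)$ and Haar system $\{\delta_x\times\lambda^{r_X(x)}\}_{x\in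 X}$. Quasi-invariance of a measure $\mu$ on $X$, ergodicity of $(X,\mu)$ and property $T$ of the $G$-space $(X,\mu)$ mean the corresponding notions for $X\rtimes G$ with this Haar system. **Theorem.** Let $(Y,\nu)$ and $(X,\mu)$ be ergodic Borel $G$-spaces with quasi-invariant measures, and let $p:Y\to X$ be a $G$-equivariant Borel map such that $\mu(A)=0\Leftrightarrow\nu(p^{-1}(A))=0$ for every Borel $A\subset X$. Suppose that the pair is measure preserving, i.e. $\nu=\int_X\rho^x\,d\mu(x)$ for a Borel family of probability measures $\rho^x$ on $p^{-1}(x)$, $x\in X$, with $\gamma\rho^x=\rho^{\gamma x}$ whenever $s(\gamma)=r_X(x)$. (i) If the $G$-space $(X,\mu)$ has property $T$, then so does the $G$-space $(Y,\nu)$. (ii) If $G$ is $r$-discrete (every fibre $G^x$ is countable) and the $G$-space $(Y,\nu)$ has property $T$, then so does the $G$-space $(X,\mu)$. -/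

import Mathlib

open MeasureTheory ProbabilityTheory Filter Topology
open scoped ENNReal NNReal

universe u v w

noncomputable section

namespace MeasGpd

/-! ### Borel groupoids -/

/-- A Borel groupoid with space of arrows `G` and unit space `G₀`.  The product `mul a b` is defined
exactly when `s a = r b`.  All structure maps are Borel. -/
structure BorelGroupoid (G₀ : Type u) (G : Type v) [MeasurableSpace G₀] [MeasurableSpace G] where
  /-- range -/
  r : G → G₀
  /-- source -/
  s : G → G₀
  /-- the unit at a point of the unit space -/
  unit : G₀ → G
  /-- inverse -/
  inv : G → G
  /-- product of a composable pair -/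
  mul : ∀ a b : G, s a = r b → G
  r_unit : ∀ x, r (unit x) = x
  s_unit : ∀ x, s (unit x) = x
  r_inv : ∀ a, r (inv a) = s a
  s_inv : ∀ a, s (inv a) = r a
  r_mul : ∀ a b h, r (mul a b h) = r a
  s_mul : ∀ a b h, s (mul a b h) = s b
  mul_assoc : ∀ a b c (hab : s a = r b) (hbc : s b = r c),
    mul (mul a b hab) c ((s_mul a b hab).trans hbc) =
      mul a (mul b c hbc) (hab.trans (r_mul b c hbc).symm)
  unit_mul : ∀ a, mul (unit (r a)) a (s_unit (r a)) = a
  mul_unit : ∀ a, mul a (unit (s a)) (r_unit (s a)).symm = a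
  inv_mul : ∀ a, mul (inv a) a (s_inv a) = unit (s a)
  mul_inv : ∀ a, mul a (inv a) (r_inv a).symm = unit (r a)
  measurable_r : Measurable r
  measurable_s : Measurable s
  measurable_unit : Measurable unit
  measurable_inv : Measurable inv
  measurable_mul : Measurable fun q : {q : G × G // s q.1 = r q.2} => mul q.1.1 q.1.2 q.2

/-- The groupoid is `r`-discrete: every fibre of the range map is countable. -/
def BorelGroupoid.IsRDiscrete {G₀ : Type u} {G : Type v} [MeasurableSpace G₀] [MeasurableSpace G]
    (𝒢 : BorelGroupoid G₀ G) : Prop :=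
  ∀ x : G₀, {γ : G | 𝒢.r γ = x}.Countable

/-! ### Haar systems, quasi-invariant measures, ergodicity -/

/-- A Haar system: a Borel system of measures on the fibres of `r` which is left invariant,
`γ λ^{s(γ)} = λ^{r(γ)}`, and proper. -/
structure HaarSystem {G₀ : Type u} {G : Type v} [MeasurableSpace G₀] [MeasurableSpace G]
    (𝒢 : BorelGroupoid G₀ G) where
  /-- the Borel system of measures -/
  kernel : Kernel G₀ G
  /-- `λ^x` is carried by `r⁻¹(x)` -/
  fibre : ∀ x, kernel x {γ | 𝒢.r γ ≠ x} = 0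
  invariant : ∀ (γ : G) (A : Set G), MeasurableSet A →
    kernel (𝒢.s γ) {γ' | ∃ h : 𝒢.s γ = 𝒢.r γ', 𝒢.mul γ γ' h ∈ A} = kernel (𝒢.r γ) A
  proper : ∃ f : G → ℝ≥0, Measurable f ∧ (∀ γ, 0 < f γ) ∧ ∀ x, ∫⁻ γ, (f γ : ℝ≥0∞) ∂(kernel x) = 1

section MeasuredGroupoid

variable {G₀ : Type u} {G : Type v} [MeasurableSpace G₀] [MeasurableSpace G]
  (𝒢 : BorelGroupoid G₀ G)

instance HaarSystem.isSFiniteKernel {𝒢 : BorelGroupoid G₀ G} (lam : HaarSystem 𝒢) :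
    IsSFiniteKernel lam.kernel := by
  obtain ⟨f, hf, hpos, hint⟩ := lam.proper
  let k : G → ℕ := fun γ => ⌈(f γ)⁻¹⌉₊
  have hk : Measurable k := Nat.measurable_ceil.comp hf.inv
  have hA : ∀ n, MeasurableSet (k ⁻¹' {n}) := fun n => hk (measurableSet_singleton n)
  have hsum : lam.kernel = Kernel.sum fun n => lam.kernel.restrict (hA n) := by
    ext x A hmA
    rw [Kernel.sum_apply' _ _ hmA]
    simp_rw [Kernel.restrict_apply' _ _ _ hmA]
    rw [← measure_iUnion]
    · congr 1
      ext γ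
      simp
    · intro i j hij
      refine Set.disjoint_left.2 ?_
      rintro γ ⟨-, h1⟩ ⟨-, h2⟩
      exact hij (h1.symm.trans h2)
    · exact fun n => hmA.inter (hA n)
  rw [hsum]
  have hfin : ∀ n, IsFiniteKernel (lam.kernel.restrict (hA n)) := by
    intro n
    refine ⟨⟨(n : ℝ≥0∞), ENNReal.natCast_lt_top n, fun x => ?_⟩⟩
    rw [Kernel.restrict_apply' _ _ _ MeasurableSet.univ, Set.univ_inter]
    calc lam.kernel x (k ⁻¹' {n}) = ∫⁻ _ in k ⁻¹' {n}, 1 ∂(lam.kernel x) := by simp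
      _ ≤ ∫⁻ γ in k ⁻¹' {n}, (n : ℝ≥0∞) * (f γ : ℝ≥0∞) ∂(lam.kernel x) := by
          refine setLIntegral_mono (measurable_const.mul hf.coe_nnreal_ennreal) ?_
          intro γ hγ
          have h1 : (f γ)⁻¹ ≤ (n : ℝ≥0) := by
            have h2 : k γ = n := hγ
            rw [← h2]
            exact Nat.le_ceil _
          have h3 : (1 : ℝ≥0) ≤ n * f γ := by
            have := mul_le_mul_of_nonneg_right h1 (zero_le (a := f γ))
            rwa [inv_mul_cancel₀ (hpos γ).ne'] at this
          exact_mod_cast h3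
      _ ≤ ∫⁻ γ, (n : ℝ≥0∞) * (f γ : ℝ≥0∞) ∂(lam.kernel x) := setLIntegral_le_lintegral _ _
      _ = n := by rw [lintegral_const_mul _ hf.coe_nnreal_ennreal, hint, mul_one]
  infer_instance

/-- The measure `μ ∘ λ` on the space of arrows: `f ↦ ∫∫ f dλ^x dμ(x)`. -/
def arrowMeasure {𝒢 : BorelGroupoid G₀ G} (lam : HaarSystem 𝒢) (μ : Measure G₀) : Measure G :=
  μ.bind lam.kernel

/-- `μ` is quasi-invariant: `μ ∘ λ` is equivalent to its image under inversion. -/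
def QuasiInvariant {𝒢 : BorelGroupoid G₀ G} (lam : HaarSystem 𝒢) (μ : Measure G₀) : Prop :=
  (arrowMeasure lam μ).map 𝒢.inv ≪ arrowMeasure lam μ ∧
    arrowMeasure lam μ ≪ (arrowMeasure lam μ).map 𝒢.inv

/-- Ergodicity: every invariant Borel set of units is null or conull. -/
def IsErgodic (μ : Measure G₀) : Prop :=
  ∀ A : Set G₀, MeasurableSet A → (∀ γ, 𝒢.r γ ∈ A ↔ 𝒢.s γ ∈ A) → μ A = 0 ∨ μ Aᶜ = 0

end MeasuredGroupoid

/-! ### Hilbert bundles -/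

/-- A (complex) Hilbert bundle on the Borel space `X`, presented by a fundamental sequence of
sections: their mutual inner products are Borel, and their values are total in every fibre (so the
fibres are separable). -/
structure HilbertBundle (X : Type u) [MeasurableSpace X] where
  /-- the fibres -/
  Fibre : X → Type u
  [normed : ∀ x, NormedAddCommGroup (Fibre x)]
  [inner : ∀ x, InnerProductSpace ℂ (Fibre x)]
  [complete : ∀ x, CompleteSpace (Fibre x)]
  /-- the fundamental sequence -/
  fund : ℕ → ∀ x, Fibre x
  measurable_inner : ∀ m n, Measurable fun x => Inner.inner ℂ (fund m x) (fund n x)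
  separating : ∀ x (v : Fibre x), (∀ n, Inner.inner ℂ (fund n x) v = 0) → v = 0

attribute [instance] HilbertBundle.normed HilbertBundle.inner HilbertBundle.complete

namespace HilbertBundle

variable {X : Type u} [MeasurableSpace X] (H : HilbertBundle X)

/-- The total space of the bundle. -/
structure Total where
  /-- the base point -/
  pt : X
  /-- the vector -/
  vec : H.Fibre pt

/-- The Borel structure of the total space: the one generated by the projection and by the functions
`(x, v) ↦ ⟨ξₙ(x), v⟩`, where `(ξₙ)` is the fundamental sequence. -/
instance : MeasurableSpace H.Total :=
  MeasurableSpace.comap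
    (fun z : H.Total => (z.pt, fun n : ℕ => Inner.inner ℂ (H.fund n z.pt) z.vec)) inferInstance

/-- Borel sections of the bundle. -/
structure BorelSection where
  /-- the section -/
  toFun : ∀ x, H.Fibre x
  measurable' : Measurable fun x => (⟨x, toFun x⟩ : H.Total)

end HilbertBundle

/-! ### Representations and property T -/

section Representation

variable {G₀ : Type u} {G : Type v} [MeasurableSpace G₀] [MeasurableSpace G]
  (𝒢 : BorelGroupoid G₀ G) (lam : HaarSystem 𝒢) (μ : Measure G₀)

/-- A representation of the measured groupoid `(G, λ, μ)`: a Hilbert bundle on the unit space and a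
Borel field `L(γ) : H(s(γ)) → H(r(γ))` which, on the reduction of `G` to some conull Borel set `U` of
units, consists of surjective isometries and is multiplicative.  (The operator is written
`L γ hx hy : H y → H x`, with `hx : r γ = x` and `hy : s γ = y`, in order to compose operators without
transport along equalities.  Off the reduction to `U` the values of `L` are irrelevant.) -/
structure Representation where
  /-- the Hilbert bundle -/
  bundle : HilbertBundle G₀
  /-- the operators -/
  L : ∀ (γ : G) {x y : G₀}, 𝒢.r γ = x → 𝒢.s γ = y → bundle.Fibre y →L[ℂ] bundle.Fibre x
  borel : ∀ m n, Measurable fun γ => Inner.inner ℂ (bundle.fund m (𝒢.r γ))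
    (L γ rfl rfl (bundle.fund n (𝒢.s γ)))
  conull : ∃ U : Set G₀, MeasurableSet U ∧ μ Uᶜ = 0 ∧
    (∀ (γ : G) {x y : G₀} (hx : 𝒢.r γ = x) (hy : 𝒢.s γ = y), x ∈ U → y ∈ U →
      (∀ v, ‖L γ hx hy v‖ = ‖v‖) ∧ Function.Surjective (L γ hx hy)) ∧
    (∀ (γ₁ γ₂ : G) {x y z : G₀} (hx : 𝒢.r γ₁ = x) (hy : 𝒢.s γ₁ = y) (hy' : 𝒢.r γ₂ = y)
      (hz : 𝒢.s γ₂ = z), x ∈ U → y ∈ U → z ∈ U →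
      L (𝒢.mul γ₁ γ₂ (hy.trans hy'.symm)) ((𝒢.r_mul _ _ _).trans hx) ((𝒢.s_mul _ _ _).trans hz) =
        (L γ₁ hx hy).comp (L γ₂ hy' hz))

variable {𝒢 μ}

namespace Representation

/-- The coboundary `c_L(ξ)(γ) = ξ(r(γ)) - L(γ) ξ(s(γ))`. -/
def coboundary (π : Representation 𝒢 μ) (ξ : π.bundle.BorelSection) (γ : G) :
    π.bundle.Fibre (𝒢.r γ) :=
  ξ.toFun (𝒢.r γ) - π.L γ rfl rfl (ξ.toFun (𝒢.s γ))

/-- Unit sections: Borel sections with `‖ξ(x)‖ = 1` for almost every unit `x`. -/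
def IsUnitSection (π : Representation 𝒢 μ) (ξ : π.bundle.BorelSection) : Prop :=
  ∀ᵐ x ∂μ, ‖ξ.toFun x‖ = 1

/-- The representation contains a unit invariant section. -/
def HasUnitInvariantSection (π : Representation 𝒢 μ) : Prop :=
  ∃ ξ : π.bundle.BorelSection, π.IsUnitSection ξ ∧
    ∀ᵐ γ ∂(arrowMeasure lam μ), π.coboundary ξ γ = 0

/-- The representation almost contains unit invariant sections: there are unit sections `ξₙ` whose
coboundaries tend to `0` almost everywhere. -/
def AlmostHasUnitInvariantSections (π : Representation 𝒢 μ) : Prop :=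
  ∃ ξ : ℕ → π.bundle.BorelSection, (∀ n, π.IsUnitSection (ξ n)) ∧
    ∀ᵐ γ ∂(arrowMeasure lam μ), Tendsto (fun n => ‖π.coboundary (ξ n) γ‖) atTop (𝓝 0)

end Representation

variable (μ)

/-- Property T for the measured groupoid `(G, λ, μ)`. -/
def HasPropertyT : Prop :=
  ∀ π : Representation 𝒢 μ, π.AlmostHasUnitInvariantSections lam → π.HasUnitInvariantSection lam

end Representation

/-! ### `G`-spaces and semi-direct groupoids -/

section GSpace

variable {G₀ : Type u} {G : Type v} {X : Type w} [MeasurableSpace G₀] [MeasurableSpace G]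
  [MeasurableSpace X]

/-- A Borel left `G`-space: a Borel surjection `anchor` onto the unit space (usually also denoted by
`r`) and a Borel action `act γ x`, defined when `s(γ) = anchor x`. -/
structure GSpace (𝒢 : BorelGroupoid G₀ G) (X : Type w) [MeasurableSpace X] where
  /-- the map onto the unit space -/
  anchor : X → G₀
  /-- the action -/
  act : ∀ (γ : G) (x : X), 𝒢.s γ = anchor x → X
  anchor_surjective : Function.Surjective anchor
  anchor_act : ∀ γ x h, anchor (act γ x h) = 𝒢.r γ
  unit_act : ∀ x, act (𝒢.unit (anchor x)) x (𝒢.s_unit _) = x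
  mul_act : ∀ γ₂ γ₁ x (h : 𝒢.s γ₂ = 𝒢.r γ₁) (h₁ : 𝒢.s γ₁ = anchor x),
    act (𝒢.mul γ₂ γ₁ h) x ((𝒢.s_mul _ _ _).trans h₁) =
      act γ₂ (act γ₁ x h₁) (h.trans (anchor_act _ _ _).symm)
  measurable_anchor : Measurable anchor
  measurable_act : Measurable fun q : {q : G × X // 𝒢.s q.1 = anchor q.2} => act q.1.1 q.1.2 q.2

namespace GSpace

variable {𝒢 : BorelGroupoid G₀ G} (𝒳 : GSpace 𝒢 X)

/-- Arrows of the semi-direct groupoid: pairs `(x, γ)` with `anchor x = r γ`. -/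
abbrev Arrow : Type (max v w) := {q : X × G // 𝒳.anchor q.1 = 𝒢.r q.2}

/-- `γ⁻¹ x`, for `anchor x = r γ`. -/
def invAct (γ : G) (x : X) (h : 𝒳.anchor x = 𝒢.r γ) : X :=
  𝒳.act (𝒢.inv γ) x ((𝒢.s_inv γ).trans h.symm)

theorem anchor_invAct (γ : G) (x : X) (h : 𝒳.anchor x = 𝒢.r γ) :
    𝒳.anchor (𝒳.invAct γ x h) = 𝒢.s γ :=
  (𝒳.anchor_act _ _ _).trans (𝒢.r_inv γ)

theorem act_congr {γ γ' : G} {x x' : X} (hγ : γ = γ') (hx : x = x') (h : 𝒢.s γ = 𝒳.anchor x) :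
    𝒳.act γ x h = 𝒳.act γ' x' (by rw [← hγ, ← hx]; exact h) := by
  subst hγ hx; rfl

end GSpace

namespace BorelGroupoid

variable (𝒢 : BorelGroupoid G₀ G)

theorem mul_congr {a a' b b' : G} (ha : a = a') (hb : b = b') (h : 𝒢.s a = 𝒢.r b) :
    𝒢.mul a b h = 𝒢.mul a' b' (by rw [← ha, ← hb]; exact h) := by
  subst ha hb; rfl

theorem inv_mul_cancel (a b : G) (h : 𝒢.s a = 𝒢.r b) :
    𝒢.mul (𝒢.inv a) (𝒢.mul a b h) ((𝒢.s_inv a).trans (𝒢.r_mul a b h).symm) = b := by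
  rw [← 𝒢.mul_assoc _ _ _ (𝒢.s_inv a) h]
  rw [𝒢.mul_congr ((𝒢.inv_mul a).trans (congrArg _ h)) rfl, 𝒢.unit_mul]

theorem mul_inv_cancel (a b : G) (h : 𝒢.r a = 𝒢.r b) :
    𝒢.mul a (𝒢.mul (𝒢.inv a) b ((𝒢.s_inv a).trans h))
      ((𝒢.r_inv a).symm.trans (𝒢.r_mul _ _ _).symm) = b := by
  rw [← 𝒢.mul_assoc _ _ _ (𝒢.r_inv a).symm ((𝒢.s_inv a).trans h)]
  rw [𝒢.mul_congr ((𝒢.mul_inv a).trans (congrArg _ h)) rfl, 𝒢.unit_mul]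

/-- The inverse is determined by a right-inverse relation. -/
theorem eq_inv_of_mul_eq_unit (a b : G) (h : 𝒢.s a = 𝒢.r b)
    (hab : 𝒢.mul a b h = 𝒢.unit (𝒢.r a)) : b = 𝒢.inv a := by
  have h1 := 𝒢.inv_mul_cancel a b h
  rw [𝒢.mul_congr rfl (hab.trans (congrArg _ (𝒢.s_inv a).symm)), 𝒢.mul_unit] at h1
  exact h1.symm

theorem mul_inv_rev (a b : G) (h : 𝒢.s a = 𝒢.r b) :
    𝒢.inv (𝒢.mul a b h) = 𝒢.mul (𝒢.inv b) (𝒢.inv a)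
      ((𝒢.s_inv b).trans (h.symm.trans (𝒢.r_inv a).symm)) := by
  symm
  refine 𝒢.eq_inv_of_mul_eq_unit _ _
    ((𝒢.s_mul a b h).trans ((𝒢.r_inv b).symm.trans (𝒢.r_mul _ _ _).symm)) ?_
  rw [𝒢.mul_assoc a b _ h ((𝒢.r_inv b).symm.trans (𝒢.r_mul _ _ _).symm)]
  rw [𝒢.mul_congr rfl (𝒢.mul_inv_cancel b (𝒢.inv a) (h.symm.trans (𝒢.r_inv a).symm))]
  rw [𝒢.mul_inv, 𝒢.r_mul]

end BorelGroupoid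

namespace GSpace

variable {𝒢 : BorelGroupoid G₀ G} (𝒳 : GSpace 𝒢 X)

theorem invAct_mul (γ₁ γ₂ : G) (x : X) (h₁ : 𝒳.anchor x = 𝒢.r γ₁) (h : 𝒢.s γ₁ = 𝒢.r γ₂) :
    𝒳.invAct (𝒢.mul γ₁ γ₂ h) x (h₁.trans (𝒢.r_mul _ _ _).symm) =
      𝒳.invAct γ₂ (𝒳.invAct γ₁ x h₁) ((𝒳.anchor_invAct _ _ _).trans h) := by
  unfold invAct
  rw [𝒳.act_congr (𝒢.mul_inv_rev γ₁ γ₂ h) rfl, 𝒳.mul_act]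

theorem act_invAct (γ : G) (x : X) (h : 𝒳.anchor x = 𝒢.r γ) :
    𝒳.act γ (𝒳.invAct γ x h) (𝒳.anchor_invAct γ x h).symm = x := by
  unfold invAct
  rw [← 𝒳.mul_act γ (𝒢.inv γ) x (𝒢.r_inv γ).symm ((𝒢.s_inv γ).trans h.symm)]
  rw [𝒳.act_congr ((𝒢.mul_inv γ).trans (congrArg _ h.symm)) rfl, 𝒳.unit_act]

theorem measurable_invAct :
    Measurable fun q : 𝒳.Arrow => 𝒳.invAct q.1.2 q.1.1 q.2 :=
  𝒳.measurable_act.comp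
    (Measurable.subtype_mk (p := fun q : G × X => 𝒢.s q.1 = 𝒳.anchor q.2)
      (f := fun q : 𝒳.Arrow => (𝒢.inv q.1.2, q.1.1))
      (h := fun q => (𝒢.s_inv _).trans q.2.symm)
      ((𝒢.measurable_inv.comp (measurable_snd.comp measurable_subtype_coe)).prodMk
        (measurable_fst.comp measurable_subtype_coe)))

theorem arrow_ext {a b : 𝒳.Arrow} (h₁ : a.1.1 = b.1.1) (h₂ : a.1.2 = b.1.2) : a = b :=
  Subtype.ext (Prod.ext h₁ h₂)

/-- The semi-direct groupoid of a `G`-space `X`, with unit space `X`: `r(x, γ) = x`,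
`s(x, γ) = γ⁻¹ x`, `(x, γ₁)(γ₁⁻¹ x, γ₂) = (x, γ₁ γ₂)` and `(x, γ)⁻¹ = (γ⁻¹ x, γ⁻¹)`. -/
def semidirect : BorelGroupoid X 𝒳.Arrow where
  r q := q.1.1
  s q := 𝒳.invAct q.1.2 q.1.1 q.2
  unit x := ⟨(x, 𝒢.unit (𝒳.anchor x)), (𝒢.r_unit _).symm⟩
  inv q := ⟨(𝒳.invAct q.1.2 q.1.1 q.2, 𝒢.inv q.1.2),
    (𝒳.anchor_invAct _ _ q.2).trans (𝒢.r_inv _).symm⟩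
  mul a b h := ⟨(a.1.1, 𝒢.mul a.1.2 b.1.2
      ((𝒳.anchor_invAct _ _ a.2).symm.trans ((congrArg 𝒳.anchor h).trans b.2))),
    a.2.trans (𝒢.r_mul _ _ _).symm⟩
  r_unit _ := rfl
  s_unit x := by
    change 𝒳.act _ _ _ = _
    have h : 𝒢.inv (𝒢.unit (𝒳.anchor x)) = 𝒢.unit (𝒳.anchor x) := by
      symm
      refine 𝒢.eq_inv_of_mul_eq_unit _ _ ((𝒢.s_unit _).trans (𝒢.r_unit _).symm) ?_
      have := 𝒢.unit_mul (𝒢.unit (𝒳.anchor x))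
      rw [𝒢.mul_congr (congrArg 𝒢.unit (𝒢.r_unit _)) rfl] at this
      rw [this, 𝒢.r_unit]
    rw [𝒳.act_congr h rfl, 𝒳.unit_act]
  r_inv _ := rfl
  s_inv q := by
    have h := 𝒳.invAct_mul q.1.2 (𝒢.inv q.1.2) q.1.1 q.2 (𝒢.r_inv _).symm
    refine h.symm.trans ?_
    have h2 : 𝒢.inv (𝒢.mul q.1.2 (𝒢.inv q.1.2) (𝒢.r_inv _).symm) = 𝒢.unit (𝒳.anchor q.1.1) := by
      rw [𝒢.mul_inv_rev, 𝒢.inv_mul, 𝒢.s_inv, q.2]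
    change 𝒳.act _ _ _ = _
    rw [𝒳.act_congr h2 rfl, 𝒳.unit_act]
  r_mul _ _ _ := rfl
  s_mul a b h := by
    have hc : 𝒢.s a.1.2 = 𝒢.r b.1.2 :=
      (𝒳.anchor_invAct _ _ a.2).symm.trans ((congrArg 𝒳.anchor h).trans b.2)
    refine (𝒳.invAct_mul a.1.2 b.1.2 a.1.1 a.2 hc).trans ?_
    exact 𝒳.act_congr rfl h _
  mul_assoc a b c hab hbc := 𝒳.arrow_ext rfl (𝒢.mul_assoc _ _ _ _ _)
  unit_mul a := 𝒳.arrow_ext rfl (by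
    change 𝒢.mul (𝒢.unit (𝒳.anchor a.1.1)) a.1.2 _ = a.1.2
    rw [𝒢.mul_congr (congrArg 𝒢.unit a.2) rfl, 𝒢.unit_mul])
  mul_unit a := 𝒳.arrow_ext rfl (by
    change 𝒢.mul a.1.2 (𝒢.unit (𝒳.anchor (𝒳.invAct _ _ _))) _ = a.1.2
    rw [𝒢.mul_congr rfl (congrArg 𝒢.unit (𝒳.anchor_invAct _ _ _)), 𝒢.mul_unit])
  inv_mul a := 𝒳.arrow_ext rfl ((𝒢.inv_mul _).trans
    (congrArg 𝒢.unit (𝒳.anchor_invAct _ _ a.2).symm))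
  mul_inv a := 𝒳.arrow_ext rfl ((𝒢.mul_inv _).trans (congrArg 𝒢.unit a.2.symm))
  measurable_r := measurable_fst.comp measurable_subtype_coe
  measurable_s := 𝒳.measurable_invAct
  measurable_unit := Measurable.subtype_mk
    (measurable_id.prodMk (𝒢.measurable_unit.comp 𝒳.measurable_anchor))
  measurable_inv := Measurable.subtype_mk
    (h := fun q => (𝒳.anchor_invAct _ _ q.2).trans (𝒢.r_inv _).symm)
    (𝒳.measurable_invAct.prodMk
      (𝒢.measurable_inv.comp (measurable_snd.comp measurable_subtype_coe)))
  measurable_mul := by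
    refine Measurable.subtype_mk (Measurable.prodMk ?_ ?_)
    · exact measurable_fst.comp (measurable_subtype_coe.comp
        (measurable_fst.comp measurable_subtype_coe))
    · refine 𝒢.measurable_mul.comp
        (Measurable.subtype_mk (p := fun q : G × G => 𝒢.s q.1 = 𝒢.r q.2)
          (h := fun q => (𝒳.anchor_invAct _ _ q.1.1.2).symm.trans
            ((congrArg 𝒳.anchor q.2).trans q.1.2.2)) (Measurable.prodMk
          (measurable_snd.comp (measurable_subtype_coe.comp
            (measurable_fst.comp measurable_subtype_coe)))
          (measurable_snd.comp (measurable_subtype_coe.comp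
            (measurable_snd.comp measurable_subtype_coe)))))

variable [StandardBorelSpace G₀]

theorem measurableSet_arrow : MeasurableSet {q : X × G | 𝒳.anchor q.1 = 𝒢.r q.2} :=
  measurableSet_eq_fun (𝒳.measurable_anchor.comp measurable_fst)
    (𝒢.measurable_r.comp measurable_snd)

theorem measurableSet_image {A : Set 𝒳.Arrow} (hA : MeasurableSet A) :
    MeasurableSet (Subtype.val '' A : Set (X × G)) :=
  MeasurableSet.subtype_image 𝒳.measurableSet_arrow hA

theorem measurableEmbedding_val : MeasurableEmbedding (Subtype.val : 𝒳.Arrow → X × G) :=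
  MeasurableEmbedding.subtype_coe 𝒳.measurableSet_arrow

variable [StandardBorelSpace X]

/-- The measure `δ_x × λ^{r(x)}` on the arrows of the semi-direct groupoid. -/
def haarMeasure (lam : HaarSystem 𝒢) (x : X) : Measure 𝒳.Arrow :=
  ((lam.kernel (𝒳.anchor x)).map (Prod.mk x)).comap Subtype.val

theorem haarMeasure_apply (lam : HaarSystem 𝒢) (x : X) (A : Set 𝒳.Arrow) :
    𝒳.haarMeasure lam x A =
      lam.kernel (𝒳.anchor x) {γ | ∃ h : 𝒳.anchor x = 𝒢.r γ, (⟨(x, γ), h⟩ : 𝒳.Arrow) ∈ A} := by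
  rw [haarMeasure, 𝒳.measurableEmbedding_val.comap_apply,
    (measurableEmbedding_prodMk_left x).map_apply]
  congr 1
  ext γ
  simp

theorem haarMeasure_lintegral (lam : HaarSystem 𝒢) (x : X) {f : G → ℝ≥0∞} (hf : Measurable f) :
    ∫⁻ q, f q.1.2 ∂(𝒳.haarMeasure lam x) = ∫⁻ γ, f γ ∂(lam.kernel (𝒳.anchor x)) := by
  have hmap : (𝒳.haarMeasure lam x).map (fun q : 𝒳.Arrow => q.1.2) = lam.kernel (𝒳.anchor x) := by
    ext B hB
    have hsnd : Measurable fun q : 𝒳.Arrow => q.1.2 := measurable_snd.comp measurable_subtype_coe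
    rw [Measure.map_apply hsnd hB, 𝒳.haarMeasure_apply lam x]
    refine measure_congr ?_
    have h0 : ∀ᵐ γ ∂(lam.kernel (𝒳.anchor x)), 𝒢.r γ = 𝒳.anchor x := lam.fibre _
    filter_upwards [h0] with γ hγ
    refine propext (Iff.intro ?_ ?_)
    · rintro ⟨_, hmem⟩
      exact hmem
    · intro hmem
      exact ⟨hγ.symm, hmem⟩
  have hsnd : Measurable fun q : 𝒳.Arrow => q.1.2 := measurable_snd.comp measurable_subtype_coe
  rw [← hmap, lintegral_map hf hsnd]

/-- The Haar system `{δ_x × λ^{r(x)}}` of the semi-direct groupoid. -/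
def haar (lam : HaarSystem 𝒢) : HaarSystem 𝒳.semidirect where
  kernel :=
    { toFun := 𝒳.haarMeasure lam
      measurable' := by
        refine Measure.measurable_of_measurable_coe _ fun A hA => ?_
        have h := Kernel.measurable_kernel_prodMk_left
          (κ := lam.kernel.comap 𝒳.anchor 𝒳.measurable_anchor) (𝒳.measurableSet_image hA)
        convert h using 2 with x
        rw [𝒳.haarMeasure_apply, Kernel.comap_apply]
        congr 1
        ext γ
        simp }
  fibre x := by
    change 𝒳.haarMeasure lam x {q | q.1.1 ≠ x} = 0
    rw [𝒳.haarMeasure_apply]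
    simp
  invariant q A hA := by
    obtain ⟨⟨x, γ⟩, hq⟩ := q
    change 𝒳.haarMeasure lam (𝒳.invAct γ x hq) _ = 𝒳.haarMeasure lam x A
    rw [𝒳.haarMeasure_apply, 𝒳.haarMeasure_apply]
    have hB : MeasurableSet {δ | ∃ h : 𝒳.anchor x = 𝒢.r δ, (⟨(x, δ), h⟩ : 𝒳.Arrow) ∈ A} := by
      convert measurable_prodMk_left (x := x) (𝒳.measurableSet_image hA) using 1
      ext δ
      simp
    have hx : 𝒳.anchor x = 𝒢.r γ := hq
    refine Eq.trans ?_ ((lam.invariant γ _ hB).trans (congrArg (fun z => lam.kernel z _) hx.symm))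
    have hs : 𝒳.anchor (𝒳.invAct γ x hq) = 𝒢.s γ := 𝒳.anchor_invAct γ x hq
    refine Eq.trans (congrArg (lam.kernel (𝒳.anchor (𝒳.invAct γ x hq))) ?_) (by rw [hs])
    ext γ'
    constructor
    · rintro ⟨h, h', hmem⟩
      exact ⟨hs.symm.trans h, hx.trans (𝒢.r_mul _ _ _).symm, hmem⟩
    · rintro ⟨h, h', hmem⟩
      exact ⟨hs.trans h, rfl, hmem⟩
  proper := by
    obtain ⟨f, hf, hpos, hint⟩ := lam.proper
    refine ⟨fun q => f q.1.2, hf.comp (measurable_snd.comp measurable_subtype_coe),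
      fun q => hpos _, fun x => ?_⟩
    exact (𝒳.haarMeasure_lintegral lam x hf.coe_nnreal_ennreal).trans (hint _)

end GSpace

end GSpace

/-! ### Pairs of measured `G`-spaces -/

section Pair

variable {G₀ : Type u} {G : Type v} {X Y : Type w} [MeasurableSpace G₀] [MeasurableSpace G]
  [MeasurableSpace X] [MeasurableSpace Y] [StandardBorelSpace G₀] [StandardBorelSpace X]
  [StandardBorelSpace Y] {𝒢 : BorelGroupoid G₀ G}

/-- `((Y, ν), (X, μ), p)` is a pair of measured `G`-spaces: `ν` and `μ` are quasi-invariant, `p` is an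
equivariant Borel map, and `μ` is equivalent to the image under `p` of the class of `ν`. -/
structure IsMeasuredPair (lam : HaarSystem 𝒢) (𝒴 : GSpace 𝒢 Y) (𝒳 : GSpace 𝒢 X) (ν : Measure Y)
    (μ : Measure X) (p : Y → X) : Prop where
  quasiInvariant_ν : QuasiInvariant (𝒴.haar lam) ν
  quasiInvariant_μ : QuasiInvariant (𝒳.haar lam) μ
  measurable_p : Measurable p
  anchor_p : ∀ y, 𝒳.anchor (p y) = 𝒴.anchor y
  equivariant : ∀ γ y h, p (𝒴.act γ y h) = 𝒳.act γ (p y) (h.trans (anchor_p y).symm)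
  map_ac : ν.map p ≪ μ
  ac_map : μ ≪ ν.map p

/-- The pair is measure preserving: `ν = ∫ ρ^x dμ(x)` for an invariant Borel system `(ρ^x)` of
probability measures on the fibres of `p`. -/
def IsMeasurePreservingPair (𝒴 : GSpace 𝒢 Y) (𝒳 : GSpace 𝒢 X) (ν : Measure Y) (μ : Measure X)
    (p : Y → X) : Prop :=
  ∃ ρ : Kernel X Y, IsMarkovKernel ρ ∧ (∀ x, ρ x {y | p y ≠ x} = 0) ∧
    (∀ (γ : G) (x : X) (h : 𝒢.s γ = 𝒳.anchor x) (A : Set Y), MeasurableSet A →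
      ρ x {y | ∃ h' : 𝒢.s γ = 𝒴.anchor y, 𝒴.act γ y h' ∈ A} = ρ (𝒳.act γ x h) A) ∧
    ν = μ.bind ρ

end Pair

end MeasGpd

end

/-! (i) A representation of `Y ⋊ G` induces one of `X ⋊ G`. The fibre at `x` is the space of square
integrable sections over `(p⁻¹(x), ρ^x)`, and arrows act by translation, isometrically because `γρ^x
= ρ^{γx}`. The induced space is the completion of the bounded Borel sections, which serve all the
measures `ρ^x` at once. Almost invariant unit sections restrict to unit vectors, since `ρ^x` is a
probability measure, and dominated convergence keeps them almost invariant
(`almostHasUnitInvariantSections_induced`). Property T of `X` then gives an invariant unit section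
`u`. Each `u(x)` is only a point of a completion; a Borel choice of approximants with errors `4⁻ᵏ`
converges almost everywhere on every fibre to an honest section `η` over `Y`
(`exists_pointwise_limit`), which is invariant (`fibreL_eq_of_inducedL_eq`) and not almost
everywhere zero unless the measure is zero. The function `‖η‖` is invariant, so ergodicity of `Y`
allows normalisation.

(ii) An invariant section of a pulled-back representation can be integrated along the fibres of `p`
to an invariant section over `X`, but the integral may vanish. The remedy is to find invariant
fields over `Y` that approach sections `ξₖ` pulled back from `X`. Let `ξₖ` be almost invariant unit
sections over `X`. Along a subsequence, the formal sequence `V = (k ξₖ)` satisfies `L(γ)V - V ∈ ℓ²`,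
so `w ↦ L(γ)(w + V) - V` is an isometric affine action on `ℓ²`-sequences; `r`-discreteness turns an
almost everywhere statement about arrows into one about all arrows of a reduction
(`exists_isAffineOn`).

The kernels `exp(-‖v - w‖²/(i+1))` are positive definite and depend only on distances, so affine
isometries become linear isometries of a Gaussian Hilbert space. The vectors located at `0` become
almost invariant as `i → ∞`. Property T of `Y` therefore gives an invariant unit field `u(y)` of the
pulled-back Gaussian representation. The points `w` at which `|⟨vec w i, u(y)⟩| > δ` form an open
bounded set that moves equivariantly (`Gauss.isBounded_superlevel`, `Gauss.superlevel_map`). When it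
is nonempty, its Chebyshev centre `c` is fixed by the affine action, which says that every `cₖ + k
ξₖ` is invariant under `L`. As `c ∈ ℓ²`, the normalisations approach `ξₖ`.

If `X` had no invariant unit section, ergodicity would make all fibre integrals of these fields
vanish. Pairing with `ξₖ` and letting `k → ∞` shows that the superlevel sets are almost everywhere
empty, for all `i` and `δ`, so `u = 0` almost everywhere, which contradicts `‖u‖ = 1` unless the
measure is zero. -/

noncomputable section

namespace MeasGpd

/-! ### The Hilbert space of a positive semidefinite form -/

section Hilb

variable {V : Type u} [AddCommGroup V] [Module ℂ V]

/-- The vector space `V` with the semi-norm of a positive semidefinite form. -/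
@[nolint unusedArguments]
def PreHilb (_ : PreInnerProductSpace.Core ℂ V) : Type u := V

instance (c : PreInnerProductSpace.Core ℂ V) : SeminormedAddCommGroup (PreHilb c) :=
  @InnerProductSpace.Core.toSeminormedAddCommGroup ℂ V _ _ _ c

instance (c : PreInnerProductSpace.Core ℂ V) : InnerProductSpace ℂ (PreHilb c) :=
  @InnerProductSpace.ofCore ℂ V _ _ _ c

/-- The Hilbert space obtained from `V` by separation and completion. -/
def Hilb (c : PreInnerProductSpace.Core ℂ V) : Type u := UniformSpace.Completion (PreHilb c)

instance (c : PreInnerProductSpace.Core ℂ V) : NormedAddCommGroup (Hilb c) :=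
  inferInstanceAs (NormedAddCommGroup (UniformSpace.Completion (PreHilb c)))

instance (c : PreInnerProductSpace.Core ℂ V) : InnerProductSpace ℂ (Hilb c) :=
  inferInstanceAs (InnerProductSpace ℂ (UniformSpace.Completion (PreHilb c)))

instance (c : PreInnerProductSpace.Core ℂ V) : CompleteSpace (Hilb c) :=
  inferInstanceAs (CompleteSpace (UniformSpace.Completion (PreHilb c)))

namespace Hilb

/-- The canonical map of `V` into its separated completion. -/
def mk (c : PreInnerProductSpace.Core ℂ V) : V →ₗ[ℂ] Hilb c :=
  (UniformSpace.Completion.toComplₗᵢ (𝕜 := ℂ) (E := PreHilb c)).toLinearMap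

theorem inner_mk (c : PreInnerProductSpace.Core ℂ V) (a b : V) :
    inner ℂ (mk c a) (mk c b) = c.inner a b :=
  UniformSpace.Completion.inner_coe (𝕜 := ℂ) (E := PreHilb c) a b

theorem denseRange_mk (c : PreInnerProductSpace.Core ℂ V) : DenseRange (mk c) :=
  UniformSpace.Completion.denseRange_coe (α := PreHilb c)

theorem norm_sq_mk (c : PreInnerProductSpace.Core ℂ V) (a : V) :
    ‖mk c a‖ ^ 2 = (c.inner a a).re := by
  rw [← inner_mk, ← inner_self_eq_norm_sq (𝕜 := ℂ)]
  rfl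

/-- The extension to the completion of a linear map that does not increase norms. -/
def lift (c : PreInnerProductSpace.Core ℂ V) {F : Type v} [NormedAddCommGroup F]
    [InnerProductSpace ℂ F] [CompleteSpace F] (f : V →ₗ[ℂ] F) : Hilb c →L[ℂ] F :=
  f.extendOfNorm (mk c)

variable (c : PreInnerProductSpace.Core ℂ V) {F : Type v} [NormedAddCommGroup F]
    [InnerProductSpace ℂ F] [CompleteSpace F] (f : V →ₗ[ℂ] F)

theorem lift_mk (hf : ∀ a, ‖f a‖ = ‖mk c a‖) (a : V) : lift c f (mk c a) = f a :=
  LinearMap.extendOfNorm_eq (denseRange_mk c) ⟨1, fun x => by rw [one_mul]; exact (hf x).le⟩ a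

theorem norm_lift (hf : ∀ a, ‖f a‖ = ‖mk c a‖) (v : Hilb c) : ‖lift c f v‖ = ‖v‖ := by
  refine (denseRange_mk c).induction_on v
    (isClosed_eq (lift c f).continuous.norm continuous_norm) fun a => ?_
  rw [lift_mk c f hf, hf]

theorem ext_mk (c : PreInnerProductSpace.Core ℂ V) {F : Type v} [NormedAddCommGroup F]
    [InnerProductSpace ℂ F] {f g : Hilb c →L[ℂ] F} (h : ∀ a, f (mk c a) = g (mk c a)) : f = g := by
  ext v
  exact (denseRange_mk c).induction_on v (isClosed_eq f.continuous g.continuous) h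

end Hilb

end Hilb

/-! ### Positive semidefinite kernels -/

section Kernels

open scoped ComplexOrder Matrix

variable {ι : Type u}

/-- Symmetry and nonnegativity of each finitely supported form involve finitely many entries at a
time, so both pass to entrywise limits. -/
theorem posSemidef_of_tendsto {M : ℕ → Matrix ι ι ℂ} {A : Matrix ι ι ℂ}
    (hM : ∀ n, (M n).PosSemidef) (h : ∀ i j, Tendsto (fun n => M n i j) atTop (𝓝 (A i j))) :
    A.PosSemidef := by
  refine ⟨?_, fun x => ?_⟩
  · ext i j
    refine tendsto_nhds_unique ?_ (h i j)
    have := (continuous_star.tendsto _).comp (h j i)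
    refine this.congr fun n => ?_
    exact (hM n).1.apply i j
  · refine ge_of_tendsto' (f := fun n => x.sum fun i xi => x.sum fun j xj => star xi * M n i j * xj)
      (x := atTop) ?_ fun n => (hM n).2 x
    refine tendsto_finsetSum _ fun i _ => tendsto_finsetSum _ fun j _ => ?_
    exact ((h i j).const_mul _).mul_const _

theorem posSemidef_congr {A B : Matrix ι ι ℂ} (hA : A.PosSemidef) (h : ∀ i j, A i j = B i j) :
    B.PosSemidef := by
  obtain rfl : A = B := Matrix.ext h
  exact hA

/-- The quadratic form is the square modulus of `∑ gᵢ xᵢ`. -/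
theorem posSemidef_mul_conj (g : ι → ℂ) :
    (Matrix.of fun i j => star (g i) * g j : Matrix ι ι ℂ).PosSemidef := by
  refine ⟨?_, fun x => ?_⟩
  · ext i j
    simp [mul_comm]
  · have : (x.sum fun i xi => x.sum fun j xj =>
        star xi * (Matrix.of fun i j => star (g i) * g j : Matrix ι ι ℂ) i j * xj) =
        star (x.sum fun i xi => g i * xi) * (x.sum fun j xj => g j * xj) := by
      simp only [Finsupp.sum, star_sum, Finset.sum_mul_sum, Matrix.of_apply]
      refine Finset.sum_congr rfl fun i _ => Finset.sum_congr rfl fun j _ => ?_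
      simp only [star_mul']
      ring
    rw [this]
    exact star_mul_self_nonneg _

theorem posSemidef_pow {M : Matrix ι ι ℂ} (hM : M.PosSemidef) (n : ℕ) :
    (Matrix.of fun i j => M i j ^ n : Matrix ι ι ℂ).PosSemidef := by
  induction n with
  | zero =>
    exact posSemidef_congr (posSemidef_mul_conj (fun _ : ι => (1 : ℂ))) fun i j => by simp
  | succ n ih =>
    exact posSemidef_congr (ih.hadamard hM) fun i j => (pow_succ _ _).symm

/-- The exponential series has nonnegative coefficients, and entrywise powers stay positive
semidefinite by the Schur product theorem. -/
theorem posSemidef_exp {M : Matrix ι ι ℂ} (hM : M.PosSemidef) :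
    (Matrix.of fun i j => Complex.exp (M i j) : Matrix ι ι ℂ).PosSemidef := by
  refine posSemidef_of_tendsto (M := fun n =>
    ∑ k ∈ Finset.range n, ((k.factorial : ℝ)⁻¹ : ℝ) • (Matrix.of fun i j => M i j ^ k))
    (fun n => ?_) fun i j => ?_
  · refine Matrix.posSemidef_sum _ fun k _ => ?_
    exact (posSemidef_pow hM k).smul (by positivity)
  · have := (NormedSpace.expSeries_div_hasSum_exp (M i j)).tendsto_sum_nat
    rw [← Complex.exp_eq_exp_ℂ] at this
    refine this.congr fun n => ?_
    rw [Matrix.sum_apply]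
    refine Finset.sum_congr rfl fun k _ => ?_
    simp [div_eq_inv_mul]

/-- The real part is the mean of the Gram kernel and its transpose. It is the real part that occurs
in the expansion of `‖v - w‖²`. -/
theorem posSemidef_re_inner (F : Type u) [NormedAddCommGroup F] [InnerProductSpace ℂ F] :
    (Matrix.of fun v w : F => (((inner ℂ v w).re : ℝ) : ℂ)).PosSemidef := by
  have h1 : (Matrix.of fun v w : F => inner ℂ v w).PosSemidef := by
    refine ⟨?_, fun x => ?_⟩
    · ext i j
      simp
    · have : (x.sum fun i xi => x.sum fun j xj =>
          star xi * (Matrix.of fun v w : F => inner ℂ v w) i j * xj) =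
          inner ℂ (x.sum fun i xi => xi • i) (x.sum fun i xi => xi • i) := by
        simp only [Finsupp.sum, sum_inner, inner_smul_left, Matrix.of_apply]
        refine Finset.sum_congr rfl fun i _ => ?_
        rw [inner_sum, Finset.mul_sum]
        refine Finset.sum_congr rfl fun j _ => ?_
        rw [inner_smul_right, RCLike.star_def]
        ring
      rw [this, inner_self_eq_norm_sq_to_K]
      positivity
  have h2 := (h1.add h1.transpose).smul (show (0 : ℝ) ≤ 1 / 2 by norm_num)
  refine posSemidef_congr h2 fun v w => ?_
  change (1 / 2 : ℝ) • (inner ℂ v w + inner ℂ w v) = (((inner ℂ v w).re : ℝ) : ℂ)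
  rw [Complex.re_eq_add_conj, inner_conj_symm, Complex.real_smul]
  push_cast
  ring

/-- The Gaussian kernels `exp (-‖v - w‖² / (i + 1))`, `i ∈ ℕ`, on the disjoint union of countably
many copies of a Hilbert space. -/
def gaussKernel (F : Type u) [NormedAddCommGroup F] : Matrix (F × ℕ) (F × ℕ) ℂ :=
  Matrix.of fun a b =>
    if a.2 = b.2 then ((Real.exp (-(‖a.1 - b.1‖ ^ 2 / (a.2 + 1))) : ℝ) : ℂ) else 0

/-- Schoenberg's factorisation: `exp(-‖v - w‖²) = exp(-‖v‖²) exp(-‖w‖²) exp(2 Re⟨v, w⟩)` is the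
Hadamard product of a rank one kernel and an exponential kernel. Rescaling points of the `i`-th copy
by `1/√(i+1)` and multiplying by the identity kernel on `ℕ` gives the general case. -/
theorem gaussKernel_posSemidef (F : Type u) [NormedAddCommGroup F] [InnerProductSpace ℂ F] :
    (gaussKernel F).PosSemidef := by
  have hN : (Matrix.of fun v w : F => ((Real.exp (-‖v - w‖ ^ 2) : ℝ) : ℂ)).PosSemidef := by
    have h1 := posSemidef_exp ((posSemidef_re_inner F).smul (show (0 : ℝ) ≤ 2 by norm_num))
    have h2 := posSemidef_mul_conj (fun v : F => ((Real.exp (-‖v‖ ^ 2) : ℝ) : ℂ))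
    refine posSemidef_congr (h2.hadamard h1) fun v w => ?_
    simp only [Matrix.of_apply, Matrix.hadamard_apply, Matrix.smul_apply, RCLike.star_def,
      Complex.conj_ofReal]
    have h4 := norm_sub_sq (𝕜 := ℂ) v w
    have h5 : RCLike.re (inner ℂ v w) = (inner ℂ v w).re := rfl
    rw [h5] at h4
    rw [Complex.real_smul, ← Complex.ofReal_mul 2, ← Complex.ofReal_exp, ← Complex.ofReal_mul,
      ← Complex.ofReal_mul, ← Real.exp_add, ← Real.exp_add, h4]
    congr 2
    ring
  have hd : (Matrix.of fun a b : F × ℕ => if a.2 = b.2 then (1 : ℂ) else 0).PosSemidef := by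
    have : (1 : Matrix ℕ ℕ ℂ).PosSemidef := Matrix.PosSemidef.one
    refine posSemidef_congr (this.submatrix (Prod.snd : F × ℕ → ℕ)) fun a b => ?_
    simp [Matrix.one_apply]
  refine posSemidef_congr
    (hd.hadamard (hN.submatrix fun a : F × ℕ => (((√(a.2 + 1))⁻¹ : ℝ) : ℂ) • a.1)) fun a b => ?_
  simp only [gaussKernel, Matrix.of_apply, Matrix.hadamard_apply, Matrix.submatrix_apply]
  split_ifs with h
  · rw [h, ← smul_sub, norm_smul, mul_pow, one_mul, Complex.norm_real, Real.norm_eq_abs, sq_abs,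
      inv_pow, Real.sq_sqrt (by positivity)]
    congr 3
    rw [div_eq_inv_mul]
  · simp

/-- The semi-inner product on finitely supported functions defined by a positive semidefinite
kernel. -/
@[reducible] def kernelCore {M : Matrix ι ι ℂ} (hM : M.PosSemidef) : PreInnerProductSpace.Core ℂ (ι →₀ ℂ) where
  inner f g := f.sum fun i a => g.sum fun j b => star a * M i j * b
  conj_inner_symm f g := by
    rw [Finsupp.sum_comm]
    simp only [Finsupp.sum, map_sum]
    refine Finset.sum_congr rfl fun i _ => Finset.sum_congr rfl fun j _ => ?_
    rw [← hM.1.apply]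
    simp [mul_comm, mul_left_comm]
    ring
  add_left _ _ _ := by
    rw [Finsupp.sum_add_index'] <;> simp [← Finsupp.sum_add, add_mul]
  smul_left _ _ _ := by
    rw [Finsupp.sum_smul_index] <;> simp [Finsupp.mul_sum, ← mul_assoc]
  re_inner_nonneg f := (Complex.nonneg_iff.1 (hM.2 f)).1

end Kernels

/-! ### Gaussian Hilbert spaces -/

section Gauss

variable (F : Type u) [NormedAddCommGroup F] [InnerProductSpace ℂ F]

/-- The Hilbert space with reproducing kernel `gaussKernel F`. -/
abbrev Gauss : Type u := Hilb (kernelCore (gaussKernel_posSemidef F))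

namespace Gauss

variable {F}

/-- The total family of vectors of the Gaussian Hilbert space. -/
def vec (w : F) (i : ℕ) : Gauss F :=
  Hilb.mk (kernelCore (gaussKernel_posSemidef F)) (Finsupp.single (w, i) 1)

theorem inner_vec (v w : F) (i j : ℕ) :
    inner ℂ (vec v i) (vec w j) =
      if i = j then ((Real.exp (-(‖v - w‖ ^ 2 / (i + 1))) : ℝ) : ℂ) else 0 := by
  rw [vec, vec, Hilb.inner_mk]
  change Finsupp.sum _ _ = _
  simp [gaussKernel]

theorem norm_vec (v : F) (i : ℕ) : ‖vec v i‖ = 1 := by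
  have h := inner_vec v v i i
  rw [inner_self_eq_norm_sq_to_K] at h
  simp only [↓reduceIte, sub_self, norm_zero, ne_eq, OfNat.ofNat_ne_zero, not_false_eq_true,
    zero_pow, zero_div, neg_zero, Real.exp_zero, Complex.ofReal_one] at h
  have h2 : ‖vec v i‖ ^ 2 = 1 := Complex.ofReal_injective (by push_cast; exact h)
  exact (pow_eq_one_iff_of_nonneg (norm_nonneg _) two_ne_zero).1 h2

/-- The source of both continuity in the point and, as `i → ∞`, of almost invariance. -/
theorem norm_vec_sub_sq (v w : F) (i : ℕ) :
    ‖vec v i - vec w i‖ ^ 2 = 2 - 2 * Real.exp (-(‖v - w‖ ^ 2 / (i + 1))) := by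
  rw [norm_sub_sq (𝕜 := ℂ), norm_vec, norm_vec, inner_vec]
  simp only [↓reduceIte, RCLike.re_to_complex, Complex.ofReal_re]
  ring

theorem continuous_vec (i : ℕ) : Continuous fun v : F => vec v i := by
  rw [continuous_iff_continuousAt]
  intro v
  rw [ContinuousAt, tendsto_iff_norm_sub_tendsto_zero]
  have h : Tendsto (fun w : F => ‖vec w i - vec v i‖ ^ 2) (𝓝 v) (𝓝 0) := by
    have hc : Continuous fun w : F => 2 - 2 * Real.exp (-(‖w - v‖ ^ 2 / (i + 1))) := by fun_prop
    have := hc.tendsto v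
    simp only [sub_self, norm_zero, ne_eq, OfNat.ofNat_ne_zero, not_false_eq_true, zero_pow,
      zero_div, neg_zero, Real.exp_zero, mul_one] at this
    exact this.congr fun w => (norm_vec_sub_sq w v i).symm
  have := (Real.continuous_sqrt.tendsto 0).comp h
  simpa [Function.comp_def, Real.sqrt_sq] using this

theorem mk_eq_sum (f : F × ℕ →₀ ℂ) : Hilb.mk (kernelCore (gaussKernel_posSemidef F)) f =
    f.sum fun a z => z • vec a.1 a.2 := by
  conv_lhs => rw [← Finsupp.sum_single f]
  rw [Finsupp.sum, map_sum]
  refine Finset.sum_congr rfl fun a _ => ?_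
  change _ = f a • Hilb.mk _ (Finsupp.single (a.1, a.2) 1)
  rw [← map_smul]
  simp

/-- Induction for closed subspaces of a Gaussian Hilbert space. -/
theorem induction {P : Gauss F → Prop} (hvec : ∀ w i, P (vec w i)) (h0 : P 0)
    (hadd : ∀ u v, P u → P v → P (u + v)) (hsmul : ∀ (z : ℂ) u, P u → P (z • u))
    (hclosed : IsClosed {u | P u}) (u : Gauss F) : P u := by
  refine (Hilb.denseRange_mk _).induction_on u hclosed fun f => ?_
  rw [mk_eq_sum]
  exact Finset.sum_induction _ P hadd h0 fun a _ => hsmul _ _ (hvec _ _)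

/-- A vector orthogonal to the total family vanishes. -/
theorem eq_zero_of_inner_vec {u : Gauss F} (h : ∀ w i, inner ℂ (vec w i) u = 0) : u = 0 := by
  have : inner ℂ u u = 0 := by
    refine induction (P := fun v => inner ℂ v u = 0) h (inner_zero_left _) ?_ ?_ ?_ u
    · intro v w hv hw
      rw [inner_add_left, hv, hw, add_zero]
    · intro z v hv
      rw [inner_smul_left, hv, mul_zero]
    · exact isClosed_eq (by fun_prop) continuous_const
  exact inner_self_eq_zero.1 this

variable {F' : Type u} [NormedAddCommGroup F'] [InnerProductSpace ℂ F']
  {F'' : Type u} [NormedAddCommGroup F''] [InnerProductSpace ℂ F'']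

/-- The operator between Gaussian Hilbert spaces induced by an isometry. -/
def map (φ : F → F') : Gauss F →L[ℂ] Gauss F' :=
  Hilb.lift (kernelCore (gaussKernel_posSemidef F))
    (Hilb.mk (kernelCore (gaussKernel_posSemidef F')) ∘ₗ
      Finsupp.lmapDomain ℂ ℂ fun a : F × ℕ => (φ a.1, a.2))

/-- The kernel sees only the index `i` and distances, so relabelling points along an isometry
preserves the form. Linearity of `φ` plays no role, which is how affine maps come to act linearly.
-/
theorem norm_mk_mapDomain {φ : F → F'} (hφ : Isometry φ) (f : F × ℕ →₀ ℂ) :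
    ‖(Hilb.mk (kernelCore (gaussKernel_posSemidef F')) ∘ₗ
      Finsupp.lmapDomain ℂ ℂ fun a : F × ℕ => (φ a.1, a.2)) f‖ =
    ‖Hilb.mk (kernelCore (gaussKernel_posSemidef F)) f‖ := by
  rw [← sq_eq_sq₀ (norm_nonneg _) (norm_nonneg _), LinearMap.comp_apply, Hilb.norm_sq_mk,
    Hilb.norm_sq_mk]
  congr 1
  change Finsupp.sum _ _ = Finsupp.sum _ _
  rw [Finsupp.lmapDomain_apply, Finsupp.sum_mapDomain_index]
  · refine Finset.sum_congr rfl fun a _ => ?_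
    simp only
    rw [Finsupp.sum_mapDomain_index]
    · refine Finset.sum_congr rfl fun b _ => ?_
      have : ‖φ a.1 - φ b.1‖ = ‖a.1 - b.1‖ := by
        rw [← dist_eq_norm, ← dist_eq_norm, hφ.dist_eq]
      simp [gaussKernel, this]
    · simp
    · intros; ring
  · simp
  · intro a z z'
    simp [Finsupp.sum, add_mul, Finset.sum_add_distrib]

theorem map_vec {φ : F → F'} (hφ : Isometry φ) (w : F) (i : ℕ) :
    map φ (vec w i) = vec (φ w) i := by
  rw [map, vec, Hilb.lift_mk _ _ (norm_mk_mapDomain hφ)]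
  simp [vec]

theorem norm_map {φ : F → F'} (hφ : Isometry φ) (u : Gauss F) : ‖map φ u‖ = ‖u‖ :=
  Hilb.norm_lift _ _ (norm_mk_mapDomain hφ) u

theorem clm_ext {G : Type v} [NormedAddCommGroup G] [InnerProductSpace ℂ G]
    {f g : Gauss F →L[ℂ] G} (h : ∀ w i, f (vec w i) = g (vec w i)) : f = g := by
  ext u
  refine induction (P := fun u => f u = g u) h (by simp) ?_ ?_
    (isClosed_eq f.continuous g.continuous) u
  · intro v w hv hw
    rw [map_add, map_add, hv, hw]
  · intro z v hv
    rw [map_smul, map_smul, hv]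

theorem map_comp {φ : F → F'} {ψ : F' → F''} (hφ : Isometry φ) (hψ : Isometry ψ) :
    map (fun w => ψ (φ w)) = (map ψ).comp (map φ) :=
  clm_ext fun w i => by
    rw [map_vec (φ := fun w => ψ (φ w)) (hψ.comp hφ), ContinuousLinearMap.comp_apply, map_vec hφ, map_vec hψ]

theorem inner_map {φ : F → F'} (hφ : Isometry φ) (u v : Gauss F) :
    inner ℂ (map φ u) (map φ v) = inner ℂ u v :=
  (LinearMap.norm_map_iff_inner_map_map (𝕜 := ℂ) (map φ)).1 (norm_map hφ) u v

theorem map_id : map (fun w : F => w) = ContinuousLinearMap.id ℂ (Gauss F) :=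
  clm_ext fun w i => by
    rw [map_vec (fun _ _ => rfl)]
    rfl

/-- The points whose vectors have a large inner product with `u`. -/
def superlevel (u : Gauss F) (i : ℕ) (δ : ℝ) : Set F := {w | δ < ‖inner ℂ (vec w i) u‖}

theorem isOpen_superlevel (u : Gauss F) (i : ℕ) (δ : ℝ) : IsOpen (superlevel u i δ) :=
  isOpen_lt continuous_const (((continuous_vec i).inner continuous_const).norm)

/-- The coefficient `w ↦ ⟨vec w i, u⟩` vanishes at infinity: this is clear for the total family, and
the property survives linear combinations and norm limits because the vectors `vec w i` have norm
one. -/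
theorem isBounded_superlevel (u : Gauss F) (i : ℕ) {δ : ℝ} (hδ : 0 < δ) :
    Bornology.IsBounded (superlevel u i δ) := by
  -- The induction is over `u` with all levels `δ` at once, since sums, multiples and limits change
  -- the level.
  suffices H : ∀ δ : ℝ, 0 < δ → Bornology.IsBounded (superlevel u i δ) from H δ hδ
  refine induction (P := fun u => ∀ δ : ℝ, 0 < δ → Bornology.IsBounded (superlevel u i δ))
    ?_ ?_ ?_ ?_ ?_ u
  · intro v j δ hδ
    by_cases hij : i = j
    · subst hij
      -- The radius solves `exp(-r²/(i+1)) = δ` when `δ ≤ 1`.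
      refine (Metric.isBounded_iff_subset_closedBall v).2 ⟨√((i + 1) * (-Real.log δ)), ?_⟩
      intro w hw
      rw [Metric.mem_closedBall, dist_eq_norm]
      refine Real.le_sqrt_of_sq_le ?_
      have h1 : δ < ‖inner ℂ (vec w i) (vec v i)‖ := hw
      rw [inner_vec, if_pos rfl, Complex.norm_real, Real.norm_eq_abs, abs_of_pos (Real.exp_pos _)]
        at h1
      have h2 := (Real.log_lt_iff_lt_exp hδ).2 h1
      have h3 : ‖w - v‖ ^ 2 / (i + 1) < -Real.log δ := by linarith
      have h4 := (div_lt_iff₀ (by positivity)).1 h3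
      nlinarith
    · refine Bornology.isBounded_empty.subset fun w hw => ?_
      have h1 : δ < ‖inner ℂ (vec w i) (vec v j)‖ := hw
      rw [inner_vec, if_neg hij, norm_zero] at h1
      exact absurd h1 hδ.not_gt
  · intro δ hδ
    refine Bornology.isBounded_empty.subset fun w hw => ?_
    have h1 : δ < ‖inner ℂ (vec w i) (0 : Gauss F)‖ := hw
    rw [inner_zero_right, norm_zero] at h1
    exact absurd h1 hδ.not_gt
  · intro v w hv hw δ hδ
    refine ((hv _ (half_pos hδ)).union (hw _ (half_pos hδ))).subset fun a ha => ?_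
    by_contra hcon
    simp only [superlevel, Set.mem_union, Set.mem_ofPred_eq, not_or, not_lt] at hcon
    have h1 : δ < ‖inner ℂ (vec a i) (v + w)‖ := ha
    rw [inner_add_right] at h1
    have := norm_add_le (inner ℂ (vec a i) v) (inner ℂ (vec a i) w)
    linarith
  · intro z v hv δ hδ
    by_cases hz : z = 0
    · refine Bornology.isBounded_empty.subset fun w hw => ?_
      have h1 : δ < ‖inner ℂ (vec w i) (z • v)‖ := hw
      rw [hz, zero_smul, inner_zero_right, norm_zero] at h1
      exact absurd h1 hδ.not_gt
    · have hz' : 0 < ‖z‖ := norm_pos_iff.2 hz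
      refine (hv (δ / ‖z‖) (div_pos hδ hz')).subset fun a ha => ?_
      have h1 : δ < ‖inner ℂ (vec a i) (z • v)‖ := ha
      rw [inner_smul_right, norm_mul] at h1
      change δ / ‖z‖ < _
      rw [div_lt_iff₀ hz']
      linarith
  · refine isClosed_of_closure_subset fun v hv δ hδ => ?_
    obtain ⟨w, hw, hvw⟩ := Metric.mem_closure_iff.1 hv (δ / 2) (half_pos hδ)
    refine (hw _ (half_pos hδ)).subset fun a ha => ?_
    have h1 : δ < ‖inner ℂ (vec a i) v‖ := ha
    have h2 : ‖inner ℂ (vec a i) (v - w)‖ ≤ ‖v - w‖ := by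
      have := norm_inner_le_norm (𝕜 := ℂ) (vec a i) (v - w)
      rwa [norm_vec, one_mul] at this
    rw [← dist_eq_norm] at h2
    have h3 : inner ℂ (vec a i) v = inner ℂ (vec a i) w + inner ℂ (vec a i) (v - w) := by
      rw [← inner_add_right, add_sub_cancel]
    have h4 := norm_add_le (inner ℂ (vec a i) w) (inner ℂ (vec a i) (v - w))
    rw [← h3] at h4
    change δ / 2 < _
    linarith

theorem superlevel_map {φ : F → F'} (hφ : Isometry φ) (hs : Function.Surjective φ) (u : Gauss F)
    (i : ℕ) (δ : ℝ) : superlevel (map φ u) i δ = φ '' superlevel u i δ := by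
  have key : ∀ w, φ w ∈ superlevel (map φ u) i δ ↔ w ∈ superlevel u i δ := fun w => by
    simp only [superlevel, Set.mem_ofPred_eq]
    rw [← map_vec hφ, inner_map hφ]
  ext w'
  obtain ⟨w, rfl⟩ := hs w'
  rw [key, hφ.injective.mem_set_image]

end Gauss

end Gauss

/-! ### Chebyshev centres -/

section Chebyshev

variable {F : Type u} [NormedAddCommGroup F]

/-- The largest distance of `v` to points of `Q`. -/
def farDist (Q : Set F) (v : F) : ℝ := sSup ((fun w => ‖v - w‖) '' Q)

/-- The infimum of the radii of the balls which contain `Q`. -/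
def chebyshevRadius (Q : Set F) : ℝ := ⨅ v, farDist Q v

variable {Q : Set F}

theorem bddAbove_farDist (hb : Bornology.IsBounded Q) (v : F) :
    BddAbove ((fun w => ‖v - w‖) '' Q) := by
  obtain ⟨r, hr⟩ := (Metric.isBounded_iff_subset_closedBall v).1 hb
  refine ⟨r, ?_⟩
  rintro _ ⟨w, hw, rfl⟩
  have := hr hw
  rwa [Metric.mem_closedBall, dist_eq_norm, norm_sub_rev] at this

theorem le_farDist (hb : Bornology.IsBounded Q) (v : F) {w : F} (hw : w ∈ Q) :
    ‖v - w‖ ≤ farDist Q v :=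
  le_csSup (bddAbove_farDist hb v) ⟨w, hw, rfl⟩

theorem farDist_le (hne : Q.Nonempty) {v : F} {c : ℝ} (h : ∀ w ∈ Q, ‖v - w‖ ≤ c) :
    farDist Q v ≤ c :=
  csSup_le (hne.image _) (by rintro _ ⟨w, hw, rfl⟩; exact h w hw)

theorem farDist_nonneg (v : F) : 0 ≤ farDist Q v :=
  Real.sSup_nonneg (by rintro _ ⟨w, -, rfl⟩; exact norm_nonneg _)

theorem farDist_le_add (hb : Bornology.IsBounded Q) (hne : Q.Nonempty) (v v' : F) :
    farDist Q v ≤ farDist Q v' + ‖v - v'‖ :=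
  farDist_le hne fun w hw => by
    have h1 := le_farDist hb v' hw
    have h2 := norm_sub_le_norm_sub_add_norm_sub v v' w
    linarith

theorem continuous_farDist (hb : Bornology.IsBounded Q) (hne : Q.Nonempty) :
    Continuous (farDist Q) := by
  refine (LipschitzWith.of_le_add fun v v' => ?_ : LipschitzWith 1 (farDist Q)).continuous
  rw [dist_eq_norm]
  exact farDist_le_add hb hne v v'

theorem bddBelow_range_farDist : BddBelow (Set.range (farDist Q)) :=
  ⟨0, by rintro _ ⟨v, rfl⟩; exact farDist_nonneg v⟩

theorem chebyshevRadius_le (v : F) : chebyshevRadius Q ≤ farDist Q v :=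
  ciInf_le bddBelow_range_farDist v

theorem chebyshevRadius_nonneg : 0 ≤ chebyshevRadius Q := Real.iInf_nonneg farDist_nonneg

variable [InnerProductSpace ℂ F]

/-- By the parallelogram law, the midpoint of `v` and `v'` is closer to every point of `Q` by an
amount controlled by `‖v - v'‖`, yet its farthest distance is at least the radius. This gives
existence, uniqueness and stability of the centre. -/
theorem norm_sub_sq_le_farDist (hb : Bornology.IsBounded Q) (hne : Q.Nonempty) (v v' : F) :
    ‖v - v'‖ ^ 2 ≤ 2 * farDist Q v ^ 2 + 2 * farDist Q v' ^ 2 - 4 * chebyshevRadius Q ^ 2 := by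
  set a := farDist Q v
  set b := farDist Q v'
  set m : F := (1 / 2 : ℂ) • (v + v')
  have ha : 0 ≤ a := farDist_nonneg v
  have hb' : 0 ≤ b := farDist_nonneg v'
  have key : ∀ w ∈ Q, ‖m - w‖ ^ 2 ≤ (2 * a ^ 2 + 2 * b ^ 2 - ‖v - v'‖ ^ 2) / 4 := by
    intro w hw
    have h1 := parallelogram_law_with_norm ℂ (v - w) (v' - w)
    have h2 : (v - w) + (v' - w) = (2 : ℂ) • (m - w) := by
      simp only [m, smul_sub, smul_smul]
      norm_num
      rw [two_smul]
      abel
    have h3 : (v - w) - (v' - w) = v - v' := by abel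
    rw [h2, h3, norm_smul] at h1
    norm_num at h1
    have h4 : ‖v - w‖ ^ 2 ≤ a ^ 2 := pow_le_pow_left₀ (norm_nonneg _) (le_farDist hb v hw) 2
    have h5 : ‖v' - w‖ ^ 2 ≤ b ^ 2 := pow_le_pow_left₀ (norm_nonneg _) (le_farDist hb v' hw) 2
    nlinarith
  obtain ⟨w₀, hw₀⟩ := hne
  have hnn : 0 ≤ (2 * a ^ 2 + 2 * b ^ 2 - ‖v - v'‖ ^ 2) / 4 := (sq_nonneg _).trans (key w₀ hw₀)
  have h1 : farDist Q m ≤ √((2 * a ^ 2 + 2 * b ^ 2 - ‖v - v'‖ ^ 2) / 4) :=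
    farDist_le ⟨w₀, hw₀⟩ fun w hw => Real.le_sqrt_of_sq_le (key w hw)
  have h2 := (chebyshevRadius_le (Q := Q) m).trans h1
  have h3 := pow_le_pow_left₀ chebyshevRadius_nonneg h2 2
  rw [Real.sq_sqrt hnn] at h3
  linarith

/-- A minimising sequence is Cauchy by `norm_sub_sq_le_farDist`. -/
theorem exists_chebyshev [CompleteSpace F] (hb : Bornology.IsBounded Q) (hne : Q.Nonempty) :
    ∃ c, farDist Q c = chebyshevRadius Q := by
  set R := chebyshevRadius Q
  have hex : ∀ n : ℕ, ∃ v, farDist Q v < R + 1 / (n + 1) := fun n =>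
    exists_lt_of_ciInf_lt (lt_add_of_pos_right _ (by positivity))
  choose v hv using hex
  have hlim : Tendsto (fun n : ℕ => R + 1 / ((n : ℝ) + 1)) atTop (𝓝 R) := by
    simpa using (tendsto_const_nhds (x := R)).add
      (tendsto_one_div_add_atTop_nhds_zero_nat (𝕜 := ℝ))
  have hfar : Tendsto (fun n => farDist Q (v n)) atTop (𝓝 R) :=
    tendsto_of_tendsto_of_tendsto_of_le_of_le tendsto_const_nhds hlim
      (fun n => chebyshevRadius_le _) fun n => (hv n).le
  have hcauchy : CauchySeq v := by
    rw [Metric.cauchySeq_iff']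
    intro ε hε
    have h1 : Tendsto (fun n => 4 * farDist Q (v n) ^ 2 - 4 * R ^ 2) atTop (𝓝 0) := by
      have h := ((hfar.pow 2).const_mul 4).sub_const (4 * R ^ 2)
      have e : 4 * R ^ 2 - 4 * R ^ 2 = 0 := by ring
      rwa [e] at h
    have h2 := h1.eventually (gt_mem_nhds (show (0 : ℝ) < ε ^ 2 / 2 by positivity))
    obtain ⟨N, hN⟩ := eventually_atTop.1 h2
    refine ⟨N, fun n hn => ?_⟩
    have h3 := norm_sub_sq_le_farDist hb hne (v n) (v N)
    have h4 := hN n hn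
    have h5 := hN N le_rfl
    rw [dist_eq_norm]
    refine lt_of_pow_lt_pow_left₀ 2 hε.le ?_
    have : 0 < ε ^ 2 := by positivity
    change _ ≤ _ - 4 * R ^ 2 at h3
    linarith
  obtain ⟨c, hc⟩ := cauchySeq_tendsto_of_complete hcauchy
  exact ⟨c, tendsto_nhds_unique (((continuous_farDist hb hne).tendsto c).comp hc) hfar⟩

variable (Q) in
open Classical in
/-- The Chebyshev centre of a nonempty bounded set. -/
def chebyshevCenter : F :=
  if h : ∃ c, farDist Q c = chebyshevRadius Q then h.choose else 0

theorem farDist_chebyshevCenter [CompleteSpace F] (hb : Bornology.IsBounded Q)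
    (hne : Q.Nonempty) : farDist Q (chebyshevCenter Q) = chebyshevRadius Q := by
  have h := exists_chebyshev hb hne
  rw [chebyshevCenter, dif_pos h]
  exact h.choose_spec

theorem norm_sub_chebyshevCenter_sq_le [CompleteSpace F] (hb : Bornology.IsBounded Q)
    (hne : Q.Nonempty) (v : F) :
    ‖v - chebyshevCenter Q‖ ^ 2 ≤ 2 * farDist Q v ^ 2 - 2 * chebyshevRadius Q ^ 2 := by
  have h := norm_sub_sq_le_farDist hb hne v (chebyshevCenter Q)
  rw [farDist_chebyshevCenter hb hne] at h
  linarith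

theorem eq_chebyshevCenter [CompleteSpace F] (hb : Bornology.IsBounded Q) (hne : Q.Nonempty)
    {v : F} (hv : farDist Q v ≤ chebyshevRadius Q) : v = chebyshevCenter Q := by
  have h := norm_sub_chebyshevCenter_sq_le hb hne v
  rw [le_antisymm hv (chebyshevRadius_le v), sub_self] at h
  have h2 : ‖v - chebyshevCenter Q‖ = 0 := by
    have := sq_nonneg ‖v - chebyshevCenter Q‖
    exact pow_eq_zero_iff two_ne_zero |>.1 (le_antisymm h this)
  exact sub_eq_zero.1 (norm_eq_zero.1 h2)

/-- The centre is determined by distances alone. Surjectivity ensures that the infimum over `F'` is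
taken over the same radii as the one over `F`. -/
theorem chebyshevCenter_image [CompleteSpace F] {F' : Type u} [NormedAddCommGroup F']
    [InnerProductSpace ℂ F'] [CompleteSpace F'] {φ : F → F'} (hφ : Isometry φ)
    (hs : Function.Surjective φ) (hb : Bornology.IsBounded Q) (hne : Q.Nonempty) :
    chebyshevCenter (φ '' Q) = φ (chebyshevCenter Q) := by
  have hb' : Bornology.IsBounded (φ '' Q) := hφ.lipschitz.isBounded_image hb
  have key : ∀ v, farDist (φ '' Q) (φ v) = farDist Q v := fun v => by
    rw [farDist, farDist, Set.image_image]
    congr 1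
    refine Set.image_congr fun w _ => ?_
    rw [← dist_eq_norm, ← dist_eq_norm, hφ.dist_eq]
  refine (eq_chebyshevCenter hb' (hne.image _) ?_).symm
  rw [key, farDist_chebyshevCenter hb hne]
  have : Nonempty F' := ⟨0⟩
  refine le_ciInf fun w => ?_
  obtain ⟨v, rfl⟩ := hs w
  rw [key]
  exact chebyshevRadius_le v

end Chebyshev

theorem Measurable.of_eq {α : Type u} {β : Type v} [MeasurableSpace α] [MeasurableSpace β]
    {f g : α → β} (hf : Measurable f) (h : ∀ x, f x = g x) : Measurable g :=
  (funext h : f = g) ▸ hf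

namespace HilbertBundle

variable {X : Type u} [MeasurableSpace X] (H : HilbertBundle X)

/-! ### Borel sections of Hilbert bundles -/

/-- A section is Borel if its inner products with the fundamental sequence are. -/
def IsBorel (ξ : ∀ x, H.Fibre x) : Prop :=
  ∀ n, Measurable fun x => Inner.inner ℂ (H.fund n x) (ξ x)

theorem measurable_total_iff (ξ : ∀ x, H.Fibre x) :
    Measurable (fun x => (⟨x, ξ x⟩ : H.Total)) ↔ H.IsBorel ξ := by
  rw [measurable_comap_iff]
  constructor
  · intro h n
    exact (measurable_pi_iff.1 (measurable_snd.comp h)) n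
  · intro h
    exact measurable_id.prodMk (measurable_pi_iff.2 h)

variable {H}

theorem BorelSection.isBorel (ξ : H.BorelSection) : H.IsBorel ξ.toFun :=
  (H.measurable_total_iff _).1 ξ.measurable'

/-- The bundled form of a Borel section. -/
def IsBorel.toSection {ξ : ∀ x, H.Fibre x} (hξ : H.IsBorel ξ) : H.BorelSection :=
  ⟨ξ, (H.measurable_total_iff _).2 hξ⟩

theorem isBorel_fund (n : ℕ) : H.IsBorel (H.fund n) := fun m => H.measurable_inner m n

theorem isBorel_zero : H.IsBorel fun _ => 0 := fun n => by
  simp only [inner_zero_right, measurable_const]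

theorem IsBorel.add {ξ ζ : ∀ x, H.Fibre x} (hξ : H.IsBorel ξ) (hζ : H.IsBorel ζ) :
    H.IsBorel fun x => ξ x + ζ x := fun n => by
  simp only [inner_add_right]
  exact (hξ n).add (hζ n)

theorem IsBorel.smul {ξ : ∀ x, H.Fibre x} (hξ : H.IsBorel ξ) {c : X → ℂ} (hc : Measurable c) :
    H.IsBorel fun x => c x • ξ x := fun n => by
  simp only [inner_smul_right]
  exact hc.mul (hξ n)

theorem IsBorel.sub {ξ ζ : ∀ x, H.Fibre x} (hξ : H.IsBorel ξ) (hζ : H.IsBorel ζ) :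
    H.IsBorel fun x => ξ x - ζ x := fun n => by
  simp only [inner_sub_right]
  exact (hξ n).sub (hζ n)

theorem isBorel_sum {ι : Type*} (s : Finset ι) {ξ : ι → ∀ x, H.Fibre x}
    (hξ : ∀ i, H.IsBorel (ξ i)) : H.IsBorel fun x => ∑ i ∈ s, ξ i x := fun n => by
  simp only [inner_sum]
  exact Finset.measurable_fun_sum _ fun i _ => hξ i n

theorem IsBorel.ite {ξ ζ : ∀ x, H.Fibre x} (hξ : H.IsBorel ξ) (hζ : H.IsBorel ζ) {P : X → Prop}
    [DecidablePred P] (hP : MeasurableSet {x | P x}) :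
    H.IsBorel fun x => if P x then ξ x else ζ x := fun n => by
  refine Measurable.of_eq (f := fun x => if P x then Inner.inner ℂ (H.fund n x) (ξ x) else
    Inner.inner ℂ (H.fund n x) (ζ x)) (Measurable.ite hP (hξ n) (hζ n)) fun x => ?_
  by_cases h : P x <;> simp [h]

theorem isBorel_of_tendsto {ξ : ℕ → ∀ x, H.Fibre x} {ζ : ∀ x, H.Fibre x}
    (hξ : ∀ k, H.IsBorel (ξ k)) (h : ∀ x, Tendsto (fun k => ξ k x) atTop (𝓝 (ζ x))) :
    H.IsBorel ζ := fun n =>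
  measurable_of_tendsto_metrizable (fun k => hξ k n)
    (tendsto_pi_nhds.2 fun x => tendsto_const_nhds.inner (h x))

theorem isBorel_select {ξ : ℕ → ∀ x, H.Fibre x} (hξ : ∀ k, H.IsBorel (ξ k)) {N : X → ℕ}
    (hN : Measurable N) : H.IsBorel fun x => ξ (N x) x := fun n => by
  have h : Measurable fun q : ℕ × X => Inner.inner ℂ (H.fund n q.2) (ξ q.1 q.2) :=
    measurable_from_prod_countable_right fun k => hξ k n
  exact h.comp (hN.prodMk measurable_id)

/-! ### A dense sequence of sections -/

/-- A dense sequence of complex numbers which starts with `0`. -/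
def scalarSeq : ℕ → ℂ
  | 0 => 0
  | n + 1 => TopologicalSpace.denseSeq ℂ n

theorem scalarSeq_zero : scalarSeq 0 = 0 := rfl

theorem denseRange_scalarSeq : DenseRange scalarSeq :=
  (TopologicalSpace.denseRange_denseSeq ℂ).mono (by rintro _ ⟨n, rfl⟩; exact ⟨n + 1, rfl⟩)

/-- A sequence of finitely supported functions, dense in the natural sense. -/
def coeffSeq (m : ℕ) : ℕ →₀ ℂ :=
  ((exists_surjective_nat (ℕ →₀ ℕ)).choose m).mapRange scalarSeq scalarSeq_zero

variable (H) in
/-- A dense sequence of Borel sections. -/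
def denseSection (m : ℕ) (x : X) : H.Fibre x :=
  (coeffSeq m).sum fun i a => a • H.fund i x

/-- The fundamental sequence separates vectors, so its span is dense, and coefficients on a finite
support can be moved into a countable dense set of scalars. That set contains `0` at index `0`, so
finitely supported index functions yield finitely supported coefficients. -/
theorem denseRange_denseSection (x : X) : DenseRange fun m => H.denseSection m x := by
  have hspan : (Submodule.span ℂ (Set.range fun i => H.fund i x)).topologicalClosure = ⊤ := by
    rw [Submodule.topologicalClosure_eq_top_iff, Submodule.eq_bot_iff]
    intro v hv
    refine H.separating x v fun n => ?_
    exact (Submodule.mem_orthogonal _ _).1 hv _ (Submodule.subset_span ⟨n, rfl⟩)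
  have hsub : (Submodule.span ℂ (Set.range fun i => H.fund i x) : Set (H.Fibre x)) ⊆
      closure (Set.range fun m => H.denseSection m x) := by
    intro v hv
    obtain ⟨f, rfl⟩ := Finsupp.mem_span_range_iff_exists_finsupp.1 hv
    let g : (f.support → ℂ) → H.Fibre x := fun c => ∑ i, c i • H.fund i.1 x
    have hg : Continuous g := by
      refine continuous_finsetSum _ fun i _ => ?_
      exact (continuous_apply i).smul continuous_const
    have hfg : (f.sum fun i a => a • H.fund i x) = g fun i => f i := by
      rw [Finsupp.sum, ← Finset.sum_coe_sort]
    rw [hfg]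
    have hd : DenseRange (Pi.map fun (_ : f.support) => scalarSeq) :=
      DenseRange.piMap fun _ => denseRange_scalarSeq
    have h1 := image_closure_subset_closure_image hg ⟨_, hd fun i => f i, rfl⟩
    refine closure_mono ?_ h1
    rintro _ ⟨_, ⟨k, rfl⟩, rfl⟩
    obtain ⟨m, hm⟩ := (exists_surjective_nat (ℕ →₀ ℕ)).choose_spec
      (Finsupp.indicator f.support fun i hi => k ⟨i, hi⟩)
    refine ⟨m, ?_⟩
    simp only [denseSection, coeffSeq, hm]
    rw [Finsupp.sum_of_support_subset (s := f.support)]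
    · rw [← Finset.sum_coe_sort]
      refine Finset.sum_congr rfl fun i _ => ?_
      rw [Finsupp.mapRange_apply, Finsupp.indicator_of_mem i.2]
      rfl
    · exact (Finsupp.support_mapRange).trans (Finsupp.support_indicator_subset _ _)
    · simp
  have hcl : closure (Submodule.span ℂ (Set.range fun i => H.fund i x) : Set (H.Fibre x)) =
      Set.univ := by
    rw [← Submodule.topologicalClosure_coe, hspan, Submodule.top_coe]
  intro v
  have : v ∈ closure (closure (Set.range fun m => H.denseSection m x)) :=
    closure_mono hsub (hcl ▸ Set.mem_univ v)
  rwa [closure_closure] at this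

theorem isBorel_denseSection (m : ℕ) : H.IsBorel (H.denseSection m) :=
  isBorel_sum _ fun i => (isBorel_fund i).smul measurable_const

theorem IsBorel.measurable_inner_denseSection {ξ : ∀ x, H.Fibre x} (hξ : H.IsBorel ξ) (m : ℕ) :
    Measurable fun x => Inner.inner ℂ (H.denseSection m x) (ξ x) := by
  simp only [denseSection, Finsupp.sum, sum_inner, inner_smul_left]
  exact Finset.measurable_fun_sum _ fun i _ => measurable_const.mul (hξ i)

/-- Completing the square gives `2 Re⟨w, v⟩ - ‖w‖² = ‖v‖² - ‖w - v‖²`. Norms of Borel sections are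
thereby countable suprema of Borel functions. -/
theorem isLUB_norm_sq {E : Type*} [NormedAddCommGroup E] [InnerProductSpace ℂ E] {d : ℕ → E}
    (hd : DenseRange d) (v : E) :
    IsLUB {a | ∃ m, 2 * (Inner.inner ℂ (d m) v).re - ‖d m‖ ^ 2 = a} (‖v‖ ^ 2) := by
  have key : ∀ w : E, 2 * (Inner.inner ℂ w v).re - ‖w‖ ^ 2 = ‖v‖ ^ 2 - ‖w - v‖ ^ 2 := fun w => by
    have := norm_sub_sq (𝕜 := ℂ) w v
    simp only [RCLike.re_to_complex] at this
    linarith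
  constructor
  · rintro _ ⟨m, rfl⟩
    rw [key]
    have := sq_nonneg ‖d m - v‖
    linarith
  · intro b hb
    have h1 : ∀ w, 2 * (Inner.inner ℂ w v).re - ‖w‖ ^ 2 ≤ b := by
      refine fun w => hd.induction_on w (isClosed_le ?_ continuous_const) fun m => hb ⟨m, rfl⟩
      exact (continuous_const.mul (Complex.continuous_re.comp
        (continuous_id.inner continuous_const))).sub (continuous_norm.pow 2)
    have := h1 v
    rw [key] at this
    simpa using this

theorem measurable_norm_sq_denseSection (m : ℕ) :
    Measurable fun x => ‖H.denseSection m x‖ ^ 2 := by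
  have h := (isBorel_denseSection (H := H) m).measurable_inner_denseSection m
  refine Measurable.of_eq (Complex.measurable_re.comp h) fun x => ?_
  rw [← inner_self_eq_norm_sq (𝕜 := ℂ)]
  rfl

theorem IsBorel.measurable_norm {ξ : ∀ x, H.Fibre x} (hξ : H.IsBorel ξ) :
    Measurable fun x => ‖ξ x‖ := by
  have h : Measurable fun x => ‖ξ x‖ ^ 2 := by
    refine Measurable.isLUB (f := fun m x => 2 * (Inner.inner ℂ (H.denseSection m x) (ξ x)).re -
      ‖H.denseSection m x‖ ^ 2) (fun m => ?_) fun x => isLUB_norm_sq (denseRange_denseSection x) _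
    exact ((Complex.measurable_re.comp (hξ.measurable_inner_denseSection m)).const_mul 2).sub
      (measurable_norm_sq_denseSection m)
  refine Measurable.of_eq (Real.continuous_sqrt.measurable.comp h) fun x => ?_
  exact Real.sqrt_sq (norm_nonneg _)

theorem IsBorel.measurable_inner {ξ ζ : ∀ x, H.Fibre x} (hξ : H.IsBorel ξ) (hζ : H.IsBorel ζ) :
    Measurable fun x => Inner.inner ℂ (ξ x) (ζ x) := by
  have hI : H.IsBorel fun x => (Complex.I : ℂ) • ζ x := hζ.smul measurable_const
  simp only [inner_eq_sum_norm_sq_div_four (𝕜 := ℂ)]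
  have h1 := Complex.measurable_ofReal.comp ((hξ.add hζ).measurable_norm)
  have h2 := Complex.measurable_ofReal.comp ((hξ.sub hζ).measurable_norm)
  have h3 := Complex.measurable_ofReal.comp ((hξ.sub hI).measurable_norm)
  have h4 := Complex.measurable_ofReal.comp ((hξ.add hI).measurable_norm)
  exact (((h1.pow_const 2).sub (h2.pow_const 2)).add
    (((h3.pow_const 2).sub (h4.pow_const 2)).mul measurable_const)).div_const 4

theorem IsBorel.normalize {ξ : ∀ x, H.Fibre x} (hξ : H.IsBorel ξ) :
    H.IsBorel fun x => ((‖ξ x‖⁻¹ : ℝ) : ℂ) • ξ x :=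
  hξ.smul (Complex.measurable_ofReal.comp hξ.measurable_norm.inv)

/-- Borel approximation by the dense sequence. -/
theorem IsBorel.exists_approx {ξ : ∀ x, H.Fibre x} (hξ : H.IsBorel ξ) {ε : ℝ} (hε : 0 < ε) :
    ∃ N : X → ℕ, Measurable N ∧ ∀ x, ‖ξ x - H.denseSection (N x) x‖ < ε := by
  classical
  have hex : ∀ x, ∃ m, ‖ξ x - H.denseSection m x‖ < ε := fun x => by
    obtain ⟨m, hm⟩ := (denseRange_denseSection (H := H) x).exists_dist_lt (ξ x) hε
    exact ⟨m, by rwa [← dist_eq_norm]⟩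
  refine ⟨fun x => Nat.find (hex x), measurable_find hex fun m => ?_, fun x => Nat.find_spec (hex x)⟩
  exact measurableSet_lt (hξ.sub (isBorel_denseSection m)).measurable_norm measurable_const

/-- Approximate `ξ` by Borel selections from the dense sequence and pass to the limit. Continuity of
each single `l x` suffices, with no bound uniform in `x`. -/
theorem IsBorel.measurable_clm_apply {ξ : ∀ x, H.Fibre x} (hξ : H.IsBorel ξ)
    (l : ∀ x, H.Fibre x →L[ℂ] ℂ) (hl : ∀ n, Measurable fun x => l x (H.fund n x)) :
    Measurable fun x => l x (ξ x) := by
  have hd : ∀ m, Measurable fun x => l x (H.denseSection m x) := fun m => by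
    simp only [denseSection, Finsupp.sum, map_sum, map_smul, smul_eq_mul]
    exact Finset.measurable_fun_sum _ fun i _ => measurable_const.mul (hl i)
  choose N hN hNlt using fun k : ℕ => hξ.exists_approx (ε := 1 / ((k : ℝ) + 1)) (by positivity)
  refine measurable_of_tendsto_metrizable (f := fun k x => l x (H.denseSection (N k x) x))
    (fun k => ?_) (tendsto_pi_nhds.2 fun x => ?_)
  · have h : Measurable fun q : ℕ × X => l q.2 (H.denseSection q.1 q.2) :=
      measurable_from_prod_countable_right hd
    exact h.comp ((hN k).prodMk measurable_id)
  · refine ((l x).continuous.tendsto _).comp ?_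
    rw [tendsto_iff_norm_sub_tendsto_zero]
    refine squeeze_zero (fun _ => norm_nonneg _) (fun k => ?_)
      (tendsto_one_div_add_atTop_nhds_zero_nat (𝕜 := ℝ))
    rw [norm_sub_rev]
    exact (hNlt k x).le

theorem IsBorel.apply_operator {K : HilbertBundle X} {ξ : ∀ x, H.Fibre x} (hξ : H.IsBorel ξ)
    (T : ∀ x, H.Fibre x →L[ℂ] K.Fibre x)
    (hT : ∀ m n, Measurable fun x => Inner.inner ℂ (K.fund m x) (T x (H.fund n x))) :
    K.IsBorel fun x => T x (ξ x) := fun m =>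
  hξ.measurable_clm_apply (fun x => (innerSL ℂ (K.fund m x)).comp (T x)) (hT m)

/-! ### Pull-backs of bundles -/

variable {Z : Type u} [MeasurableSpace Z]

variable (H) in
/-- The pull-back of a Hilbert bundle along a Borel map. -/
abbrev comap (f : Z → X) (hf : Measurable f) : HilbertBundle Z where
  Fibre z := H.Fibre (f z)
  fund n z := H.fund n (f z)
  measurable_inner m n := (H.measurable_inner m n).comp hf
  separating z := H.separating (f z)

theorem IsBorel.comap {ξ : ∀ x, H.Fibre x} (hξ : H.IsBorel ξ) {f : Z → X} (hf : Measurable f) :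
    (H.comap f hf).IsBorel fun z => ξ (f z) := fun n => (hξ n).comp hf

/-! ### Gaussian bundles and Chebyshev centres -/

variable (H) in
/-- The bundle of Gaussian Hilbert spaces of a Hilbert bundle. -/
abbrev gauss : HilbertBundle X where
  Fibre x := Gauss (H.Fibre x)
  fund n x := Gauss.vec (H.denseSection n.unpair.1 x) n.unpair.2
  measurable_inner m n := by
    simp only [Gauss.inner_vec]
    refine Measurable.ite (MeasurableSet.const _) ?_ measurable_const
    refine Complex.measurable_ofReal.comp (Real.measurable_exp.comp (Measurable.neg ?_))
    exact (((isBorel_denseSection _).sub (isBorel_denseSection _)).measurable_norm.pow_const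
      2).div_const _
  separating x v hv := by
    refine Gauss.eq_zero_of_inner_vec fun w i => ?_
    refine (denseRange_denseSection (H := H) x).induction_on w
      (isClosed_eq ((Gauss.continuous_vec i).inner continuous_const) continuous_const) fun m => ?_
    simpa using hv (Nat.pair m i)

theorem IsBorel.gauss_vec {ξ : ∀ x, H.Fibre x} (hξ : H.IsBorel ξ) (i : ℕ) :
    H.gauss.IsBorel fun x => Gauss.vec (ξ x) i := fun n => by
  change Measurable fun x =>
    Inner.inner ℂ (Gauss.vec (H.denseSection n.unpair.1 x) n.unpair.2) (Gauss.vec (ξ x) i)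
  simp only [Gauss.inner_vec]
  refine Measurable.ite (MeasurableSet.const _) ?_ measurable_const
  refine Complex.measurable_ofReal.comp (Real.measurable_exp.comp (Measurable.neg ?_))
  exact (((isBorel_denseSection _).sub hξ).measurable_norm.pow_const 2).div_const _

/-- Openness of the superlevel set reduces nonemptiness to a countable test. -/
theorem superlevel_nonempty_iff {x : X} (u : Gauss (H.Fibre x)) (i : ℕ) (δ : ℝ) :
    (Gauss.superlevel u i δ).Nonempty ↔ ∃ m, H.denseSection m x ∈ Gauss.superlevel u i δ := by
  constructor
  · intro h
    exact (denseRange_denseSection (H := H) x).exists_mem_open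
      (Gauss.isOpen_superlevel u i δ) h
  · rintro ⟨m, hm⟩
    exact ⟨_, hm⟩

/-- For open `Q` the points of a dense sequence in `Q` already realise the supremum. The value `0`
assigned off `Q` is harmless because `farDist` is nonnegative, and it also covers empty `Q`. -/
theorem isLUB_farDist {E : Type u} [NormedAddCommGroup E] {d : ℕ → E} (hd : DenseRange d)
    {Q : Set E} (hb : Bornology.IsBounded Q) (ho : IsOpen Q) [∀ m, Decidable (d m ∈ Q)] (v : E) :
    IsLUB {a | ∃ m, (if d m ∈ Q then ‖v - d m‖ else 0) = a} (farDist Q v) := by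
  constructor
  · rintro _ ⟨m, rfl⟩
    split_ifs with h
    · exact le_farDist hb v h
    · exact farDist_nonneg v
  · intro b hub
    refine Real.sSup_le ?_ ?_
    · rintro _ ⟨w, hw, rfl⟩
      by_contra hcon
      obtain ⟨m, hm, hm'⟩ := hd.exists_mem_open
        (ho.inter (isOpen_lt continuous_const (continuous_const.sub continuous_id).norm))
        ⟨w, hw, not_le.1 hcon⟩
      have := hub ⟨m, rfl⟩
      rw [if_pos hm] at this
      exact absurd hm' this.not_gt
    · refine le_trans ?_ (hub ⟨0, rfl⟩)
      split_ifs
      · exact norm_nonneg _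
      · exact le_rfl

theorem continuous_farDist' {E : Type u} [NormedAddCommGroup E] {Q : Set E}
    (hb : Bornology.IsBounded Q) : Continuous (farDist Q) := by
  rcases Q.eq_empty_or_nonempty with rfl | hne
  · refine continuous_const.congr (f := fun _ => 0) fun v => ?_
    simp [farDist]
  · exact continuous_farDist hb hne

theorem isGLB_chebyshevRadius {E : Type u} [NormedAddCommGroup E] {d : ℕ → E} (hd : DenseRange d)
    {Q : Set E} (hb : Bornology.IsBounded Q) :
    IsGLB {a | ∃ m, farDist Q (d m) = a} (chebyshevRadius Q) := by
  constructor
  · rintro _ ⟨m, rfl⟩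
    exact chebyshevRadius_le _
  · intro b hlb
    have : Nonempty E := ⟨0⟩
    refine le_ciInf fun v => ?_
    exact hd.induction_on v (isClosed_le continuous_const (continuous_farDist' hb))
      fun m => hlb ⟨m, rfl⟩

open Classical in
/-- The Chebyshev centre of a superlevel set, and `0` if that set is empty. -/
def centerSection (u : ∀ x, Gauss (H.Fibre x)) (i : ℕ) (δ : ℝ) (x : X) : H.Fibre x :=
  if (Gauss.superlevel (u x) i δ).Nonempty then chebyshevCenter (Gauss.superlevel (u x) i δ) else 0

theorem IsBorel.measurableSet_mem_superlevel {u : ∀ x, Gauss (H.Fibre x)}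
    (hu : H.gauss.IsBorel u) (i : ℕ) (δ : ℝ) (m : ℕ) :
    MeasurableSet {x | H.denseSection m x ∈ Gauss.superlevel (u x) i δ} := by
  have h := hu (Nat.pair m i)
  have h2 : Measurable fun x => ‖Inner.inner ℂ (Gauss.vec (H.denseSection m x) i) (u x)‖ :=
    Measurable.of_eq h.norm fun x => by
      change ‖Inner.inner ℂ (Gauss.vec (H.denseSection (Nat.pair m i).unpair.1 x)
        (Nat.pair m i).unpair.2) (u x)‖ = _
      rw [Nat.unpair_pair]
  exact measurableSet_lt measurable_const h2

theorem IsBorel.measurableSet_superlevel_nonempty {u : ∀ x, Gauss (H.Fibre x)}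
    (hu : H.gauss.IsBorel u) (i : ℕ) (δ : ℝ) :
    MeasurableSet {x | (Gauss.superlevel (u x) i δ).Nonempty} := by
  simp only [superlevel_nonempty_iff, Set.ofPred_exists]
  exact MeasurableSet.iUnion fun m => hu.measurableSet_mem_superlevel i δ m

/-- The radius is a countable infimum of Borel functions, so an almost optimal member of the dense
sequence can be chosen in a Borel way. By the stability estimate, almost optimal points converge to
the centre. -/
theorem IsBorel.centerSection {u : ∀ x, Gauss (H.Fibre x)} (hu : H.gauss.IsBorel u) (i : ℕ)
    {δ : ℝ} (hδ : 0 < δ) : H.IsBorel (centerSection u i δ) := by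
  classical
  have hb := fun x => Gauss.isBounded_superlevel (u x) i hδ
  have hfar : ∀ m, Measurable fun x => farDist (Gauss.superlevel (u x) i δ) (H.denseSection m x) :=
    fun m => by
      refine Measurable.isLUB (f := fun l x =>
        if H.denseSection l x ∈ Gauss.superlevel (u x) i δ then
          ‖H.denseSection m x - H.denseSection l x‖ else 0) (fun l => ?_)
        fun x => isLUB_farDist (denseRange_denseSection x) (hb x) (Gauss.isOpen_superlevel _ _ _) _
      exact Measurable.ite (hu.measurableSet_mem_superlevel i δ l)
        ((isBorel_denseSection m).sub (isBorel_denseSection l)).measurable_norm measurable_const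
  have hR : Measurable fun x => chebyshevRadius (Gauss.superlevel (u x) i δ) :=
    Measurable.isGLB hfar fun x => isGLB_chebyshevRadius (denseRange_denseSection x) (hb x)
  have hex : ∀ (k : ℕ) (x : X), ∃ m, farDist (Gauss.superlevel (u x) i δ) (H.denseSection m x) <
      chebyshevRadius (Gauss.superlevel (u x) i δ) + 1 / ((k : ℝ) + 1) := fun k x => by
    obtain ⟨v, hv⟩ := exists_lt_of_ciInf_lt (lt_add_of_pos_right
      (chebyshevRadius (Gauss.superlevel (u x) i δ))
      (show (0 : ℝ) < 1 / ((k : ℝ) + 1) by positivity))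
    exact (denseRange_denseSection (H := H) x).exists_mem_open
      (isOpen_lt (continuous_farDist' (hb x)) continuous_const) ⟨v, hv⟩
  have hN : ∀ k, Measurable fun x => Nat.find (hex k x) := fun k =>
    measurable_find (hex k) fun m => measurableSet_lt (hfar m) (hR.add_const _)
  refine isBorel_of_tendsto (ξ := fun k x => if (Gauss.superlevel (u x) i δ).Nonempty then
    H.denseSection (Nat.find (hex k x)) x else 0) (fun k => ?_) fun x => ?_
  · exact (isBorel_select isBorel_denseSection (hN k)).ite isBorel_zero
      (hu.measurableSet_superlevel_nonempty i δ)
  · simp only [HilbertBundle.centerSection]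
    split_ifs with hne
    · rw [tendsto_iff_norm_sub_tendsto_zero]
      set R := chebyshevRadius (Gauss.superlevel (u x) i δ)
      have hlim : Tendsto (fun k : ℕ => √(2 * (R + 1 / ((k : ℝ) + 1)) ^ 2 - 2 * R ^ 2)) atTop
          (𝓝 0) := by
        have h1 := ((((tendsto_const_nhds (x := R)).add
          (tendsto_one_div_add_atTop_nhds_zero_nat (𝕜 := ℝ))).pow 2).const_mul 2).sub_const
          (2 * R ^ 2)
        have e : 2 * (R + 0) ^ 2 - 2 * R ^ 2 = 0 := by ring
        rw [e] at h1
        have h2 := (Real.continuous_sqrt.tendsto 0).comp h1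
        rwa [Real.sqrt_zero] at h2
      refine squeeze_zero (fun _ => norm_nonneg _) (fun k => ?_) hlim
      refine Real.le_sqrt_of_sq_le ?_
      refine (norm_sub_chebyshevCenter_sq_le (hb x) hne _).trans ?_
      have h2 := (Nat.find_spec (hex k x)).le
      have h3 := pow_le_pow_left₀ (farDist_nonneg _) h2 2
      linarith
    · exact tendsto_const_nhds

end HilbertBundle

/-! ### Conull Borel sets and almost everywhere summable subsequences -/

theorem exists_measurable_conull {X : Type u} [MeasurableSpace X] {μ : Measure X} {P : X → Prop}
    (h : ∀ᵐ x ∂μ, P x) : ∃ U : Set X, MeasurableSet U ∧ μ Uᶜ = 0 ∧ ∀ x ∈ U, P x := by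
  refine ⟨(toMeasurable μ {x | ¬ P x})ᶜ, (measurableSet_toMeasurable _ _).compl, ?_, fun x hx => ?_⟩
  · rw [compl_compl, measure_toMeasurable]
    exact h
  · by_contra hcon
    exact hx (subset_toMeasurable μ {x | ¬ P x} hcon)

/-- A sequence of functions which tends to zero almost everywhere has a subsequence which is
weighted square summable almost everywhere. -/
theorem exists_seq_ae_summable {G : Type u} [MeasurableSpace G] (m : Measure G) [SFinite m]
    {f : ℕ → G → ℝ} (hf : ∀ n, Measurable (f n))
    (h : ∀ᵐ γ ∂m, Tendsto (fun n => f n γ) atTop (𝓝 0)) :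
    ∃ φ : ℕ → ℕ, ∀ᵐ γ ∂m, Summable fun k : ℕ => ((k : ℝ) * f (φ k) γ) ^ 2 := by
  -- Passing from almost everywhere convergence to convergence in measure needs finiteness, so `m`
  -- is replaced by an equivalent finite measure.
  have h' : ∀ᵐ γ ∂m.toFinite, Tendsto (fun n => f n γ) atTop (𝓝 ((fun _ => (0 : ℝ)) γ)) :=
    (toFinite_absolutelyContinuous m).ae_le h
  have hm := tendstoInMeasure_of_tendsto_ae (fun n => (hf n).aestronglyMeasurable) h'
  rw [tendstoInMeasure_iff_norm] at hm
  have hex : ∀ k : ℕ, ∃ n, m.toFinite {γ | (1 / 2 : ℝ) ^ k ≤ ‖f n γ - 0‖} ≤ (1 / 2 : ℝ≥0∞) ^ k := by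
    intro k
    have := (hm ((1 / 2 : ℝ) ^ k) (by positivity)).eventually
      (ge_mem_nhds (show (0 : ℝ≥0∞) < (1 / 2) ^ k from
        ENNReal.pow_pos (by simp) k))
    exact this.exists
  choose φ hφ using hex
  refine ⟨φ, (absolutelyContinuous_toFinite m).ae_le ?_⟩
  have hsum : ∑' k, m.toFinite {γ | (1 / 2 : ℝ) ^ k ≤ ‖f (φ k) γ - 0‖} ≠ ∞ := by
    refine ne_top_of_le_ne_top ?_ (ENNReal.tsum_le_tsum hφ)
    rw [ENNReal.tsum_geometric]
    simp
  -- Borel–Cantelli: eventually `|f (φ k) γ| < 2⁻ᵏ`, so the terms are dominated by `k² 4⁻ᵏ`.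
  filter_upwards [ae_eventually_notMem hsum] with γ hγ
  have hs : Summable fun k : ℕ => (k : ℝ) ^ 2 * (1 / 4 : ℝ) ^ k :=
    summable_pow_mul_geometric_of_norm_lt_one 2 (by norm_num)
  refine Summable.of_norm_bounded_eventually_nat hs ?_
  filter_upwards [hγ] with k hk
  have hk' : ‖f (φ k) γ‖ < (1 / 2 : ℝ) ^ k := by
    rw [sub_zero] at hk
    exact not_le.1 hk
  rw [norm_pow, norm_mul, mul_pow, Real.norm_natCast]
  have h2 : ‖f (φ k) γ‖ ^ 2 ≤ (1 / 4 : ℝ) ^ k := by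
    calc ‖f (φ k) γ‖ ^ 2 ≤ ((1 / 2 : ℝ) ^ k) ^ 2 := pow_le_pow_left₀ (norm_nonneg _) hk'.le 2
      _ = (1 / 4 : ℝ) ^ k := by rw [← pow_mul, mul_comm, pow_mul]; norm_num
  gcongr

/-! ### Null sets of measured groupoids -/

section Null

variable {X G : Type u} [MeasurableSpace X] [MeasurableSpace G] {𝒢 : BorelGroupoid X G}
  (lam : HaarSystem 𝒢) {μ : Measure X}

theorem ae_arrow_iff {p : G → Prop} (hp : MeasurableSet {γ | p γ}) :
    (∀ᵐ γ ∂(arrowMeasure lam μ), p γ) ↔ ∀ᵐ x ∂μ, ∀ᵐ γ ∂(lam.kernel x), p γ :=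
  Measure.ae_comp_iff hp

theorem ae_ae_of_ae_arrow {p : G → Prop} (h : ∀ᵐ γ ∂(arrowMeasure lam μ), p γ) :
    ∀ᵐ x ∂μ, ∀ᵐ γ ∂(lam.kernel x), p γ :=
  Measure.ae_ae_of_ae_comp h

theorem HaarSystem.ae_r_eq (x : X) : ∀ᵐ γ ∂(lam.kernel x), 𝒢.r γ = x := lam.fibre x

theorem HaarSystem.kernel_ne_zero (x : X) : lam.kernel x ≠ 0 := by
  obtain ⟨f, -, -, hf⟩ := lam.proper
  intro h
  have := hf x
  rw [h, lintegral_zero_measure] at this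
  exact zero_ne_one this

instance (x : X) : (ae (lam.kernel x)).NeBot := ae_neBot.2 (lam.kernel_ne_zero x)

theorem ae_arrow_r {P : X → Prop} (h : ∀ᵐ x ∂μ, P x) : ∀ᵐ γ ∂(arrowMeasure lam μ), P (𝒢.r γ) := by
  obtain ⟨U, hU, hU0, hUP⟩ := exists_measurable_conull h
  have : ∀ᵐ γ ∂(arrowMeasure lam μ), 𝒢.r γ ∈ U := by
    rw [ae_arrow_iff lam (𝒢.measurable_r hU)]
    filter_upwards [show ∀ᵐ x ∂μ, x ∈ U from hU0] with x hx
    filter_upwards [lam.ae_r_eq x] with γ hγ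
    rwa [hγ]
  filter_upwards [this] with γ hγ using hUP _ hγ

/-- Since `λ^x ≠ 0`, almost every unit is the range of some good arrow. -/
theorem ae_of_ae_arrow_r {P : X → Prop} (h : ∀ᵐ γ ∂(arrowMeasure lam μ), P (𝒢.r γ)) :
    ∀ᵐ x ∂μ, P x := by
  filter_upwards [ae_ae_of_ae_arrow lam h] with x hx
  obtain ⟨γ, h1, h2⟩ := (hx.and (lam.ae_r_eq x)).exists
  rwa [h2] at h1

variable {lam}

theorem QuasiInvariant.ae_inv (hq : QuasiInvariant lam μ) {P : G → Prop}
    (h : ∀ᵐ γ ∂(arrowMeasure lam μ), P γ) : ∀ᵐ γ ∂(arrowMeasure lam μ), P (𝒢.inv γ) :=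
  ae_of_ae_map 𝒢.measurable_inv.aemeasurable (hq.1.ae_le h)

theorem QuasiInvariant.ae_arrow_s (hq : QuasiInvariant lam μ) {P : X → Prop}
    (h : ∀ᵐ x ∂μ, P x) : ∀ᵐ γ ∂(arrowMeasure lam μ), P (𝒢.s γ) := by
  filter_upwards [hq.ae_inv (ae_arrow_r lam h)] with γ hγ
  rwa [𝒢.r_inv] at hγ

theorem QuasiInvariant.ae_of_ae_arrow_s (hq : QuasiInvariant lam μ) {P : X → Prop}
    (h : ∀ᵐ γ ∂(arrowMeasure lam μ), P (𝒢.s γ)) : ∀ᵐ x ∂μ, P x := by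
  refine ae_of_ae_arrow_r lam ?_
  filter_upwards [hq.ae_inv h] with γ hγ
  rwa [𝒢.s_inv] at hγ

/-- In an ergodic groupoid, almost invariant Borel sets are null or conull. -/
theorem IsErgodic.null_or_conull (herg : IsErgodic 𝒢 μ) (lam : HaarSystem 𝒢) {A : Set X}
    (hA : MeasurableSet A)
    (h : ∀ᵐ γ ∂(arrowMeasure lam μ), 𝒢.r γ ∈ A ↔ 𝒢.s γ ∈ A) : μ A = 0 ∨ μ Aᶜ = 0 := by
  -- By left invariance, the set of `x` for which almost every arrow with range `x` has its source
  -- in `A` is strictly invariant. It agrees with `A` almost everywhere.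
  set B : Set X := {x | lam.kernel x (𝒢.s ⁻¹' Aᶜ) = 0} with hB
  have hBm : MeasurableSet B :=
    (lam.kernel.measurable_coe (𝒢.measurable_s hA.compl)) (measurableSet_singleton 0)
  have hinv : ∀ γ, 𝒢.r γ ∈ B ↔ 𝒢.s γ ∈ B := by
    intro γ
    have h1 := lam.invariant γ _ (𝒢.measurable_s hA.compl)
    have h2 : lam.kernel (𝒢.s γ) {γ' | ∃ h : 𝒢.s γ = 𝒢.r γ', 𝒢.mul γ γ' h ∈ 𝒢.s ⁻¹' Aᶜ} =
        lam.kernel (𝒢.s γ) (𝒢.s ⁻¹' Aᶜ) := by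
      refine measure_congr ?_
      filter_upwards [lam.ae_r_eq (𝒢.s γ)] with γ' hγ'
      refine propext ⟨?_, fun hs => ⟨hγ'.symm, ?_⟩⟩
      · rintro ⟨h, hs⟩
        rw [Set.mem_preimage, 𝒢.s_mul] at hs
        exact hs
      · rw [Set.mem_preimage, 𝒢.s_mul]
        exact hs
    change lam.kernel _ _ = 0 ↔ lam.kernel _ _ = 0
    rw [← h1, h2]
  have hAB : ∀ᵐ x ∂μ, x ∈ A ↔ x ∈ B := by
    filter_upwards [ae_ae_of_ae_arrow lam h] with x hx
    constructor
    · intro hxA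
      change ∀ᵐ γ ∂(lam.kernel x), 𝒢.s γ ∈ A
      filter_upwards [hx, lam.ae_r_eq x] with γ h1 h2
      rw [h2] at h1
      exact h1.1 hxA
    · intro hxB
      have hxB' : ∀ᵐ γ ∂(lam.kernel x), 𝒢.s γ ∈ A := hxB
      obtain ⟨γ, ⟨h1, h2⟩, h3⟩ := ((hx.and hxB').and (lam.ae_r_eq x)).exists
      rw [← h3]
      exact h1.2 h2
  have hAB' : A =ᵐ[μ] B := by
    filter_upwards [hAB] with x hx using propext hx
  rcases herg B hBm hinv with h0 | h0
  · left
    rwa [measure_congr hAB']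
  · right
    rwa [measure_congr hAB'.compl]

/-- Left translation by `γ` carries the unit at `s(γ)` to `γ`. -/
theorem kernel_singleton [MeasurableSingletonClass G] (γ : G) :
    lam.kernel (𝒢.r γ) {γ} = lam.kernel (𝒢.s γ) {𝒢.unit (𝒢.s γ)} := by
  rw [← lam.invariant γ {γ} (measurableSet_singleton γ)]
  congr 1
  ext γ'
  constructor
  · rintro ⟨h, hγ'⟩
    have h3 := 𝒢.inv_mul_cancel γ γ' h
    rw [𝒢.mul_congr rfl (Set.mem_singleton_iff.1 hγ'), 𝒢.inv_mul] at h3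
    exact h3.symm
  · rintro rfl
    exact ⟨(𝒢.r_unit _).symm, 𝒢.mul_unit γ⟩

/-- In a discrete groupoid with Haar system, the Haar measures charge the units almost
everywhere. -/
theorem ae_kernel_unit_ne_zero [StandardBorelSpace G] (hd : 𝒢.IsRDiscrete)
    (hq : QuasiInvariant lam μ) : ∀ᵐ x ∂μ, lam.kernel x {𝒢.unit x} ≠ 0 := by
  refine hq.ae_of_ae_arrow_s ?_
  have hm : MeasurableSet {x | lam.kernel x {𝒢.unit x} ≠ 0} := by
    have h1 : MeasurableSet {q : X × G | q.2 = 𝒢.unit q.1} :=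
      measurableSet_eq_fun measurable_snd (𝒢.measurable_unit.comp measurable_fst)
    have h2 := Kernel.measurable_kernel_prodMk_left (κ := lam.kernel) h1
    exact h2 (measurableSet_singleton 0).compl
  refine (ae_arrow_iff lam (𝒢.measurable_s hm)).2 ?_
  refine Eventually.of_forall fun x => ?_
  rw [ae_iff]
  refine measure_mono_null (t := {γ | 𝒢.r γ ≠ x} ∪
    {γ | 𝒢.r γ = x ∧ lam.kernel (𝒢.s γ) {𝒢.unit (𝒢.s γ)} = 0}) ?_ ?_
  · intro γ hγ
    by_cases h : 𝒢.r γ = x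
    · exact Or.inr ⟨h, not_not.1 hγ⟩
    · exact Or.inl h
  · rw [measure_union_null_iff]
    refine ⟨lam.fibre x, ?_⟩
    -- Only countably many arrows are left, and each has the mass of the unit at its source, here
    -- zero.
    have hc : ({γ | 𝒢.r γ = x ∧ lam.kernel (𝒢.s γ) {𝒢.unit (𝒢.s γ)} = 0} : Set G).Countable :=
      (hd x).mono fun γ hγ => hγ.1
    rw [← Set.biUnion_of_singleton {γ | 𝒢.r γ = x ∧ lam.kernel (𝒢.s γ) {𝒢.unit (𝒢.s γ)} = 0},
      measure_biUnion_null_iff hc]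
    rintro γ ⟨rfl, h2⟩
    rwa [kernel_singleton]

/-- In a discrete measured groupoid, a property of almost all arrows holds for all arrows of some
inessential reduction. -/
theorem ae_forall_arrow_of_ae [MeasurableSingletonClass G] {P : G → Prop} (h : ∀ᵐ γ ∂(arrowMeasure lam μ), P γ) :
    ∀ᵐ x ∂μ, ∀ γ, 𝒢.r γ = x → lam.kernel (𝒢.s γ) {𝒢.unit (𝒢.s γ)} ≠ 0 → P γ := by
  filter_upwards [ae_ae_of_ae_arrow lam h] with x hx γ hr hs
  -- The singleton `{γ}` has the mass of the unit at `s(γ)`, which is positive, so it cannot lie in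
  -- the null set of bad arrows.
  by_contra hcon
  rw [← kernel_singleton, hr] at hs
  exact hs (measure_mono_null (by rintro _ rfl; exact hcon) hx)

end Null

/-! ### Representations -/

namespace Representation

section

variable {X G : Type u} [MeasurableSpace X] [MeasurableSpace G] {𝒢 : BorelGroupoid X G}
  {μ : Measure X}

theorem clm_congr {bundle : HilbertBundle X}
    (L : ∀ (γ : G) {x y : X}, 𝒢.r γ = x → 𝒢.s γ = y → bundle.Fibre y →L[ℂ] bundle.Fibre x)
    {γ γ' : G} (h : γ = γ') {x y : X} (hx : 𝒢.r γ = x) (hy : 𝒢.s γ = y) :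
    L γ hx hy = L γ' (h ▸ hx) (h ▸ hy) := by
  subst h
  rfl

/-- A representation is determined by isometric operators, since surjectivity follows from
invertibility of the arrows. -/
def ofIsometric (bundle : HilbertBundle X)
    (L : ∀ (γ : G) {x y : X}, 𝒢.r γ = x → 𝒢.s γ = y → bundle.Fibre y →L[ℂ] bundle.Fibre x)
    (borel : ∀ m n, Measurable fun γ => Inner.inner ℂ (bundle.fund m (𝒢.r γ))
      (L γ rfl rfl (bundle.fund n (𝒢.s γ))))
    (U : Set X) (hU : MeasurableSet U) (hU0 : μ Uᶜ = 0)
    (hnorm : ∀ (γ : G) {x y : X} (hx : 𝒢.r γ = x) (hy : 𝒢.s γ = y), x ∈ U → y ∈ U →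
      ∀ v, ‖L γ hx hy v‖ = ‖v‖)
    (hmul : ∀ (γ₁ γ₂ : G) {x y z : X} (hx : 𝒢.r γ₁ = x) (hy : 𝒢.s γ₁ = y) (hy' : 𝒢.r γ₂ = y)
      (hz : 𝒢.s γ₂ = z), x ∈ U → y ∈ U → z ∈ U →
      L (𝒢.mul γ₁ γ₂ (hy.trans hy'.symm)) ((𝒢.r_mul _ _ _).trans hx) ((𝒢.s_mul _ _ _).trans hz) =
        (L γ₁ hx hy).comp (L γ₂ hy' hz))
    (hunit : ∀ x ∈ U, L (𝒢.unit x) (𝒢.r_unit x) (𝒢.s_unit x) = ContinuousLinearMap.id ℂ _) :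
    Representation 𝒢 μ where
  bundle := bundle
  L := L
  borel := borel
  conull := by
    refine ⟨U, hU, hU0, fun γ x y hx hy hxU hyU => ⟨hnorm γ hx hy hxU hyU, fun v => ?_⟩, hmul⟩
    refine ⟨L (𝒢.inv γ) ((𝒢.r_inv γ).trans hy) ((𝒢.s_inv γ).trans hx) v, ?_⟩
    have h1 := hmul γ (𝒢.inv γ) hx hy ((𝒢.r_inv γ).trans hy) ((𝒢.s_inv γ).trans hx) hxU hyU hxU
    rw [← ContinuousLinearMap.comp_apply, ← h1,
      clm_congr L ((𝒢.mul_inv γ).trans (congrArg 𝒢.unit hx)), hunit x hxU]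
    rfl

variable (π : Representation 𝒢 μ)

theorem isBorel_apply {ξ : ∀ γ, π.bundle.Fibre (𝒢.s γ)}
    (hξ : (π.bundle.comap 𝒢.s 𝒢.measurable_s).IsBorel ξ) :
    (π.bundle.comap 𝒢.r 𝒢.measurable_r).IsBorel fun γ => π.L γ rfl rfl (ξ γ) :=
  HilbertBundle.IsBorel.apply_operator (K := π.bundle.comap 𝒢.r 𝒢.measurable_r) hξ
    (fun γ => π.L γ rfl rfl) π.borel

theorem measurable_norm_coboundary (ξ : π.bundle.BorelSection) :
    Measurable fun γ => ‖π.coboundary ξ γ‖ :=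
  ((ξ.isBorel.comap 𝒢.measurable_r).sub
    (π.isBorel_apply (ξ.isBorel.comap 𝒢.measurable_s))).measurable_norm

variable {lam : HaarSystem 𝒢} {π}

/-- In an ergodic measured groupoid, a nonzero invariant section can be normalised. -/
theorem hasUnitInvariantSection_of_invariant (hq : QuasiInvariant lam μ) (herg : IsErgodic 𝒢 μ)
    {η : ∀ x, π.bundle.Fibre x} (hη : π.bundle.IsBorel η)
    (hinv : ∀ᵐ γ ∂(arrowMeasure lam μ), π.L γ rfl rfl (η (𝒢.s γ)) = η (𝒢.r γ))
    (hne : (∀ᵐ x ∂μ, η x = 0) → μ = 0) : π.HasUnitInvariantSection lam := by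
  obtain ⟨U, hU, hU0, hiso, -⟩ := π.conull
  have hUae : ∀ᵐ x ∂μ, x ∈ U := hU0
  have hnorm : ∀ᵐ γ ∂(arrowMeasure lam μ), ‖η (𝒢.s γ)‖ = ‖η (𝒢.r γ)‖ := by
    filter_upwards [hinv, ae_arrow_r lam hUae, hq.ae_arrow_s hUae] with γ h1 h2 h3
    rw [← h1, (hiso γ rfl rfl h2 h3).1]
  have hA : MeasurableSet {x | ‖η x‖ = 0} := hη.measurable_norm (measurableSet_singleton 0)
  refine ⟨hη.normalize.toSection, ?_, ?_⟩
  -- The norm of `η` is invariant, hence its zero set is null or conull.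
  · have hdich : μ {x | ‖η x‖ = 0} = 0 ∨ μ {x | ‖η x‖ = 0}ᶜ = 0 := by
      refine herg.null_or_conull lam hA ?_
      filter_upwards [hnorm] with γ hγ
      rw [hγ]
    have h0 : ∀ᵐ x ∂μ, ‖η x‖ ≠ 0 := by
      rcases hdich with h | h
      · rw [ae_iff]
        simpa only [ne_eq, not_not] using h
      -- If `η` vanishes almost everywhere, `hne` forces `μ = 0`, where every almost everywhere
      -- statement is vacuous.
      · have hz : ∀ᵐ x ∂μ, ‖η x‖ = 0 := h
        rw [ae_eq_bot.2 (hne (by filter_upwards [hz] with x hx using norm_eq_zero.1 hx))]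
        exact Filter.eventually_bot
    filter_upwards [h0] with x hx
    change ‖((‖η x‖⁻¹ : ℝ) : ℂ) • η x‖ = 1
    rw [norm_smul, Complex.norm_real, norm_inv, norm_norm, inv_mul_cancel₀ hx]
  · filter_upwards [hinv, hnorm] with γ h1 h2
    change ((‖η (𝒢.r γ)‖⁻¹ : ℝ) : ℂ) • η (𝒢.r γ) -
      π.L γ rfl rfl (((‖η (𝒢.s γ)‖⁻¹ : ℝ) : ℂ) • η (𝒢.s γ)) = 0
    rw [map_smul, h1, h2, sub_self]

end

end Representation

/-! ### Countable multiples of Hilbert bundles -/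

theorem memℓp_two_iff {E : ℕ → Type u} [∀ i, NormedAddCommGroup (E i)] {f : ∀ i, E i} :
    Memℓp f 2 ↔ Summable fun i => ‖f i‖ ^ 2 := by
  rw [memℓp_gen_iff (by norm_num)]
  norm_num

theorem lp_two_norm_sq {E : ℕ → Type u} [∀ i, NormedAddCommGroup (E i)] (f : lp E 2) :
    ‖f‖ ^ 2 = ∑' i, ‖f i‖ ^ 2 := by
  have := lp.norm_rpow_eq_tsum (p := 2) (by norm_num) f
  norm_num at this
  exact this

theorem lp_two_norm_congr {E E' : ℕ → Type u} [∀ i, NormedAddCommGroup (E i)]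
    [∀ i, NormedAddCommGroup (E' i)] {f : lp E 2} {g : lp E' 2} (h : ∀ i, ‖f i‖ = ‖g i‖) :
    ‖f‖ = ‖g‖ := by
  rw [← sq_eq_sq₀ (norm_nonneg _) (norm_nonneg _), lp_two_norm_sq, lp_two_norm_sq]
  simp only [h]

theorem tendsto_norm_lp_two {E : ℕ → Type u} [∀ i, NormedAddCommGroup (E i)] (f : lp E 2) :
    Tendsto (fun k => ‖f k‖) atTop (𝓝 0) := by
  have h := (memℓp_two_iff.1 (lp.memℓp f)).tendsto_atTop_zero
  have h2 := (Real.continuous_sqrt.tendsto 0).comp h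
  rw [Real.sqrt_zero] at h2
  refine h2.congr fun k => ?_
  exact Real.sqrt_sq (norm_nonneg _)

namespace HilbertBundle

variable {X : Type u} [MeasurableSpace X] (H : HilbertBundle X)

/-- The Hilbert sum of countably many copies of a Hilbert bundle. -/
abbrev ell2 : HilbertBundle X where
  Fibre x := lp (fun _ : ℕ => H.Fibre x) 2
  fund n x := lp.single 2 n.unpair.1 (H.fund n.unpair.2 x)
  measurable_inner m n := by
    simp only [lp.inner_single_left, lp.coeFn_single, Pi.single_apply]
    by_cases h : m.unpair.1 = n.unpair.1
    · exact Measurable.of_eq (H.measurable_inner m.unpair.2 n.unpair.2) fun x => by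
        rw [if_pos h]
    · exact Measurable.of_eq (measurable_const (a := (0 : ℂ))) fun x => by
        rw [if_neg h, inner_zero_right]
  separating x v hv := by
    ext k
    refine H.separating x _ fun n => ?_
    have := hv (Nat.pair k n)
    rwa [lp.inner_single_left, Nat.unpair_pair] at this

variable {H}

theorem isBorel_ell2_iff {w : ∀ x, lp (fun _ : ℕ => H.Fibre x) 2} :
    H.ell2.IsBorel w ↔ ∀ k, H.IsBorel fun x => w x k := by
  constructor
  · intro h k n
    refine Measurable.of_eq (h (Nat.pair k n)) fun x => ?_
    change Inner.inner ℂ (lp.single 2 (Nat.pair k n).unpair.1 (H.fund (Nat.pair k n).unpair.2 x))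
      (w x) = _
    rw [lp.inner_single_left, Nat.unpair_pair]
  · intro h n
    refine Measurable.of_eq (h n.unpair.1 n.unpair.2) fun x => ?_
    exact (lp.inner_single_left (𝕜 := ℂ) n.unpair.1 (H.fund n.unpair.2 x) (w x)).symm

end HilbertBundle

/-! ### The affine action of a formal sequence of sections -/

namespace Representation

variable {X G : Type u} [MeasurableSpace X] [MeasurableSpace G] {𝒢 : BorelGroupoid X G}
  {μ : Measure X} (π : Representation 𝒢 μ) (V : ℕ → ∀ x, π.bundle.Fibre x)

/-- The square summable sequences of vectors of a fibre. -/
abbrev Ell2Fibre (x : X) : Type u := lp (fun _ : ℕ => π.bundle.Fibre x) 2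

open Classical in
/-- The affine map `w ↦ L(γ) (w + V) - V`. -/
def affine (γ : G) {x y : X} (hx : 𝒢.r γ = x) (hy : 𝒢.s γ = y) (w : π.Ell2Fibre y) :
    π.Ell2Fibre x :=
  if h : Memℓp (fun k => π.L γ hx hy (w k + V k y) - V k x) 2 then ⟨_, h⟩ else 0

/-- On the reduction to `U` the representation is isometric and multiplicative. -/
structure IsIsometricOn (U : Set X) : Prop where
  norm_map : ∀ (γ : G) {x y : X} (hx : 𝒢.r γ = x) (hy : 𝒢.s γ = y), x ∈ U → y ∈ U →
    ∀ v, ‖π.L γ hx hy v‖ = ‖v‖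
  mul : ∀ (γ₁ γ₂ : G) {x y z : X} (hx : 𝒢.r γ₁ = x) (hy : 𝒢.s γ₁ = y) (hy' : 𝒢.r γ₂ = y)
    (hz : 𝒢.s γ₂ = z), x ∈ U → y ∈ U → z ∈ U →
    π.L (𝒢.mul γ₁ γ₂ (hy.trans hy'.symm)) ((𝒢.r_mul _ _ _).trans hx) ((𝒢.s_mul _ _ _).trans hz) =
      (π.L γ₁ hx hy).comp (π.L γ₂ hy' hz)

/-- The representation is isometric on the reduction to `U`, and `V` is invariant there up to square
summable sequences. -/
structure IsAffineOn (U : Set X) : Prop extends π.IsIsometricOn U where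
  summable : ∀ (γ : G) {x y : X} (hx : 𝒢.r γ = x) (hy : 𝒢.s γ = y), x ∈ U → y ∈ U →
    Summable fun k => ‖π.L γ hx hy (V k y) - V k x‖ ^ 2

-- The operator of a unit is idempotent and isometric, hence injective, so it is the identity.
variable {π} in
theorem IsIsometricOn.unit {U : Set X} (h : π.IsIsometricOn U) {x : X} (hx : x ∈ U) (v : π.bundle.Fibre x) :
    π.L (𝒢.unit x) (𝒢.r_unit x) (𝒢.s_unit x) v = v := by
  have h1 := h.mul (𝒢.unit x) (𝒢.unit x) (𝒢.r_unit x) (𝒢.s_unit x) (𝒢.r_unit x) (𝒢.s_unit x)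
    hx hx hx
  have h2 : 𝒢.mul (𝒢.unit x) (𝒢.unit x) ((𝒢.s_unit x).trans (𝒢.r_unit x).symm) = 𝒢.unit x := by
    have := 𝒢.unit_mul (𝒢.unit x)
    rwa [𝒢.mul_congr (congrArg 𝒢.unit (𝒢.r_unit x)) rfl] at this
  rw [clm_congr π.L h2] at h1
  have h3 := h.norm_map (𝒢.unit x) (𝒢.r_unit x) (𝒢.s_unit x) hx hx
    (π.L (𝒢.unit x) (𝒢.r_unit x) (𝒢.s_unit x) v - v)
  have h4 : π.L (𝒢.unit x) (𝒢.r_unit x) (𝒢.s_unit x)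
      (π.L (𝒢.unit x) (𝒢.r_unit x) (𝒢.s_unit x) v) =
      π.L (𝒢.unit x) (𝒢.r_unit x) (𝒢.s_unit x) v := (DFunLike.congr_fun h1 v).symm
  rw [map_sub, h4, sub_self, norm_zero] at h3
  exact sub_eq_zero.1 (norm_eq_zero.1 h3.symm)

namespace IsAffineOn

variable {π V} {U : Set X} (h : π.IsAffineOn V U)
include h

/-- Split the sequence as `L(γ)w + (L(γ)V - V)`: the first term is square summable by isometry, the
second by hypothesis. -/
theorem memℓp_affine (γ : G) {x y : X} (hx : 𝒢.r γ = x) (hy : 𝒢.s γ = y) (hxU : x ∈ U)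
    (hyU : y ∈ U) (w : π.Ell2Fibre y) :
    Memℓp (fun k => π.L γ hx hy (w k + V k y) - V k x) 2 := by
  have h1 : Memℓp (fun k => π.L γ hx hy (w k)) 2 := by
    rw [memℓp_two_iff]
    simp only [h.norm_map γ hx hy hxU hyU]
    exact memℓp_two_iff.1 (lp.memℓp w)
  have h2 : Memℓp (fun k => π.L γ hx hy (V k y) - V k x) 2 :=
    memℓp_two_iff.2 (h.summable γ hx hy hxU hyU)
  convert h1.add h2 using 1
  funext k
  rw [Pi.add_apply, map_add]
  abel

theorem affine_apply (γ : G) {x y : X} (hx : 𝒢.r γ = x) (hy : 𝒢.s γ = y) (hxU : x ∈ U)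
    (hyU : y ∈ U) (w : π.Ell2Fibre y) (k : ℕ) :
    π.affine V γ hx hy w k = π.L γ hx hy (w k + V k y) - V k x := by
  rw [affine, dif_pos (h.memℓp_affine γ hx hy hxU hyU w)]

theorem isometry_affine (γ : G) {x y : X} (hx : 𝒢.r γ = x) (hy : 𝒢.s γ = y) (hxU : x ∈ U)
    (hyU : y ∈ U) : Isometry (π.affine V γ hx hy) := by
  refine Isometry.of_dist_eq fun w w' => ?_
  rw [dist_eq_norm, dist_eq_norm]
  refine lp_two_norm_congr fun k => ?_
  rw [lp.coeFn_sub, lp.coeFn_sub, Pi.sub_apply, Pi.sub_apply, h.affine_apply γ hx hy hxU hyU,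
    h.affine_apply γ hx hy hxU hyU, sub_sub_sub_cancel_right, ← map_sub, add_sub_add_right_eq_sub,
    h.norm_map γ hx hy hxU hyU]

theorem affine_mul (γ₁ γ₂ : G) {x y z : X} (hx : 𝒢.r γ₁ = x) (hy : 𝒢.s γ₁ = y)
    (hy' : 𝒢.r γ₂ = y) (hz : 𝒢.s γ₂ = z) (hxU : x ∈ U) (hyU : y ∈ U) (hzU : z ∈ U)
    (w : π.Ell2Fibre z) :
    π.affine V (𝒢.mul γ₁ γ₂ (hy.trans hy'.symm)) ((𝒢.r_mul _ _ _).trans hx)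
      ((𝒢.s_mul _ _ _).trans hz) w = π.affine V γ₁ hx hy (π.affine V γ₂ hy' hz w) := by
  ext k
  rw [h.affine_apply _ _ _ hxU hzU, h.affine_apply _ _ _ hxU hyU, h.affine_apply _ _ _ hyU hzU,
    h.mul γ₁ γ₂ hx hy hy' hz hxU hyU hzU, sub_add_cancel]
  rfl

theorem affine_unit {x : X} (hx : x ∈ U) (w : π.Ell2Fibre x) :
    π.affine V (𝒢.unit x) (𝒢.r_unit x) (𝒢.s_unit x) w = w := by
  ext k
  rw [h.affine_apply _ _ _ hx hx, h.unit hx, add_sub_cancel_right]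

omit h in
theorem affine_congr {γ γ' : G} (e : γ = γ') {x y : X} (hx : 𝒢.r γ = x) (hy : 𝒢.s γ = y) :
    π.affine V γ hx hy = π.affine V γ' (e ▸ hx) (e ▸ hy) := by
  subst e
  rfl

theorem surjective_affine (γ : G) {x y : X} (hx : 𝒢.r γ = x) (hy : 𝒢.s γ = y) (hxU : x ∈ U)
    (hyU : y ∈ U) : Function.Surjective (π.affine V γ hx hy) := fun w => by
  refine ⟨π.affine V (𝒢.inv γ) ((𝒢.r_inv γ).trans hy) ((𝒢.s_inv γ).trans hx) w, ?_⟩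
  rw [← h.affine_mul γ (𝒢.inv γ) hx hy ((𝒢.r_inv γ).trans hy) ((𝒢.s_inv γ).trans hx) hxU hyU hxU,
    affine_congr ((𝒢.mul_inv γ).trans (congrArg 𝒢.unit hx)), h.affine_unit hxU]

end IsAffineOn

variable {π V}

open Classical in
theorem isBorel_affine {U : Set X} (h : π.IsAffineOn V U) (hU : MeasurableSet U)
    (hV : ∀ k, π.bundle.IsBorel (V k)) {w : ∀ x, π.Ell2Fibre x} (hw : π.bundle.ell2.IsBorel w) :
    (π.bundle.ell2.comap 𝒢.r 𝒢.measurable_r).IsBorel fun γ =>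
      if 𝒢.r γ ∈ U ∧ 𝒢.s γ ∈ U then π.affine V γ rfl rfl (w (𝒢.s γ)) else 0 := by
  refine (HilbertBundle.isBorel_ell2_iff (H := π.bundle.comap 𝒢.r 𝒢.measurable_r)).2 fun k => ?_
  have hm : MeasurableSet {γ | 𝒢.r γ ∈ U ∧ 𝒢.s γ ∈ U} :=
    (𝒢.measurable_r hU).inter (𝒢.measurable_s hU)
  have h1 := (π.isBorel_apply (((HilbertBundle.isBorel_ell2_iff.1 hw k).add (hV k)).comap
    𝒢.measurable_s)).sub ((hV k).comap 𝒢.measurable_r)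
  have h2 := h1.ite HilbertBundle.isBorel_zero hm
  refine fun n => Measurable.of_eq (h2 n) fun γ => congrArg _ ?_
  by_cases hγ : 𝒢.r γ ∈ U ∧ 𝒢.s γ ∈ U
  · simp only [hγ, and_self, if_true]
    exact (h.affine_apply γ rfl rfl hγ.1 hγ.2 _ k).symm
  · simp only [hγ, if_false]
    rfl

open Classical in
/-- The representation on Gaussian Hilbert spaces defined by an affine action. -/
def gauss (U : Set X) (h : π.IsAffineOn V U) (hU : MeasurableSet U) (hU0 : μ Uᶜ = 0)
    (hV : ∀ k, π.bundle.IsBorel (V k)) : Representation 𝒢 μ :=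
  ofIsometric π.bundle.ell2.gauss
    (fun γ x y hx hy => if x ∈ U ∧ y ∈ U then Gauss.map (π.affine V γ hx hy) else 0)
    (fun m n => by
      have h1 := (isBorel_affine h hU hV
        (HilbertBundle.isBorel_denseSection (H := π.bundle.ell2) n.unpair.1)).gauss_vec n.unpair.2 m
      have hm : MeasurableSet {γ | 𝒢.r γ ∈ U ∧ 𝒢.s γ ∈ U} :=
        (𝒢.measurable_r hU).inter (𝒢.measurable_s hU)
      refine Measurable.of_eq (f := fun γ => if 𝒢.r γ ∈ U ∧ 𝒢.s γ ∈ U then _ else 0)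
        (Measurable.ite hm h1 measurable_const) fun γ => ?_
      by_cases hγ : 𝒢.r γ ∈ U ∧ 𝒢.s γ ∈ U
      · simp only [hγ, and_self, if_true]
        refine congrArg _ (Eq.symm ?_)
        exact Gauss.map_vec (h.isometry_affine γ rfl rfl hγ.1 hγ.2) _ _
      · simp only [hγ, if_false]
        exact (inner_zero_right _).symm)
    U hU hU0
    (fun γ x y hx hy hxU hyU v => by
      rw [if_pos ⟨hxU, hyU⟩]
      exact Gauss.norm_map (h.isometry_affine γ hx hy hxU hyU) v)
    (fun γ₁ γ₂ x y z hx hy hy' hz hxU hyU hzU => by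
      rw [if_pos ⟨hxU, hzU⟩, if_pos ⟨hxU, hyU⟩, if_pos ⟨hyU, hzU⟩]
      refine Eq.trans ?_ (Gauss.map_comp (h.isometry_affine γ₂ hy' hz hyU hzU)
        (h.isometry_affine γ₁ hx hy hxU hyU))
      exact congrArg Gauss.map (funext fun w =>
        h.affine_mul γ₁ γ₂ hx hy hy' hz hxU hyU hzU w))
    (fun x hx => by
      rw [if_pos ⟨hx, hx⟩]
      refine Eq.trans ?_ Gauss.map_id
      exact congrArg Gauss.map (funext fun w => h.affine_unit hx w))

theorem gauss_L {U : Set X} (h : π.IsAffineOn V U) (hU : MeasurableSet U) (hU0 : μ Uᶜ = 0)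
    (hV : ∀ k, π.bundle.IsBorel (V k)) (γ : G) {x y : X} (hx : 𝒢.r γ = x) (hy : 𝒢.s γ = y)
    (hxU : x ∈ U) (hyU : y ∈ U) :
    (gauss U h hU hU0 hV).L γ hx hy = Gauss.map (π.affine V γ hx hy) :=
  if_pos ⟨hxU, hyU⟩

/-- The Gaussians widen with `i`, so any two fixed points become indistinguishable. This supplies
almost invariant vectors for every affine isometric action. -/
theorem tendsto_norm_vec_sub {F : Type u} [NormedAddCommGroup F] [InnerProductSpace ℂ F]
    (v w : F) : Tendsto (fun i : ℕ => ‖Gauss.vec v i - Gauss.vec w i‖) atTop (𝓝 0) := by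
  have h1 : Tendsto (fun i : ℕ => ‖v - w‖ ^ 2 / ((i : ℝ) + 1)) atTop (𝓝 0) := by
    have := (tendsto_one_div_add_atTop_nhds_zero_nat (𝕜 := ℝ)).const_mul (‖v - w‖ ^ 2)
    rw [mul_zero] at this
    exact this.congr fun i => by ring
  have h2 : Tendsto (fun i : ℕ => √(2 - 2 * Real.exp (-(‖v - w‖ ^ 2 / ((i : ℝ) + 1))))) atTop
      (𝓝 0) := by
    have hc : Continuous fun t : ℝ => √(2 - 2 * Real.exp (-t)) := by fun_prop
    have := (hc.tendsto 0).comp h1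
    simpa [Function.comp_def] using this
  refine h2.congr fun i => ?_
  rw [← Gauss.norm_vec_sub_sq, Real.sqrt_sq (norm_nonneg _)]

/-! ### Pull-backs of representations -/

theorem inner_L_eq {m n : ℕ} (π : Representation 𝒢 μ) (γ : G) {x y : X} (hx : 𝒢.r γ = x)
    (hy : 𝒢.s γ = y) :
    Inner.inner ℂ (π.bundle.fund m x) (π.L γ hx hy (π.bundle.fund n y)) =
      Inner.inner ℂ (π.bundle.fund m (𝒢.r γ)) (π.L γ rfl rfl (π.bundle.fund n (𝒢.s γ))) := by
  subst hx hy
  rfl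

variable {Y G' : Type u} [MeasurableSpace Y] [MeasurableSpace G'] {𝒢' : BorelGroupoid Y G'}

/-- The pull-back of a representation along a Borel homomorphism of groupoids. -/
def comap (π : Representation 𝒢 μ) (ν : Measure Y) {p : Y → X} (hp : Measurable p) {Φ : G' → G}
    (hΦ : Measurable Φ) (hr : ∀ γ, 𝒢.r (Φ γ) = p (𝒢'.r γ)) (hs : ∀ γ, 𝒢.s (Φ γ) = p (𝒢'.s γ))
    (hmul : ∀ a b (h : 𝒢'.s a = 𝒢'.r b), Φ (𝒢'.mul a b h) =
      𝒢.mul (Φ a) (Φ b) ((hs a).trans ((congrArg p h).trans (hr b).symm)))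
    (hac : ν.map p ≪ μ) : Representation 𝒢' ν where
  bundle := π.bundle.comap p hp
  L γ x y hx hy := π.L (Φ γ) ((hr γ).trans (congrArg p hx)) ((hs γ).trans (congrArg p hy))
  borel m n := Measurable.of_eq ((π.borel m n).comp hΦ) fun γ =>
    (π.inner_L_eq (Φ γ) (hr γ) (hs γ)).symm
  conull := by
    obtain ⟨U, hU, hU0, h1, h2⟩ := π.conull
    refine ⟨p ⁻¹' U, hp hU, ?_, fun γ x y hx hy hxU hyU => h1 _ _ _ hxU hyU, ?_⟩
    · rw [← Set.preimage_compl, ← Measure.map_apply hp hU.compl]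
      exact hac hU0
    · intro γ₁ γ₂ x y z hx hy hy' hz hxU hyU hzU
      exact (clm_congr π.L (hmul _ _ _) _ _).trans
        (h2 (Φ γ₁) (Φ γ₂) _ _ ((hr γ₂).trans (congrArg p hy')) _ hxU hyU hzU)

end Representation

/-! ### Arrows of semi-direct groupoids -/

namespace GSpace

variable {G₀ G X : Type u} [MeasurableSpace G₀] [MeasurableSpace G] [MeasurableSpace X]
  {𝒢 : BorelGroupoid G₀ G} (𝒳 : GSpace 𝒢 X)

open Classical in
/-- The action of `γ⁻¹`, extended by the identity to the points where it is not defined. -/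
def invActTotal (γ : G) (x : X) : X :=
  if h : 𝒳.anchor x = 𝒢.r γ then 𝒳.invAct γ x h else x

theorem invActTotal_eq {γ : G} {x : X} (h : 𝒳.anchor x = 𝒢.r γ) :
    𝒳.invActTotal γ x = 𝒳.invAct γ x h := dif_pos h

variable [StandardBorelSpace G₀]

theorem measurable_invActTotal : Measurable fun q : X × G => 𝒳.invActTotal q.2 q.1 := by
  refine measurable_of_restrict_of_restrict_compl 𝒳.measurableSet_arrow ?_ ?_
  · refine Measurable.of_eq 𝒳.measurable_invAct fun q => ?_
    exact (𝒳.invActTotal_eq q.2).symm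
  · refine Measurable.of_eq (measurable_fst.comp measurable_subtype_coe) fun q => ?_
    have hq : ¬ 𝒳.anchor q.1.1 = 𝒢.r q.1.2 := q.2
    change q.1.1 = 𝒳.invActTotal q.1.2 q.1.1
    rw [invActTotal, dif_neg hq]

variable [StandardBorelSpace X] (lam : HaarSystem 𝒢) {μ : Measure X}

theorem ae_haarMeasure_iff (x : X) {Q : 𝒳.Arrow → Prop} :
    (∀ᵐ q ∂(𝒳.haar lam).kernel x, Q q) ↔
      ∀ᵐ γ ∂lam.kernel (𝒳.anchor x), ∀ h : 𝒳.anchor x = 𝒢.r γ, Q ⟨(x, γ), h⟩ := by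
  rw [ae_iff, ae_iff]
  change 𝒳.haarMeasure lam x _ = 0 ↔ _
  rw [𝒳.haarMeasure_apply]
  simp only [not_forall]
  rfl

theorem ae_ae_of_ae_arrow {Q : 𝒳.Arrow → Prop} (h : ∀ᵐ q ∂arrowMeasure (𝒳.haar lam) μ, Q q) :
    ∀ᵐ x ∂μ, ∀ᵐ γ ∂lam.kernel (𝒳.anchor x), ∀ h : 𝒳.anchor x = 𝒢.r γ, Q ⟨(x, γ), h⟩ := by
  filter_upwards [MeasGpd.ae_ae_of_ae_arrow (𝒳.haar lam) h] with x hx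
  rwa [ae_haarMeasure_iff] at hx

theorem ae_arrow_of_ae_ae {Q : 𝒳.Arrow → Prop} (hQ : MeasurableSet {q | Q q})
    (h : ∀ᵐ x ∂μ, ∀ᵐ γ ∂lam.kernel (𝒳.anchor x), ∀ h : 𝒳.anchor x = 𝒢.r γ, Q ⟨(x, γ), h⟩) :
    ∀ᵐ q ∂arrowMeasure (𝒳.haar lam) μ, Q q := by
  rw [ae_arrow_iff (𝒳.haar lam) hQ]
  filter_upwards [h] with x hx
  rwa [ae_haarMeasure_iff]

end GSpace

/-! ### Measure preserving pairs -/

/-- The data of a measure preserving equivariant map between `G`-spaces. -/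
structure FibreSystem {G₀ G X Y : Type u} [MeasurableSpace G₀] [MeasurableSpace G]
    [MeasurableSpace X] [MeasurableSpace Y] {𝒢 : BorelGroupoid G₀ G} (𝒴 : GSpace 𝒢 Y)
    (𝒳 : GSpace 𝒢 X) (p : Y → X) (ρ : Kernel X Y) : Prop where
  measurable : Measurable p
  anchor : ∀ y, 𝒳.anchor (p y) = 𝒴.anchor y
  equivariant : ∀ γ y h, p (𝒴.act γ y h) = 𝒳.act γ (p y) (h.trans (anchor y).symm)
  fibre : ∀ x, ρ x {y | p y ≠ x} = 0
  invariant : ∀ (γ : G) (x : X) (h : 𝒢.s γ = 𝒳.anchor x) (A : Set Y), MeasurableSet A →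
    ρ x {y | ∃ h' : 𝒢.s γ = 𝒴.anchor y, 𝒴.act γ y h' ∈ A} = ρ (𝒳.act γ x h) A

namespace FibreSystem

variable {G₀ G X Y : Type u} [MeasurableSpace G₀] [MeasurableSpace G] [MeasurableSpace X]
  [MeasurableSpace Y] {𝒢 : BorelGroupoid G₀ G} {𝒴 : GSpace 𝒢 Y}
  {𝒳 : GSpace 𝒢 X} {p : Y → X} {ρ : Kernel X Y} (hp : FibreSystem 𝒴 𝒳 p ρ)
include hp

theorem ae_eq (x : X) : ∀ᵐ y ∂ρ x, p y = x := hp.fibre x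

theorem p_invAct (γ : G) (y : Y) (h : 𝒴.anchor y = 𝒢.r γ) :
    p (𝒴.invAct γ y h) = 𝒳.invAct γ (p y) ((hp.anchor y).trans h) :=
  hp.equivariant _ _ _

/-- The homomorphism of semi-direct groupoids induced by an equivariant map. -/
def arrowMap (q : 𝒴.Arrow) : 𝒳.Arrow := ⟨(p q.1.1, q.1.2), (hp.anchor q.1.1).trans q.2⟩

theorem measurable_arrowMap : Measurable hp.arrowMap :=
  Measurable.subtype_mk ((hp.measurable.comp (measurable_fst.comp measurable_subtype_coe)).prodMk
    (measurable_snd.comp measurable_subtype_coe))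

theorem s_arrowMap (q : 𝒴.Arrow) :
    𝒳.semidirect.s (hp.arrowMap q) = p (𝒴.semidirect.s q) :=
  (hp.p_invAct q.1.2 q.1.1 q.2).symm

variable [StandardBorelSpace G₀]

/-- This is the invariance of the fibre measures for the arrow `γ⁻¹`. The arbitrary values of
`invActTotal` do not matter, because `ρ x` is carried by the fibre over `x`, where the action of
`γ⁻¹` is defined. -/
theorem measurePreserving (γ : G) (x : X) (h : 𝒳.anchor x = 𝒢.r γ) :
    MeasurePreserving (𝒴.invActTotal γ) (ρ x) (ρ (𝒳.invAct γ x h)) := by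
  have hm : Measurable (𝒴.invActTotal γ) :=
    𝒴.measurable_invActTotal.comp (measurable_id.prodMk measurable_const)
  refine ⟨hm, ?_⟩
  ext A hA
  rw [Measure.map_apply hm hA]
  refine Eq.trans ?_ (hp.invariant (𝒢.inv γ) x ((𝒢.s_inv γ).trans h.symm) A hA)
  refine measure_congr ?_
  filter_upwards [hp.ae_eq x] with y hy
  have hy' : 𝒴.anchor y = 𝒢.r γ := by rw [← hp.anchor, hy, h]
  refine propext ⟨fun hm => ⟨(𝒢.s_inv γ).trans hy'.symm, ?_⟩, ?_⟩
  · have hm' : 𝒴.invActTotal γ y ∈ A := hm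
    rwa [𝒴.invActTotal_eq hy'] at hm'
  · rintro ⟨h', hm⟩
    change 𝒴.invActTotal γ y ∈ A
    rwa [𝒴.invActTotal_eq hy']

variable [StandardBorelSpace Y] [IsMarkovKernel ρ] (lam : HaarSystem 𝒢) {μ : Measure X}

/-- All points `y` above `x` share the Haar measure `λ^{r(x)}`, so Fubini allows the arrow to be
chosen before `y`. A property of almost all arrows of `Y` becomes one of `ρ x`-almost all `y`, for
almost every arrow of `X`. -/
theorem ae_arrow_iff {S : Set 𝒴.Arrow} (hS : MeasurableSet S) :
    (∀ᵐ q ∂arrowMeasure (𝒴.haar lam) (μ.bind ρ), q ∈ S) ↔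
    ∀ᵐ x ∂μ, ∀ᵐ γ ∂lam.kernel (𝒳.anchor x), ∀ᵐ y ∂ρ x,
      ∀ h : 𝒴.anchor y = 𝒢.r γ, (⟨(y, γ), h⟩ : 𝒴.Arrow) ∈ S := by
  have hm : MeasurableSet {q : Y × G | ∀ h : 𝒴.anchor q.1 = 𝒢.r q.2, (⟨q, h⟩ : 𝒴.Arrow) ∈ S} := by
    have h1 := (𝒴.measurableSet_image hS.compl).compl
    convert h1 using 1
    ext q
    simp
  have hmB : MeasurableSet {y | ∀ᵐ q ∂(𝒴.haar lam).kernel y, q ∈ S} :=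
    (𝒴.haar lam).kernel.measurable_coe hS.compl (measurableSet_singleton 0)
  refine (MeasGpd.ae_arrow_iff (𝒴.haar lam) (p := fun q => q ∈ S) hS).trans ?_
  refine (Measure.ae_comp_iff (μ := μ) (κ := ρ) hmB).trans ?_
  refine eventually_congr (Eventually.of_forall fun x => ?_)
  have h1 : (∀ᵐ y ∂ρ x, ∀ᵐ q ∂(𝒴.haar lam).kernel y, q ∈ S) ↔
      ∀ᵐ y ∂ρ x, ∀ᵐ γ ∂lam.kernel (𝒳.anchor x),
        ∀ h : 𝒴.anchor y = 𝒢.r γ, (⟨(y, γ), h⟩ : 𝒴.Arrow) ∈ S := by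
    refine eventually_congr ?_
    filter_upwards [hp.ae_eq x] with y hy
    have e : lam.kernel (𝒴.anchor y) = lam.kernel (𝒳.anchor x) := by rw [← hp.anchor, hy]
    rw [𝒴.ae_haarMeasure_iff, e]
  rw [h1]
  exact Measure.ae_ae_comm hm

theorem ae_ae_ae {Q : 𝒴.Arrow → Prop}
    (h : ∀ᵐ q ∂arrowMeasure (𝒴.haar lam) (μ.bind ρ), Q q) :
    ∀ᵐ x ∂μ, ∀ᵐ γ ∂lam.kernel (𝒳.anchor x), ∀ᵐ y ∂ρ x,
      ∀ h : 𝒴.anchor y = 𝒢.r γ, Q ⟨(y, γ), h⟩ := by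
  obtain ⟨S, hS, hS0, hSQ⟩ := exists_measurable_conull h
  have h1 := (hp.ae_arrow_iff lam hS).1 hS0
  filter_upwards [h1] with x hx
  filter_upwards [hx] with γ hγ
  filter_upwards [hγ] with y hy h using hSQ _ (hy h)

end FibreSystem

/-! ### Fibre integrals of sections -/

namespace HilbertBundle

variable {X Y : Type u} [MeasurableSpace X] [MeasurableSpace Y] {H : HilbertBundle X}
  {p : Y → X}

open Classical in
/-- The values of a field over `Y` at the points of the fibre above `x`, and `0` elsewhere. -/
def onFibre (η : ∀ y, H.Fibre (p y)) (x : X) (y : Y) : H.Fibre x :=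
  if h : p y = x then h ▸ η y else 0

omit [MeasurableSpace Y] in
theorem onFibre_self (η : ∀ y, H.Fibre (p y)) (y : Y) : onFibre η (p y) y = η y := dif_pos rfl

omit [MeasurableSpace Y] in
theorem norm_onFibre_le {η : ∀ y, H.Fibre (p y)} {C : ℝ} (hC : ∀ y, ‖η y‖ ≤ C) (hC0 : 0 ≤ C)
    (x : X) (y : Y) : ‖onFibre η x y‖ ≤ C := by
  by_cases h : p y = x
  · subst h
    rw [onFibre_self]
    exact hC y
  · rw [onFibre, dif_neg h, norm_zero]
    exact hC0

/-- Above a single `x` all values lie in one Hilbert space, and Borel selections from the dense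
sequence are countably valued functions that approximate the field there. -/
theorem stronglyMeasurable_onFibre [MeasurableSingletonClass X] {hp : Measurable p}
    {η : ∀ y, H.Fibre (p y)} (hη : (H.comap p hp).IsBorel η) (x : X) :
    StronglyMeasurable (onFibre η x) := by
  classical
  choose N hN hNlt using fun k : ℕ => hη.exists_approx (ε := 1 / ((k : ℝ) + 1)) (by positivity)
  refine stronglyMeasurable_of_tendsto atTop
    (f := fun (k : ℕ) y => if p y = x then H.denseSection (N k y) x else 0) (fun k => ?_)
    (tendsto_pi_nhds.2 fun y => ?_)
  · refine StronglyMeasurable.ite (hp (measurableSet_singleton x)) ?_ stronglyMeasurable_const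
    exact (StronglyMeasurable.of_discrete (f := fun m : ℕ => H.denseSection m x)).comp_measurable
      (hN k)
  · by_cases h : p y = x
    · subst h
      simp only [if_true, onFibre_self]
      rw [tendsto_iff_norm_sub_tendsto_zero]
      refine squeeze_zero (fun _ => norm_nonneg _) (fun k => ?_)
        (tendsto_one_div_add_atTop_nhds_zero_nat (𝕜 := ℝ))
      rw [norm_sub_rev]
      exact (hNlt k y).le
    · simp only [h, if_false, onFibre, dite_false]
      exact tendsto_const_nhds

variable [StandardBorelSpace X] {ρ : Kernel X Y} [IsMarkovKernel ρ]

theorem integrable_onFibre {hp : Measurable p} {η : ∀ y, H.Fibre (p y)}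
    (hη : (H.comap p hp).IsBorel η) (h1 : ∀ y, ‖η y‖ ≤ 1) (x : X) :
    Integrable (onFibre η x) (ρ x) :=
  Integrable.of_bound (stronglyMeasurable_onFibre hη x).aestronglyMeasurable 1
    (Eventually.of_forall (norm_onFibre_le h1 zero_le_one x))

variable (ρ) in
/-- The integral of a field along the fibres of `p`. -/
def fibreIntegral (η : ∀ y, H.Fibre (p y)) (x : X) : H.Fibre x := ∫ y, onFibre η x y ∂ρ x

theorem inner_fibreIntegral {hp : Measurable p} {η : ∀ y, H.Fibre (p y)}
    (hη : (H.comap p hp).IsBorel η) (h1 : ∀ y, ‖η y‖ ≤ 1) (x : X) (v : H.Fibre x) :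
    Inner.inner ℂ v (fibreIntegral ρ η x) = ∫ y, Inner.inner ℂ v (onFibre η x y) ∂ρ x :=
  (integral_inner (integrable_onFibre hη h1 x) v).symm

theorem isBorel_fibreIntegral {hp : Measurable p} {η : ∀ y, H.Fibre (p y)}
    (hη : (H.comap p hp).IsBorel η) (h1 : ∀ y, ‖η y‖ ≤ 1) (hfib : ∀ x, ∀ᵐ y ∂ρ x, p y = x) :
    H.IsBorel (fibreIntegral ρ η) := fun n => by
  refine Measurable.of_eq ((hη n).stronglyMeasurable.integral_kernel (κ := ρ)).measurable
    fun x => ?_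
  rw [inner_fibreIntegral hη h1]
  refine integral_congr_ae ?_
  filter_upwards [hfib x] with y hy
  subst hy
  rw [onFibre_self]

/-- If the fibre integrals of normalised fields which converge to a field of unit vectors on
`Y₁` and vanish off `Y₁` are zero, then `Y₁` is null. -/
theorem measure_eq_zero_of_fibreIntegral {hp : Measurable p} {η : ℕ → ∀ y, H.Fibre (p y)}
    (hη : ∀ k, (H.comap p hp).IsBorel (η k)) (h1 : ∀ k y, ‖η k y‖ ≤ 1) {x : X}
    (hfib : ∀ᵐ y ∂ρ x, p y = x) {ξ : ℕ → ∀ x, H.Fibre x} (hξ : ∀ k, ‖ξ k x‖ = 1) {Y₁ : Set Y}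
    (hY₁ : MeasurableSet Y₁) (h0 : ∀ k, ∀ y ∉ Y₁, η k y = 0)
    (hlim : ∀ y ∈ Y₁, p y = x → Tendsto (fun k => ‖η k y - ξ k (p y)‖) atTop (𝓝 0))
    (hz : ∀ k, fibreIntegral ρ (η k) x = 0) : ρ x Y₁ = 0 := by
  -- The pairings of `ξₖ` with `ηₖ` are bounded by `1` and converge to the indicator of `Y₁`. Their
  -- integrals are the pairings with the fibre integrals, hence zero.
  have hi : Tendsto (fun k => ∫ y, Inner.inner ℂ (ξ k x) (onFibre (η k) x y) ∂ρ x) atTop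
      (𝓝 (∫ y, Y₁.indicator (fun _ => (1 : ℂ)) y ∂ρ x)) := by
    refine tendsto_integral_of_dominated_convergence (fun _ => 1) (fun k => ?_)
      (integrable_const 1) (fun k => ?_) ?_
    · exact ((stronglyMeasurable_const (b := ξ k x)).inner
        (stronglyMeasurable_onFibre (hη k) x)).aestronglyMeasurable
    · refine Eventually.of_forall fun y => (norm_inner_le_norm _ _).trans ?_
      rw [hξ, one_mul]
      exact norm_onFibre_le (h1 k) zero_le_one x y
    · filter_upwards [hfib] with y hy
      subst hy
      simp only [onFibre_self]
      by_cases hyY : y ∈ Y₁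
      · rw [Set.indicator_of_mem hyY, tendsto_iff_norm_sub_tendsto_zero]
        refine squeeze_zero (fun _ => norm_nonneg _) (fun k => ?_) (hlim y hyY rfl)
        have h2 : (1 : ℂ) = Inner.inner ℂ (ξ k (p y)) (ξ k (p y)) := by
          rw [inner_self_eq_norm_sq_to_K, hξ]
          simp
        rw [h2, ← inner_sub_right]
        refine (norm_inner_le_norm _ _).trans ?_
        rw [hξ, one_mul]
      · rw [Set.indicator_of_notMem hyY]
        simp only [h0 _ y hyY, inner_zero_right]
        exact tendsto_const_nhds
  have hzero : ∀ k, ∫ y, Inner.inner ℂ (ξ k x) (onFibre (η k) x y) ∂ρ x = 0 := fun k => by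
    rw [← inner_fibreIntegral (hη k) (h1 k), hz, inner_zero_right]
  simp only [hzero] at hi
  have h3 := tendsto_nhds_unique hi tendsto_const_nhds
  rw [integral_indicator_const _ hY₁] at h3
  simpa [Measure.real, ENNReal.toReal_eq_zero_iff] using h3

end HilbertBundle

/-! ### Fibre integrals of invariant fields -/

namespace FibreSystem

variable {G₀ G X Y : Type u} [MeasurableSpace G₀] [MeasurableSpace G] [MeasurableSpace X]
  [MeasurableSpace Y] {𝒢 : BorelGroupoid G₀ G} {𝒴 : GSpace 𝒢 Y}
  {𝒳 : GSpace 𝒢 X} {p : Y → X} {ρ : Kernel X Y} (hp : FibreSystem 𝒴 𝒳 p ρ) {μ : Measure X}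
  (π : Representation 𝒳.semidirect μ)
include hp

/-- Invariance of a field over `Y` under a representation of the groupoid of `X`. -/
def IsInvariantAt (η : ∀ y, π.bundle.Fibre (p y)) (q : 𝒴.Arrow) : Prop :=
  π.L (hp.arrowMap q) rfl (hp.s_arrowMap q) (η (𝒴.semidirect.s q)) = η q.1.1

variable {π}

omit [MeasurableSpace Y] hp in
theorem L_onFibre (η : ∀ y, π.bundle.Fibre (p y)) (q : 𝒳.Arrow) {x x' : X}
    (hx : 𝒳.semidirect.r q = x) (hx' : 𝒳.semidirect.s q = x') {z : Y} (hz : p z = x') :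
    π.L q hx hx' (HilbertBundle.onFibre η x' z) = π.L q hx (hx'.trans hz.symm) (η z) := by
  subst hz
  rw [HilbertBundle.onFibre_self]

theorem L_onFibre_invActTotal {η : ∀ y, π.bundle.Fibre (p y)} {x : X} {γ : G}
    (hxγ : 𝒳.anchor x = 𝒢.r γ) {y : Y} (hy : p y = x)
    (hinv : ∀ h : 𝒴.anchor y = 𝒢.r γ, hp.IsInvariantAt π η ⟨(y, γ), h⟩) :
    π.L ⟨(x, γ), hxγ⟩ rfl rfl (HilbertBundle.onFibre η (𝒳.invAct γ x hxγ) (𝒴.invActTotal γ y)) =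
      HilbertBundle.onFibre η x y := by
  subst hy
  have h : 𝒴.anchor y = 𝒢.r γ := (hp.anchor y).symm.trans hxγ
  rw [𝒴.invActTotal_eq h, HilbertBundle.onFibre_self]
  exact (L_onFibre η ⟨(p y, γ), hxγ⟩ rfl rfl (hp.p_invAct γ y h)).trans (hinv h)

variable [StandardBorelSpace G₀] [StandardBorelSpace X] [IsMarkovKernel ρ]

/-- A bounded operator commutes with the integral. The substitution `y ↦ γ⁻¹y`, which carries `ρ x`
to `ρ (γ⁻¹x)`, then turns the integrand into the field itself by invariance. -/
theorem L_fibreIntegral {η : ∀ y, π.bundle.Fibre (p y)}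
    (hη : (π.bundle.comap p hp.measurable).IsBorel η) (h1 : ∀ y, ‖η y‖ ≤ 1) {x : X} {γ : G}
    (hxγ : 𝒳.anchor x = 𝒢.r γ)
    (hinv : ∀ᵐ y ∂ρ x, ∀ h : 𝒴.anchor y = 𝒢.r γ, hp.IsInvariantAt π η ⟨(y, γ), h⟩) :
    π.L ⟨(x, γ), hxγ⟩ rfl rfl (HilbertBundle.fibreIntegral ρ η (𝒳.invAct γ x hxγ)) =
      HilbertBundle.fibreIntegral ρ η x := by
  have hmp := hp.measurePreserving γ x hxγ
  refine (ContinuousLinearMap.integral_comp_comm (π.L ⟨(x, γ), hxγ⟩ rfl rfl)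
    (HilbertBundle.integrable_onFibre hη h1 (𝒳.invAct γ x hxγ))).symm.trans ?_
  have hsm := (π.L ⟨(x, γ), hxγ⟩ rfl rfl).continuous.comp_stronglyMeasurable
    (HilbertBundle.stronglyMeasurable_onFibre hη (𝒳.invAct γ x hxγ))
  rw [← hmp.map_eq]
  refine (integral_map hmp.measurable.aemeasurable hsm.aestronglyMeasurable).trans ?_
  refine integral_congr_ae ?_
  filter_upwards [hinv, hp.ae_eq x] with y h2 h3
  exact hp.L_onFibre_invActTotal hxγ h3 h2

variable [StandardBorelSpace Y] (lam : HaarSystem 𝒢)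

theorem ae_coboundary_fibreIntegral {η : ∀ y, π.bundle.Fibre (p y)}
    (hη : (π.bundle.comap p hp.measurable).IsBorel η) (h1 : ∀ y, ‖η y‖ ≤ 1)
    (hinv : ∀ᵐ q ∂arrowMeasure (𝒴.haar lam) (μ.bind ρ), hp.IsInvariantAt π η q) :
    ∀ᵐ q ∂arrowMeasure (𝒳.haar lam) μ,
      π.L q rfl rfl (HilbertBundle.fibreIntegral ρ η (𝒳.semidirect.s q)) =
        HilbertBundle.fibreIntegral ρ η (𝒳.semidirect.r q) := by
  have hb : π.bundle.IsBorel (HilbertBundle.fibreIntegral ρ η) :=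
    HilbertBundle.isBorel_fibreIntegral hη h1 hp.ae_eq
  have hm : MeasurableSet {q | ‖π.coboundary hb.toSection q‖ = 0} :=
    π.measurable_norm_coboundary hb.toSection (measurableSet_singleton 0)
  have h2 : ∀ᵐ q ∂arrowMeasure (𝒳.haar lam) μ, ‖π.coboundary hb.toSection q‖ = 0 := by
    refine 𝒳.ae_arrow_of_ae_ae lam hm ?_
    filter_upwards [hp.ae_ae_ae lam hinv] with x hx
    filter_upwards [hx] with γ hγ h
    rw [norm_eq_zero]
    exact sub_eq_zero.2 (hp.L_fibreIntegral hη h1 h hγ).symm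
  filter_upwards [h2] with q hq
  exact (sub_eq_zero.1 (norm_eq_zero.1 hq)).symm

end FibreSystem

/-! ### Descent of property T along measure preserving maps, for discrete groupoids -/

namespace Representation

variable {X G : Type u} [MeasurableSpace X] [MeasurableSpace G] {𝒢 : BorelGroupoid X G}
  {μ : Measure X} {lam : HaarSystem 𝒢}

/-- In a discrete groupoid, almost invariant unit sections yield an affine action. -/
theorem exists_isAffineOn [StandardBorelSpace G] [SFinite μ] (hd : 𝒢.IsRDiscrete)
    (hq : QuasiInvariant lam μ) (π : Representation 𝒢 μ)
    (h : π.AlmostHasUnitInvariantSections lam) :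
    ∃ (ξ : ℕ → π.bundle.BorelSection) (U : Set X), MeasurableSet U ∧ μ Uᶜ = 0 ∧
      (∀ k, ∀ x ∈ U, ‖(ξ k).toFun x‖ = 1) ∧
      π.IsAffineOn (fun k x => (k : ℂ) • (ξ k).toFun x) U := by
  obtain ⟨ξ, hξ, hlim⟩ := h
  have : SFinite (arrowMeasure lam μ) := inferInstanceAs (SFinite (lam.kernel ∘ₘ μ))
  -- The subsequence is chosen so that `k` times its `k`-th coboundary is square summable almost
  -- everywhere.
  obtain ⟨φ, hφ⟩ := exists_seq_ae_summable (arrowMeasure lam μ)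
    (fun n => π.measurable_norm_coboundary (ξ n)) hlim
  obtain ⟨W, hW, hW0, hWiso, hWmul⟩ := π.conull
  have hWae : ∀ᵐ x ∂μ, x ∈ W := hW0
  have hunit : ∀ᵐ x ∂μ, ∀ k, ‖(ξ (φ k)).toFun x‖ = 1 := ae_all_iff.2 fun k => hξ (φ k)
  -- The units in `U` are charged by their Haar measures, so the almost everywhere summability holds
  -- for every arrow between points of `U`. An affine action requires this for all of these arrows.
  obtain ⟨U, hU, hU0, hUP⟩ := exists_measurable_conull (((hWae.and hunit).and
    (ae_kernel_unit_ne_zero hd hq)).and (ae_forall_arrow_of_ae hφ))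
  refine ⟨fun k => ξ (φ k), U, hU, hU0, fun k x hx => (hUP x hx).1.1.2 k, ⟨?_, ?_⟩, ?_⟩
  · exact fun γ x y hx hy hxU hyU => (hWiso γ hx hy (hUP x hxU).1.1.1 (hUP y hyU).1.1.1).1
  · exact fun γ₁ γ₂ x y z hx hy hy' hz hxU hyU hzU => hWmul γ₁ γ₂ hx hy hy' hz
      (hUP x hxU).1.1.1 (hUP y hyU).1.1.1 (hUP z hzU).1.1.1
  · intro γ x y hx hy hxU hyU
    subst hx hy
    refine ((hUP _ hxU).2 γ rfl (hUP _ hyU).1.2).congr fun k => ?_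
    rw [coboundary, map_smul, ← smul_sub, norm_smul, norm_sub_rev, Complex.norm_natCast]

namespace IsAffineOn

variable {π : Representation 𝒢 μ} {V : ℕ → ∀ x, π.bundle.Fibre x} {U : Set X}
  (h : π.IsAffineOn V U)
include h

theorem affine_add (γ : G) {x y : X} (hx : 𝒢.r γ = x) (hy : 𝒢.s γ = y) (hxU : x ∈ U)
    (hyU : y ∈ U) (w : π.Ell2Fibre y) (k : ℕ) :
    π.L γ hx hy (w k + V k y) = π.affine V γ hx hy w k + V k x := by
  rw [h.affine_apply γ hx hy hxU hyU, sub_add_cancel]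

theorem superlevel_nonempty_iff (γ : G) {x y : X} (hx : 𝒢.r γ = x) (hy : 𝒢.s γ = y) (hxU : x ∈ U)
    (hyU : y ∈ U) (u : Gauss (π.Ell2Fibre y)) (i : ℕ) (δ : ℝ) :
    (Gauss.superlevel (Gauss.map (π.affine V γ hx hy) u) i δ).Nonempty ↔
      (Gauss.superlevel u i δ).Nonempty := by
  rw [Gauss.superlevel_map (h.isometry_affine γ hx hy hxU hyU)
    (h.surjective_affine γ hx hy hxU hyU), Set.image_nonempty]

theorem chebyshevCenter_superlevel (γ : G) {x y : X} (hx : 𝒢.r γ = x) (hy : 𝒢.s γ = y)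
    (hxU : x ∈ U) (hyU : y ∈ U) (u : Gauss (π.Ell2Fibre y)) (i : ℕ) {δ : ℝ} (hδ : 0 < δ)
    (hne : (Gauss.superlevel u i δ).Nonempty) :
    chebyshevCenter (Gauss.superlevel (Gauss.map (π.affine V γ hx hy) u) i δ) =
      π.affine V γ hx hy (chebyshevCenter (Gauss.superlevel u i δ)) := by
  rw [Gauss.superlevel_map (h.isometry_affine γ hx hy hxU hyU)
    (h.surjective_affine γ hx hy hxU hyU)]
  exact chebyshevCenter_image (h.isometry_affine γ hx hy hxU hyU)
    (h.surjective_affine γ hx hy hxU hyU) (Gauss.isBounded_superlevel u i hδ) hne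

end IsAffineOn

end Representation

/-- With `v = c + kξ`, one has `k(v/‖v‖ - ξ) = (k - ‖v‖) v/‖v‖ + c`, and both terms on the right
have norm at most `‖c‖`. -/
theorem norm_normalize_sub_le {E : Type u} [NormedAddCommGroup E] [InnerProductSpace ℂ E] {c ξ : E}
    (hξ : ‖ξ‖ = 1) {k : ℕ} (hk : 0 < k) :
    ‖((‖c + (k : ℂ) • ξ‖⁻¹ : ℝ) : ℂ) • (c + (k : ℂ) • ξ) - ξ‖ ≤ 2 * ‖c‖ := by
  set v := c + (k : ℂ) • ξ with hv
  have hkξ : ‖(k : ℂ) • ξ‖ = k := by rw [norm_smul, hξ, Complex.norm_natCast, mul_one]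
  have h1 : |‖v‖ - k| ≤ ‖c‖ := by
    have := abs_norm_sub_norm_le v ((k : ℂ) • ξ)
    rwa [hkξ, hv, add_sub_cancel_right] at this
  have hk1 : (1 : ℝ) ≤ k := by exact_mod_cast hk
  have h2 : (k : ℂ) • (((‖v‖⁻¹ : ℝ) : ℂ) • v - ξ) =
      ((k - ‖v‖ : ℝ) : ℂ) • (((‖v‖⁻¹ : ℝ) : ℂ) • v) + c := by
    by_cases hv0 : v = 0
    · have : c = - ((k : ℂ) • ξ) := eq_neg_of_add_eq_zero_left (hv.symm.trans hv0)
      rw [hv0, this]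
      simp
    · have hn : (‖v‖ : ℂ) ≠ 0 := by exact_mod_cast norm_ne_zero_iff.2 hv0
      have e : ((‖v‖ : ℝ) : ℂ) • (((‖v‖⁻¹ : ℝ) : ℂ) • v) = v := by
        rw [smul_smul, Complex.ofReal_inv, mul_inv_cancel₀ hn, one_smul]
      rw [Complex.ofReal_sub, sub_smul, e, smul_sub, Complex.ofReal_natCast, hv]
      abel
  have h3 : ‖((‖v‖⁻¹ : ℝ) : ℂ) • v‖ ≤ 1 := by
    rw [norm_smul, Complex.norm_real, norm_inv, norm_norm]
    exact inv_mul_le_one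
  have h4 : (k : ℝ) * ‖((‖v‖⁻¹ : ℝ) : ℂ) • v - ξ‖ ≤ 2 * ‖c‖ := by
    have e : (k : ℝ) * ‖((‖v‖⁻¹ : ℝ) : ℂ) • v - ξ‖ = ‖(k : ℂ) • (((‖v‖⁻¹ : ℝ) : ℂ) • v - ξ)‖ := by
      rw [norm_smul, Complex.norm_natCast]
    rw [e, h2]
    refine (norm_add_le _ _).trans ?_
    have : ‖((k - ‖v‖ : ℝ) : ℂ) • (((‖v‖⁻¹ : ℝ) : ℂ) • v)‖ ≤ ‖c‖ := by
      rw [norm_smul, Complex.norm_real, Real.norm_eq_abs, abs_sub_comm]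
      exact (mul_le_of_le_one_right (abs_nonneg _) h3).trans h1
    linarith
  have h5 := mul_le_mul_of_nonneg_right hk1 (norm_nonneg (((‖v‖⁻¹ : ℝ) : ℂ) • v - ξ))
  linarith

theorem norm_normalize_le {E : Type u} [NormedAddCommGroup E] [InnerProductSpace ℂ E] (v : E) :
    ‖((‖v‖⁻¹ : ℝ) : ℂ) • v‖ ≤ 1 := by
  rw [norm_smul, Complex.norm_real, norm_inv, norm_norm]
  exact inv_mul_le_one

/-! ### Invariant fields on the extension obtained from the Gaussian representation -/

namespace FibreSystem

variable {G₀ G X Y : Type u} [MeasurableSpace G₀] [MeasurableSpace G] [MeasurableSpace X]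
  [MeasurableSpace Y] {𝒢 : BorelGroupoid G₀ G} {𝒴 : GSpace 𝒢 Y}
  {𝒳 : GSpace 𝒢 X} {p : Y → X} {ρ : Kernel X Y} (hp : FibreSystem 𝒴 𝒳 p ρ) {μ : Measure X}
include hp

theorem ae_bind_iff {A : Set X} (hA : MeasurableSet A) [IsMarkovKernel ρ] :
    (∀ᵐ y ∂μ.bind ρ, p y ∈ A) ↔ ∀ᵐ x ∂μ, x ∈ A := by
  refine (Measure.ae_comp_iff (hp.measurable hA)).trans ?_
  refine eventually_congr (Eventually.of_forall fun x => ?_)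
  have : (∀ᵐ y ∂ρ x, p y ∈ A) ↔ ∀ᵐ _y ∂ρ x, x ∈ A := by
    refine eventually_congr ?_
    filter_upwards [hp.ae_eq x] with y hy
    rw [hy]
  rw [this, eventually_const]

theorem map_bind_absolutelyContinuous [IsMarkovKernel ρ] : (μ.bind ρ).map p ≪ μ := by
  refine Measure.AbsolutelyContinuous.mk fun A hA hA0 => ?_
  rw [Measure.map_apply hp.measurable hA]
  have h := (hp.ae_bind_iff (μ := μ) hA.compl).2 (by rw [ae_iff]; simpa using hA0)
  refine Eq.trans (congrArg _ ?_) (ae_iff.1 h)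
  ext y
  simp

theorem ae_bind_of_ae [IsMarkovKernel ρ] {P : X → Prop} (h : ∀ᵐ x ∂μ, P x) :
    ∀ᵐ y ∂μ.bind ρ, P (p y) := by
  obtain ⟨U, hU, hU0, hUP⟩ := exists_measurable_conull h
  filter_upwards [(hp.ae_bind_iff hU).2 hU0] with y hy using hUP _ hy

variable {π : Representation 𝒳.semidirect μ} {V : ℕ → ∀ x, π.bundle.Fibre x} {U : Set X}

section Gaussian

variable [StandardBorelSpace G₀] [StandardBorelSpace Y] [IsMarkovKernel ρ] {lam : HaarSystem 𝒢}

/-- The pull-back to the extension of the Gaussian representation of an affine action. -/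
def gaussComap (h : π.IsAffineOn V U) (hU : MeasurableSet U) (hU0 : μ Uᶜ = 0)
    (hV : ∀ k, π.bundle.IsBorel (V k)) : Representation 𝒴.semidirect (μ.bind ρ) :=
  (Representation.gauss U h hU hU0 hV).comap (μ.bind ρ) hp.measurable hp.measurable_arrowMap
    (fun _ => rfl) hp.s_arrowMap (fun _ _ _ => rfl) hp.map_bind_absolutelyContinuous

omit [StandardBorelSpace G₀] [StandardBorelSpace Y] in
theorem gaussComap_L (h : π.IsAffineOn V U) (hU : MeasurableSet U) (hU0 : μ Uᶜ = 0)
    (hV : ∀ k, π.bundle.IsBorel (V k)) (q : 𝒴.Arrow) (hr : p q.1.1 ∈ U)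
    (hs : p (𝒴.semidirect.s q) ∈ U) (w : Gauss (π.Ell2Fibre (p (𝒴.semidirect.s q)))) :
    (hp.gaussComap h hU hU0 hV).L q rfl rfl w =
      Gauss.map (π.affine V (hp.arrowMap q) rfl (hp.s_arrowMap q)) w :=
  DFunLike.congr_fun
    (Representation.gauss_L h hU hU0 hV (hp.arrowMap q) rfl (hp.s_arrowMap q) hr hs) w

set_option maxHeartbeats 1000000 in
/-- If the extension has property T, then the Gaussian representation of an affine action has an
invariant unit vector after pulling it back. -/
theorem exists_invariant_gauss (hq : QuasiInvariant (𝒴.haar lam) (μ.bind ρ))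
    (h : π.IsAffineOn V U) (hU : MeasurableSet U) (hU0 : μ Uᶜ = 0)
    (hV : ∀ k, π.bundle.IsBorel (V k)) (hT : HasPropertyT (𝒴.haar lam) (μ.bind ρ)) :
    ∃ u : ∀ y, Gauss (π.Ell2Fibre (p y)), (π.bundle.ell2.comap p hp.measurable).gauss.IsBorel u ∧
      (∀ᵐ y ∂μ.bind ρ, ‖u y‖ = 1) ∧
      ∀ᵐ q ∂arrowMeasure (𝒴.haar lam) (μ.bind ρ),
        Gauss.map (π.affine V (hp.arrowMap q) rfl (hp.s_arrowMap q)) (u (𝒴.semidirect.s q)) =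
          u q.1.1 := by
  have hUY : ∀ᵐ y ∂μ.bind ρ, p y ∈ U := hp.ae_bind_of_ae (P := fun x => x ∈ U) hU0
  have hUr : ∀ᵐ q ∂arrowMeasure (𝒴.haar lam) (μ.bind ρ), p q.1.1 ∈ U :=
    ae_arrow_r (𝒴.haar lam) hUY
  have hUs := hq.ae_arrow_s hUY
  -- The test sections are the Gaussian vectors at the origin. An arrow moves the origin to another
  -- fixed point, and the two vectors merge as `n → ∞`.
  have hvec : ∀ n : ℕ, (hp.gaussComap h hU hU0 hV).bundle.IsBorel
      fun y => Gauss.vec (0 : π.Ell2Fibre (p y)) n :=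
    fun n => (HilbertBundle.isBorel_zero (H := π.bundle.ell2.comap p hp.measurable)).gauss_vec n
  have hlim : ∀ᵐ q ∂arrowMeasure (𝒴.haar lam) (μ.bind ρ), Tendsto (fun n =>
      ‖(hp.gaussComap h hU hU0 hV).coboundary (hvec n).toSection q‖) atTop (𝓝 0) := by
    filter_upwards [hUr, hUs] with q hr hs
    have hi := h.isometry_affine (hp.arrowMap q) rfl (hp.s_arrowMap q) hr hs
    refine (Representation.tendsto_norm_vec_sub (0 : π.Ell2Fibre (p q.1.1))
      (π.affine V (hp.arrowMap q) rfl (hp.s_arrowMap q) 0)).congr fun n => ?_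
    have e : (hp.gaussComap h hU hU0 hV).L q rfl rfl
        (Gauss.vec (0 : π.Ell2Fibre (p (𝒴.semidirect.s q))) n) =
        Gauss.vec (π.affine V (hp.arrowMap q) rfl (hp.s_arrowMap q) 0) n :=
      (hp.gaussComap_L h hU hU0 hV q hr hs _).trans (Gauss.map_vec hi _ _)
    exact congrArg (fun z : Gauss (π.Ell2Fibre (p q.1.1)) =>
      ‖Gauss.vec (0 : π.Ell2Fibre (p q.1.1)) n - z‖) e.symm
  obtain ⟨u, hu1, hu2⟩ := hT (hp.gaussComap h hU hU0 hV) ⟨fun n => (hvec n).toSection,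
    fun n => Eventually.of_forall fun y => Gauss.norm_vec _ _, hlim⟩
  refine ⟨u.toFun, u.isBorel, hu1, ?_⟩
  filter_upwards [hu2, hUr, hUs] with q h1 hr hs
  exact (hp.gaussComap_L h hU hU0 hV q hr hs _).symm.trans (sub_eq_zero.1 h1).symm

end Gaussian

open Classical in
/-- The normalised translates of the Chebyshev centres of the superlevel sets of an invariant
field `u`. -/
def centredField (V : ℕ → ∀ x, π.bundle.Fibre x) (u : ∀ y, Gauss (π.Ell2Fibre (p y))) (i : ℕ)
    (δ : ℝ) (k : ℕ) (y : Y) : π.bundle.Fibre (p y) :=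
  if (Gauss.superlevel (u y) i δ).Nonempty then
    ((‖HilbertBundle.centerSection (H := π.bundle.ell2.comap p hp.measurable) u i δ y k +
        V k (p y)‖⁻¹ : ℝ) : ℂ) •
      (HilbertBundle.centerSection (H := π.bundle.ell2.comap p hp.measurable) u i δ y k +
        V k (p y))
  else 0

theorem centredField_of_nonempty {u : ∀ y, Gauss (π.Ell2Fibre (p y))} {i : ℕ} {δ : ℝ} (k : ℕ)
    {y : Y} (hne : (Gauss.superlevel (u y) i δ).Nonempty) :
    hp.centredField V u i δ k y =
      ((‖chebyshevCenter (Gauss.superlevel (u y) i δ) k + V k (p y)‖⁻¹ : ℝ) : ℂ) •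
        (chebyshevCenter (Gauss.superlevel (u y) i δ) k + V k (p y)) := by
  have e : HilbertBundle.centerSection (H := π.bundle.ell2.comap p hp.measurable) u i δ y =
      chebyshevCenter (Gauss.superlevel (u y) i δ) := if_pos hne
  refine (if_pos hne).trans ?_
  exact congrArg (fun w : π.Ell2Fibre (p y) =>
    ((‖w k + V k (p y)‖⁻¹ : ℝ) : ℂ) • (w k + V k (p y))) e

theorem isBorel_centredField {u : ∀ y, Gauss (π.Ell2Fibre (p y))}
    (hu : (π.bundle.ell2.comap p hp.measurable).gauss.IsBorel u) (hV : ∀ k, π.bundle.IsBorel (V k))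
    (i : ℕ) {δ : ℝ} (hδ : 0 < δ) (k : ℕ) :
    (π.bundle.comap p hp.measurable).IsBorel (hp.centredField V u i δ k) := by
  classical
  have h1 := (HilbertBundle.isBorel_ell2_iff (H := π.bundle.comap p hp.measurable)).1
    (hu.centerSection i hδ) k
  exact (h1.add ((hV k).comap hp.measurable)).normalize.ite HilbertBundle.isBorel_zero
    (hu.measurableSet_superlevel_nonempty i δ)

theorem norm_centredField_le (u : ∀ y, Gauss (π.Ell2Fibre (p y))) (i : ℕ) (δ : ℝ) (k : ℕ) (y : Y) :
    ‖hp.centredField V u i δ k y‖ ≤ 1 := by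
  rw [centredField]
  split_ifs
  · exact norm_normalize_le _
  · rw [norm_zero]
    exact zero_le_one

/-- Superlevel sets of an invariant `u` correspond under the affine map, and so do their centres
`c`. The equation `c(r) = L(γ)(c(s) + V) - V` says that `L(γ)` carries `cₖ + Vₖ` to `cₖ + Vₖ`, and
an isometry commutes with normalisation. -/
theorem isInvariantAt_centredField (h : π.IsAffineOn V U) {u : ∀ y, Gauss (π.Ell2Fibre (p y))}
    (i : ℕ) {δ : ℝ} (hδ : 0 < δ) (k : ℕ) {q : 𝒴.Arrow} (hr : p q.1.1 ∈ U)
    (hs : p (𝒴.semidirect.s q) ∈ U)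
    (hu : Gauss.map (π.affine V (hp.arrowMap q) rfl (hp.s_arrowMap q)) (u (𝒴.semidirect.s q)) =
      u q.1.1) : hp.IsInvariantAt π (hp.centredField V u i δ k) q := by
  have hiff := h.superlevel_nonempty_iff (hp.arrowMap q) rfl (hp.s_arrowMap q) hr hs
    (u (𝒴.semidirect.s q)) i δ
  rw [IsInvariantAt]
  by_cases hne : (Gauss.superlevel (u (𝒴.semidirect.s q)) i δ).Nonempty
  · have hc := h.chebyshevCenter_superlevel (hp.arrowMap q) rfl (hp.s_arrowMap q) hr hs
      (u (𝒴.semidirect.s q)) i hδ hne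
    have hne' := hiff.2 hne
    rw [hu] at hne'
    have hc' : chebyshevCenter (Gauss.superlevel (u q.1.1) i δ) =
        π.affine V (hp.arrowMap q) rfl (hp.s_arrowMap q)
          (chebyshevCenter (Gauss.superlevel (u (𝒴.semidirect.s q)) i δ)) :=
      (congrArg (fun z => chebyshevCenter (Gauss.superlevel z i δ)) hu).symm.trans hc
    refine (congrArg _ (hp.centredField_of_nonempty k hne)).trans
      (Eq.trans ?_ (hp.centredField_of_nonempty k hne').symm)
    have ha := h.affine_add (hp.arrowMap q) rfl (hp.s_arrowMap q) hr hs
      (chebyshevCenter (Gauss.superlevel (u (𝒴.semidirect.s q)) i δ)) k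
    have hn := h.norm_map (hp.arrowMap q) rfl (hp.s_arrowMap q) hr hs
      (chebyshevCenter (Gauss.superlevel (u (𝒴.semidirect.s q)) i δ) k +
        V k (p (𝒴.semidirect.s q)))
    refine (map_smul _ _ _).trans ?_
    rw [← hn, ha]
    exact congrArg (fun w : π.Ell2Fibre (p q.1.1) =>
      ((‖w k + V k (p q.1.1)‖⁻¹ : ℝ) : ℂ) • (w k + V k (p q.1.1))) hc'.symm
  · have hne' := mt hiff.1 hne
    rw [hu] at hne'
    exact (congrArg _ (if_neg hne)).trans ((map_zero _).trans (if_neg hne').symm)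

/-- The centre is a square summable sequence, so its components tend to `0`, and
`norm_normalize_sub_le` applies for `k > 0`. -/
theorem tendsto_centredField {ξ : ℕ → ∀ x, π.bundle.Fibre x} {u : ∀ y, Gauss (π.Ell2Fibre (p y))}
    (i : ℕ) (δ : ℝ) {y : Y} (hξ : ∀ k, ‖ξ k (p y)‖ = 1)
    (hne : (Gauss.superlevel (u y) i δ).Nonempty) :
    Tendsto (fun k => ‖hp.centredField (fun k x => (k : ℂ) • ξ k x) u i δ k y - ξ k (p y)‖) atTop
      (𝓝 0) := by
  have h1 := (tendsto_norm_lp_two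
    (HilbertBundle.centerSection (H := π.bundle.ell2.comap p hp.measurable) u i δ y)).const_mul 2
  rw [mul_zero] at h1
  refine squeeze_zero' (Eventually.of_forall fun _ => norm_nonneg _) ?_ h1
  filter_upwards [eventually_gt_atTop 0] with k hk
  rw [centredField, if_pos hne]
  exact norm_normalize_sub_le (hξ k) hk

/-- For discrete groupoids property T descends along measure preserving maps. -/
theorem hasPropertyT_of_extension [StandardBorelSpace G₀] [StandardBorelSpace X]
    [StandardBorelSpace Y] [StandardBorelSpace G] [SFinite μ] [IsMarkovKernel ρ]
    {lam : HaarSystem 𝒢}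
    (hd : 𝒢.IsRDiscrete) (hqY : QuasiInvariant (𝒴.haar lam) (μ.bind ρ))
    (hqX : QuasiInvariant (𝒳.haar lam) μ) (herg : IsErgodic 𝒳.semidirect μ)
    (hT : HasPropertyT (𝒴.haar lam) (μ.bind ρ)) : HasPropertyT (𝒳.haar lam) μ := by
  intro π hπ
  have : StandardBorelSpace 𝒳.Arrow := 𝒳.measurableSet_arrow.standardBorel
  have hdX : 𝒳.semidirect.IsRDiscrete := fun x => by
    refine ((hd (𝒳.anchor x)).image (Prod.mk x)).preimage
      (f := (Subtype.val : 𝒳.Arrow → X × G)) Subtype.val_injective |>.mono ?_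
    rintro ⟨⟨x', γ⟩, hq⟩ (rfl : x' = x)
    exact ⟨γ, hq.symm, rfl⟩
  obtain ⟨ξ, U, hU, hU0, hξ, hA⟩ := π.exists_isAffineOn hdX hqX hπ
  have hV : ∀ k : ℕ, π.bundle.IsBorel fun x => (k : ℂ) • (ξ k).toFun x :=
    fun k => (ξ k).isBorel.smul measurable_const
  obtain ⟨u, hu, hu1, huinv⟩ := hp.exists_invariant_gauss hqY hA hU hU0 hV hT
  by_contra hcon
  -- Without an invariant unit section, every invariant section over `X` is almost everywhere zero;
  -- this will be applied to fibre integrals.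
  have hzero : ∀ η : ∀ x, π.bundle.Fibre x, π.bundle.IsBorel η →
      (∀ᵐ q ∂(arrowMeasure (𝒳.haar lam) μ), π.L q rfl rfl (η (𝒳.semidirect.s q)) =
        η (𝒳.semidirect.r q)) → ∀ᵐ x ∂μ, η x = 0 := fun η hη hinv => by
    by_contra hne
    exact hcon (Representation.hasUnitInvariantSection_of_invariant hqX herg hη hinv
      fun h => absurd h hne)
  have hUae : ∀ᵐ x ∂μ, x ∈ U := hU0
  have hUY : ∀ᵐ y ∂μ.bind ρ, p y ∈ U := hp.ae_bind_of_ae (P := fun x => x ∈ U) hU0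
  -- The centred fields are invariant and asymptotic to `ξₖ` where the superlevel set is nonempty.
  -- Their fibre integrals vanish, so that set of points is null.
  have hnull : ∀ (i : ℕ) (δ : ℝ), 0 < δ →
      ∀ᵐ y ∂μ.bind ρ, ¬ (Gauss.superlevel (u y) i δ).Nonempty := fun i δ hδ => by
    have hY₁ := hu.measurableSet_superlevel_nonempty i δ
    have hB := hp.isBorel_centredField hu hV i hδ
    have h1 := hp.norm_centredField_le (V := fun k x => (k : ℂ) • (ξ k).toFun x) u i δ
    have h2 : ∀ᵐ x ∂μ, ∀ k, HilbertBundle.fibreIntegral ρ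
        (hp.centredField (fun k x => (k : ℂ) • (ξ k).toFun x) u i δ k) x = 0 := by
      refine ae_all_iff.2 fun k => hzero _
        (HilbertBundle.isBorel_fibreIntegral (hB k) (h1 k) hp.ae_eq)
        (hp.ae_coboundary_fibreIntegral lam (hB k) (h1 k) ?_)
      have hUr : ∀ᵐ q ∂arrowMeasure (𝒴.haar lam) (μ.bind ρ), p q.1.1 ∈ U :=
        ae_arrow_r (𝒴.haar lam) hUY
      filter_upwards [huinv, hUr, hqY.ae_arrow_s hUY] with q h3 hr hs
      exact hp.isInvariantAt_centredField hA i hδ k hr hs h3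
    refine (Measure.ae_comp_iff hY₁.compl).2 ?_
    filter_upwards [h2, hUae] with x hx hxU
    have h3 := HilbertBundle.measure_eq_zero_of_fibreIntegral hB h1 (hp.ae_eq x)
      (fun k => hξ k x hxU) hY₁ (fun k y hy => if_neg hy)
      (fun y hy hyx => hp.tendsto_centredField i δ (fun k => by rw [hyx]; exact hξ k x hxU) hy) hx
    rw [ae_iff]
    simpa using h3
  have hall : ∀ᵐ y ∂μ.bind ρ, ∀ i m : ℕ,
      ¬ (Gauss.superlevel (u y) i (1 / ((m : ℝ) + 1))).Nonempty :=
    ae_all_iff.2 fun i => ae_all_iff.2 fun m => hnull i _ (by positivity)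
  have hfalse : ∀ᵐ _y ∂μ.bind ρ, False := by
    filter_upwards [hall, hu1] with y hy hy1
    -- A nonzero vector pairs nontrivially with some `vec w i`, hence has a nonempty superlevel set
    -- at some level `1/(m+1)`.
    have h0 : u y = 0 := Gauss.eq_zero_of_inner_vec fun w i => by
      by_contra hne
      obtain ⟨m, hm⟩ := exists_nat_one_div_lt (norm_pos_iff.2 hne)
      exact hy i m ⟨w, hm⟩
    rw [h0, norm_zero] at hy1
    exact zero_ne_one hy1
  -- Only `μ = 0` remains, and there the zero section is vacuously an invariant unit section.
  have hμ : ∀ᵐ _x ∂μ, False :=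
    (hp.ae_bind_iff (A := (∅ : Set X)) MeasurableSet.empty).1 hfalse
  have hμ0 : μ = 0 := ae_eq_bot.1 (eventually_false_iff_eq_bot.1 hμ)
  exact hcon (Representation.hasUnitInvariantSection_of_invariant hqX herg
    HilbertBundle.isBorel_zero (Eventually.of_forall fun q => map_zero _) fun _ => hμ0)

end FibreSystem

/-! ### Direct integrals of Hilbert bundles along a family of measures -/

namespace HilbertBundle

variable {Y : Type u} [MeasurableSpace Y] (H : HilbertBundle Y)

/-- The bounded Borel sections. -/
def boundedSections : Submodule ℂ (∀ y, H.Fibre y) where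
  carrier := {ζ | H.IsBorel ζ ∧ ∃ C : ℝ, ∀ y, ‖ζ y‖ ≤ C}
  zero_mem' := ⟨isBorel_zero, 0, fun y => by simp⟩
  add_mem' := by
    rintro ζ ζ' ⟨h1, C, hC⟩ ⟨h2, C', hC'⟩
    exact ⟨h1.add h2, C + C', fun y => (norm_add_le _ _).trans (add_le_add (hC y) (hC' y))⟩
  smul_mem' := by
    rintro c ζ ⟨h1, C, hC⟩
    refine ⟨h1.smul measurable_const, ‖c‖ * C, fun y => ?_⟩
    rw [Pi.smul_apply, norm_smul]
    exact mul_le_mul_of_nonneg_left (hC y) (norm_nonneg c)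

variable {H}

theorem measurable_inner_boundedSections (ζ ζ' : H.boundedSections) :
    Measurable fun y => Inner.inner ℂ (ζ.1 y) (ζ'.1 y) := ζ.2.1.measurable_inner ζ'.2.1

theorem integrable_inner (m : Measure Y) [IsFiniteMeasure m] (ζ ζ' : H.boundedSections) :
    Integrable (fun y => Inner.inner ℂ (ζ.1 y) (ζ'.1 y)) m := by
  obtain ⟨C, hC⟩ := ζ.2.2
  obtain ⟨C', hC'⟩ := ζ'.2.2
  refine Integrable.of_bound (measurable_inner_boundedSections ζ ζ').aestronglyMeasurable (C * C')
    (Eventually.of_forall fun y => (norm_inner_le_norm _ _).trans ?_)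
  exact mul_le_mul (hC y) (hC' y) (norm_nonneg _) ((norm_nonneg _).trans (hC y))

variable (H) in
/-- The semi-inner product of square integrable sections. -/
@[reducible] def l2Core (m : Measure Y) [IsFiniteMeasure m] :
    PreInnerProductSpace.Core ℂ H.boundedSections where
  inner ζ ζ' := ∫ y, Inner.inner ℂ (ζ.1 y) (ζ'.1 y) ∂m
  conj_inner_symm ζ ζ' := by
    rw [← integral_conj]
    exact integral_congr_ae (Eventually.of_forall fun y => inner_conj_symm _ _)
  re_inner_nonneg ζ := by
    rw [← integral_re (integrable_inner m ζ ζ)]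
    exact integral_nonneg fun y => inner_self_nonneg
  add_left ζ₁ ζ₂ ζ' := by
    rw [← integral_add (integrable_inner m ζ₁ ζ') (integrable_inner m ζ₂ ζ')]
    exact integral_congr_ae (Eventually.of_forall fun y => inner_add_left _ _ _)
  smul_left ζ ζ' c := by
    rw [← integral_const_mul]
    exact integral_congr_ae (Eventually.of_forall fun y => inner_smul_left _ _ _)

variable (H) in
/-- The Hilbert space of square integrable sections. -/
abbrev L2 (m : Measure Y) [IsFiniteMeasure m] : Type u := Hilb (H.l2Core m)

namespace L2

variable (m : Measure Y) [IsFiniteMeasure m]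

/-- The class of a bounded section. -/
abbrev mk : H.boundedSections →ₗ[ℂ] H.L2 m := Hilb.mk (H.l2Core m)

theorem inner_mk (ζ ζ' : H.boundedSections) :
    Inner.inner ℂ (mk m ζ) (mk m ζ') = ∫ y, Inner.inner ℂ (ζ.1 y) (ζ'.1 y) ∂m :=
  Hilb.inner_mk _ _ _

theorem norm_mk_sq (ζ : H.boundedSections) : ‖mk m ζ‖ ^ 2 = ∫ y, ‖ζ.1 y‖ ^ 2 ∂m := by
  refine (Hilb.norm_sq_mk (H.l2Core m) ζ).trans ?_
  refine (integral_re (integrable_inner m ζ ζ)).symm.trans ?_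
  exact integral_congr_ae (Eventually.of_forall fun y => inner_self_eq_norm_sq (𝕜 := ℂ) _)

theorem integrable_norm_sq (ζ : H.boundedSections) : Integrable (fun y => ‖ζ.1 y‖ ^ 2) m := by
  obtain ⟨C, hC⟩ := ζ.2.2
  refine Integrable.of_bound (ζ.2.1.measurable_norm.pow_const 2).aestronglyMeasurable (C ^ 2)
    (Eventually.of_forall fun y => ?_)
  rw [norm_pow, norm_norm]
  exact pow_le_pow_left₀ (norm_nonneg _) (hC y) 2

theorem lintegral_enorm_sq (ζ : H.boundedSections) :
    ∫⁻ y, ‖ζ.1 y‖ₑ ^ 2 ∂m = ENNReal.ofReal (‖mk m ζ‖ ^ 2) := by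
  rw [norm_mk_sq, ofReal_integral_eq_lintegral_ofReal (integrable_norm_sq m ζ)
    (Eventually.of_forall fun y => sq_nonneg _)]
  refine lintegral_congr fun y => ?_
  rw [ENNReal.ofReal_pow (norm_nonneg _), ofReal_norm]

variable {m}

theorem norm_mk_congr {m' : Measure Y} [IsFiniteMeasure m'] {ζ ζ' : H.boundedSections}
    (h : ∫ y, ‖ζ.1 y‖ ^ 2 ∂m = ∫ y, ‖ζ'.1 y‖ ^ 2 ∂m') : ‖mk m ζ‖ = ‖mk m' ζ'‖ := by
  rw [← sq_eq_sq₀ (norm_nonneg _) (norm_nonneg _), norm_mk_sq, norm_mk_sq, h]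

theorem mk_congr {ζ ζ' : H.boundedSections} (h : ∀ᵐ y ∂m, ζ.1 y = ζ'.1 y) : mk m ζ = mk m ζ' := by
  rw [← sub_eq_zero, ← map_sub, ← norm_eq_zero, ← sq_eq_zero_iff, norm_mk_sq]
  refine integral_eq_zero_of_ae ?_
  filter_upwards [h] with y hy
  have : (ζ - ζ').1 y = 0 := sub_eq_zero.2 hy
  simp [this]

/-- Dominated convergence for the squared norms, the total mass being finite. -/
theorem tendsto_norm_mk {ζ : ℕ → H.boundedSections} {C : ℝ} (hC : ∀ k y, ‖(ζ k).1 y‖ ≤ C)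
    (h : ∀ᵐ y ∂m, Tendsto (fun k => ‖(ζ k).1 y‖) atTop (𝓝 0)) :
    Tendsto (fun k => ‖mk m (ζ k)‖) atTop (𝓝 0) := by
  have h1 : Tendsto (fun k => ∫ y, ‖(ζ k).1 y‖ ^ 2 ∂m) atTop (𝓝 (∫ _, (0 : ℝ) ∂m)) := by
    refine tendsto_integral_of_dominated_convergence (fun _ => C ^ 2)
      (fun k => ((ζ k).2.1.measurable_norm.pow_const 2).aestronglyMeasurable) (integrable_const _)
      (fun k => Eventually.of_forall fun y => ?_) ?_
    · rw [norm_pow, norm_norm]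
      exact pow_le_pow_left₀ (norm_nonneg _) (hC k y) 2
    · filter_upwards [h] with y hy
      simpa using hy.pow 2
  rw [integral_zero] at h1
  have h2 := (Real.continuous_sqrt.tendsto 0).comp h1
  rw [Real.sqrt_zero] at h2
  refine h2.congr fun k => ?_
  rw [Function.comp_apply, ← norm_mk_sq, Real.sqrt_sq (norm_nonneg _)]

theorem tendsto_mk {ζ : ℕ → H.boundedSections} {ζ' : H.boundedSections} {C : ℝ}
    (hC : ∀ k y, ‖(ζ k).1 y‖ ≤ C) (h : ∀ y, Tendsto (fun k => (ζ k).1 y) atTop (𝓝 (ζ'.1 y))) :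
    Tendsto (fun k => mk m (ζ k)) atTop (𝓝 (mk m ζ')) := by
  rw [tendsto_iff_norm_sub_tendsto_zero]
  simp only [← map_sub]
  obtain ⟨C', hC'⟩ := ζ'.2.2
  refine tendsto_norm_mk (C := C + C') (fun k y => ?_) (Eventually.of_forall fun y => ?_)
  · exact (norm_sub_le _ _).trans (add_le_add (hC k y) (hC' y))
  · exact tendsto_iff_norm_sub_tendsto_zero.1 (h y)

end L2

open Classical in
/-- The restriction of a bounded section to a Borel set. -/
def indicatorSection (ζ : H.boundedSections) (A : Set Y) (hA : MeasurableSet A) :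
    H.boundedSections :=
  ⟨fun y => if y ∈ A then ζ.1 y else 0, ζ.2.1.ite isBorel_zero hA, by
    obtain ⟨C, hC⟩ := ζ.2.2
    refine ⟨C, fun y => ?_⟩
    beta_reduce
    split_ifs
    · exact hC y
    · rw [norm_zero]
      exact (norm_nonneg _).trans (hC y)⟩

theorem indicatorSection_of_mem (ζ : H.boundedSections) {A : Set Y} (hA : MeasurableSet A) {y : Y}
    (hy : y ∈ A) : (indicatorSection ζ A hA).1 y = ζ.1 y := if_pos hy

theorem indicatorSection_of_notMem (ζ : H.boundedSections) {A : Set Y} (hA : MeasurableSet A)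
    {y : Y} (hy : y ∉ A) : (indicatorSection ζ A hA).1 y = 0 := if_neg hy

theorem norm_indicatorSection_le {ζ : H.boundedSections} {A : Set Y} (hA : MeasurableSet A) {C : ℝ}
    (hC : ∀ y, ‖ζ.1 y‖ ≤ C) (y : Y) : ‖(indicatorSection ζ A hA).1 y‖ ≤ C := by
  by_cases hy : y ∈ A
  · rw [indicatorSection_of_mem ζ hA hy]
    exact hC y
  · rw [indicatorSection_of_notMem ζ hA hy, norm_zero]
    exact (norm_nonneg _).trans (hC y)

/-! ### A countable total family of square integrable sections -/

open Classical in
theorem norm_cut_le {E : Type u} [NormedAddCommGroup E] (v : E) (c : ℕ) :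
    ‖if ‖v‖ ≤ c then v else 0‖ ≤ c := by
  split_ifs with h
  · exact h
  · rw [norm_zero]
    exact Nat.cast_nonneg c

variable (H) in
open Classical in
/-- The dense sequence of sections, cut off where their norm is larger than `c`. -/
def cutSection (n c : ℕ) : H.boundedSections :=
  ⟨fun y => if ‖H.denseSection n y‖ ≤ c then H.denseSection n y else 0,
    (isBorel_denseSection n).ite isBorel_zero
      (measurableSet_le (isBorel_denseSection n).measurable_norm measurable_const), c,
    fun _ => norm_cut_le _ _⟩

theorem norm_cutSection_le (n c : ℕ) (y : Y) : ‖(H.cutSection n c).1 y‖ ≤ c := norm_cut_le _ _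

theorem cutSection_eq {n c : ℕ} {y : Y} (h : ‖H.denseSection n y‖ ≤ c) :
    (H.cutSection n c).1 y = H.denseSection n y := if_pos h

/-- The algebra generated by a countable generating family is still countable, and it is closed
under intersections and contains the whole space. -/
theorem exists_piSystem_seq (Y : Type u) [MeasurableSpace Y] [MeasurableSpace.CountablyGenerated Y] :
    ∃ A : ℕ → Set Y, (∀ j, MeasurableSet (A j)) ∧ IsPiSystem (Set.range A) ∧
      (∃ j, A j = Set.univ) ∧
      (inferInstance : MeasurableSpace Y) = MeasurableSpace.generateFrom (Set.range A) := by
  have hg := generateFrom_generateSetAlgebra_eq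
    (𝒜 := MeasurableSpace.countableGeneratingSet Y)
  rw [MeasurableSpace.generateFrom_countableGeneratingSet] at hg
  have hA := isSetAlgebra_generateSetAlgebra (𝒜 := MeasurableSpace.countableGeneratingSet Y)
  obtain ⟨A, hA'⟩ := (countable_generateSetAlgebra
    (MeasurableSpace.countable_countableGeneratingSet (α := Y))).exists_eq_range ⟨_, hA.univ_mem⟩
  rw [hA'] at hg hA
  refine ⟨A, fun j => ?_, fun s hs t ht _ => hA.inter_mem hs ht, hA.univ_mem, hg.symm⟩
  rw [← hg]
  exact MeasurableSpace.measurableSet_generateFrom ⟨j, rfl⟩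

section L2Bundle

variable [MeasurableSpace.CountablyGenerated Y]

variable (Y) in
/-- A sequence of sets, stable under intersections, which generates the Borel structure. -/
def piSeq : ℕ → Set Y := (exists_piSystem_seq Y).choose

theorem measurableSet_piSeq (j : ℕ) : MeasurableSet (piSeq Y j) :=
  (exists_piSystem_seq Y).choose_spec.1 j

variable (H) in
/-- The fundamental sequence of the bundle of spaces of square integrable sections. -/
def l2Fund (n : ℕ) : H.boundedSections :=
  indicatorSection (H.cutSection n.unpair.2.unpair.1 n.unpair.2.unpair.2) (piSeq Y n.unpair.1)
    (measurableSet_piSeq _)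

/-- A monotone class argument in `A`: the sets for which orthogonality holds contain a generating
π-system and are closed under complements and countable disjoint unions. -/
theorem mem_of_l2Fund (m : Measure Y) [IsFiniteMeasure m] {v : H.L2 m}
    (hv : ∀ n, Inner.inner ℂ (L2.mk m (H.l2Fund n)) v = 0) (n c : ℕ) {A : Set Y}
    (hA : MeasurableSet A) :
    Inner.inner ℂ (L2.mk m (indicatorSection (H.cutSection n c) A hA)) v = 0 := by
  classical
  obtain ⟨hmeas, hpi, ⟨j₀, hj₀⟩, hgen⟩ := (exists_piSystem_seq Y).choose_spec
  have hbase : ∀ j (h : MeasurableSet (piSeq Y j)),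
      Inner.inner ℂ (L2.mk m (indicatorSection (H.cutSection n c) (piSeq Y j) h)) v = 0 :=
    fun j h => by
      have := hv (Nat.pair j (Nat.pair n c))
      simpa only [l2Fund, Nat.unpair_pair] using this
  have huniv : Inner.inner ℂ (L2.mk m (H.cutSection n c)) v = 0 := by
    have h1 := hbase j₀ (hmeas j₀)
    rwa [show indicatorSection (H.cutSection n c) (piSeq Y j₀) (hmeas j₀) = H.cutSection n c from
      Subtype.ext (funext fun y => if_pos (by rw [show piSeq Y j₀ = Set.univ from hj₀]; trivial))]
      at h1
  refine MeasurableSpace.induction_on_inter (C := fun A hA =>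
    Inner.inner ℂ (L2.mk m (indicatorSection (H.cutSection n c) A hA)) v = 0) hgen hpi ?_ ?_ ?_ ?_
    A hA
  · rw [show indicatorSection (H.cutSection n c) ∅ MeasurableSet.empty = 0 from
      Subtype.ext (funext fun y => if_neg (Set.notMem_empty y)), map_zero, inner_zero_left]
  · rintro _ ⟨j, rfl⟩
    exact hbase j _
  · intro t ht h0
    rw [show indicatorSection (H.cutSection n c) tᶜ ht.compl =
      H.cutSection n c - indicatorSection (H.cutSection n c) t ht from
      Subtype.ext (funext fun y => ?_), map_sub, inner_sub_left, huniv, h0, sub_zero]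
    rw [Submodule.coe_sub, Pi.sub_apply]
    by_cases hy : y ∈ t
    · rw [indicatorSection_of_mem _ ht hy, indicatorSection_of_notMem _ ht.compl fun h => h hy,
        sub_self]
    · rw [indicatorSection_of_notMem _ ht hy, indicatorSection_of_mem _ ht.compl hy, sub_zero]
  · intro f hd hf h0
    have hp : ∀ M, MeasurableSet (⋃ i ∈ Finset.range M, f i) :=
      fun M => Finset.measurableSet_biUnion _ fun i _ => hf i
    have hfin : ∀ M, Inner.inner ℂ (L2.mk m (indicatorSection (H.cutSection n c)
        (⋃ i ∈ Finset.range M, f i) (hp M))) v = 0 := fun M => by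
      rw [show indicatorSection (H.cutSection n c) (⋃ i ∈ Finset.range M, f i) (hp M) =
        ∑ i ∈ Finset.range M, indicatorSection (H.cutSection n c) (f i) (hf i) from
        Subtype.ext (funext fun y => ?_), map_sum, sum_inner]
      · exact Finset.sum_eq_zero fun i _ => h0 i
      · rw [Submodule.coe_sum, Finset.sum_apply]
        by_cases hy : ∃ i ∈ Finset.range M, y ∈ f i
        · obtain ⟨i, hi, hyi⟩ := hy
          rw [indicatorSection_of_mem _ (hp M) (Set.mem_iUnion₂.2 ⟨i, hi, hyi⟩),
            Finset.sum_eq_single_of_mem i hi, indicatorSection_of_mem _ _ hyi]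
          intro j _ hji
          exact indicatorSection_of_notMem _ _ fun hyj =>
            Set.disjoint_left.1 (hd hji) hyj hyi
        · rw [indicatorSection_of_notMem _ (hp M) fun h => hy (by simpa using h),
            Finset.sum_eq_zero]
          exact fun i hi => indicatorSection_of_notMem _ _ fun hyi => hy ⟨i, hi, hyi⟩
    have hlim : Tendsto (fun M => L2.mk m (indicatorSection (H.cutSection n c)
        (⋃ i ∈ Finset.range M, f i) (hp M))) atTop
        (𝓝 (L2.mk m (indicatorSection (H.cutSection n c) (⋃ i, f i) (MeasurableSet.iUnion hf)))) := by
      refine L2.tendsto_mk (C := c)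
        (fun M => norm_indicatorSection_le (hp M) (norm_cutSection_le n c)) fun y => ?_
      refine tendsto_const_nhds.congr' ?_
      by_cases hy : ∃ i, y ∈ f i
      · obtain ⟨i, hi⟩ := hy
        filter_upwards [eventually_gt_atTop i] with M hM
        rw [indicatorSection_of_mem _ _ (Set.mem_iUnion.2 ⟨i, hi⟩), indicatorSection_of_mem _ (hp M)
          (Set.mem_iUnion₂.2 ⟨i, Finset.mem_range.2 hM, hi⟩)]
      · refine Eventually.of_forall fun M => ?_
        beta_reduce
        rw [indicatorSection_of_notMem _ _ fun h => hy (Set.mem_iUnion.1 h),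
          indicatorSection_of_notMem _ (hp M) fun h => ?_]
        obtain ⟨i, _, hi⟩ := Set.mem_iUnion₂.1 h
        exact hy ⟨i, hi⟩
    refine tendsto_nhds_unique (hlim.inner (tendsto_const_nhds (x := v))) ?_
    simp only [hfin]
    exact tendsto_const_nhds

/-- A bounded section is a uniform limit of selections `y ↦ denseSection (N y) y`, and each
selection is a bounded pointwise limit of finite sums of cut-off sections restricted to the sets `{N
= n}`. -/
theorem eq_zero_of_inner_l2Fund (m : Measure Y) [IsFiniteMeasure m] {v : H.L2 m}
    (hv : ∀ n, Inner.inner ℂ (L2.mk m (H.l2Fund n)) v = 0) : v = 0 := by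
  have key : ∀ ζ : H.boundedSections, Inner.inner ℂ (L2.mk m ζ) v = 0 := fun ζ => by
    obtain ⟨C, hC⟩ := ζ.2.2
    choose N hN hNlt using fun k : ℕ => ζ.2.1.exists_approx (ε := 1 / ((k : ℝ) + 1)) (by positivity)
    -- The approximation error is at most `1`, so a cut-off above `C + 1` never alters the selected
    -- vectors.
    obtain ⟨c, hc⟩ := exists_nat_ge (C + 1)
    have hb : ∀ k y, ‖H.denseSection (N k y) y‖ ≤ c := fun k y => by
      have h1 : ‖H.denseSection (N k y) y‖ ≤ ‖ζ.1 y‖ + ‖ζ.1 y - H.denseSection (N k y) y‖ :=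
        norm_le_norm_add_norm_sub _ _
      have h2 : 1 / ((k : ℝ) + 1) ≤ 1 := by
        rw [div_le_one (by positivity)]
        linarith [Nat.cast_nonneg (α := ℝ) k]
      have := hNlt k y
      have := hC y
      linarith
    have hset : ∀ k n, MeasurableSet {y | N k y = n} := fun k n => hN k (measurableSet_singleton n)
    let a : ℕ → H.boundedSections := fun k =>
      ⟨fun y => H.denseSection (N k y) y, isBorel_select isBorel_denseSection (hN k), c, hb k⟩
    have hsum : ∀ k M y, (∑ n ∈ Finset.range M,
        indicatorSection (H.cutSection n c) {y | N k y = n} (hset k n)).1 y =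
        if N k y < M then (a k).1 y else 0 := fun k M y => by
      rw [Submodule.coe_sum, Finset.sum_apply]
      split_ifs with h
      · rw [Finset.sum_eq_single_of_mem (N k y) (Finset.mem_range.2 h),
          indicatorSection_of_mem _ _ (show y ∈ {y' | N k y' = N k y} from rfl),
          cutSection_eq (hb k y)]
        exact fun n _ hn => indicatorSection_of_notMem _ _ fun h' => hn (Eq.symm h')
      · refine Finset.sum_eq_zero fun n hn => indicatorSection_of_notMem _ _ fun h' => h ?_
        have h'' : N k y = n := h'
        rw [h'']
        exact Finset.mem_range.1 hn
    have h1 : ∀ k, Inner.inner ℂ (L2.mk m (a k)) v = 0 := fun k => by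
      have hlim : Tendsto (fun M => L2.mk m (∑ n ∈ Finset.range M,
          indicatorSection (H.cutSection n c) {y | N k y = n} (hset k n))) atTop
          (𝓝 (L2.mk m (a k))) := by
        refine L2.tendsto_mk (C := c) (fun M y => ?_) fun y => ?_
        · rw [hsum]
          split_ifs
          · exact hb k y
          · rw [norm_zero]
            exact Nat.cast_nonneg c
        · refine tendsto_const_nhds.congr' ?_
          filter_upwards [eventually_gt_atTop (N k y)] with M hM
          rw [hsum, if_pos hM]
      refine tendsto_nhds_unique (hlim.inner (tendsto_const_nhds (x := v))) ?_
      have hz : ∀ M, Inner.inner ℂ (L2.mk m (∑ n ∈ Finset.range M,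
          indicatorSection (H.cutSection n c) {y | N k y = n} (hset k n))) v = 0 := fun M => by
        rw [map_sum, sum_inner]
        exact Finset.sum_eq_zero fun n _ => mem_of_l2Fund m hv n c (hset k n)
      simp only [hz]
      exact tendsto_const_nhds
    have hlim : Tendsto (fun k => L2.mk m (a k)) atTop (𝓝 (L2.mk m ζ)) := by
      refine L2.tendsto_mk (C := c) hb fun y => ?_
      rw [tendsto_iff_norm_sub_tendsto_zero]
      refine squeeze_zero (fun _ => norm_nonneg _) (fun k => ?_)
        (tendsto_one_div_add_atTop_nhds_zero_nat (𝕜 := ℝ))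
      rw [norm_sub_rev]
      exact (hNlt k y).le
    refine tendsto_nhds_unique (hlim.inner (tendsto_const_nhds (x := v))) ?_
    simp only [h1]
    exact tendsto_const_nhds
  have h2 : ∀ w : H.L2 m, Inner.inner ℂ w v = 0 := fun w =>
    (Hilb.denseRange_mk (H.l2Core m)).induction_on w
      (isClosed_eq (continuous_id.inner continuous_const) continuous_const) key
  exact inner_self_eq_zero.1 (h2 v)

variable {X : Type u} [MeasurableSpace X] (ρ : Kernel X Y) [IsMarkovKernel ρ]

variable (H) in
/-- The bundle of the Hilbert spaces of sections which are square integrable on the fibres. -/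
abbrev l2 : HilbertBundle X where
  Fibre x := H.L2 (ρ x)
  fund n x := L2.mk (ρ x) (H.l2Fund n)
  measurable_inner m n := by
    refine Measurable.of_eq ((measurable_inner_boundedSections (H.l2Fund m)
      (H.l2Fund n)).stronglyMeasurable.integral_kernel (κ := ρ)).measurable fun x => ?_
    exact (L2.inner_mk (ρ x) _ _).symm
  separating x _ hv := eq_zero_of_inner_l2Fund (ρ x) hv

theorem isBorel_l2_mk (ζ : H.boundedSections) : (H.l2 ρ).IsBorel fun x => L2.mk (ρ x) ζ := fun n => by
  refine Measurable.of_eq ((measurable_inner_boundedSections (H.l2Fund n)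
    ζ).stronglyMeasurable.integral_kernel (κ := ρ)).measurable fun x => ?_
  exact (L2.inner_mk (ρ x) _ _).symm

/-- The bounded section which represents the dense sequence of the bundle `H.l2 ρ`. -/
def l2Dense (H : HilbertBundle Y) (n : ℕ) : H.boundedSections :=
  (coeffSeq n).sum fun i a => a • H.l2Fund i

theorem mk_l2Dense (n : ℕ) (x : X) : L2.mk (ρ x) (H.l2Dense n) = (H.l2 ρ).denseSection n x := by
  simp only [l2Dense, denseSection, Finsupp.sum, map_sum, map_smul]

end L2Bundle

end HilbertBundle

/-! ### The representation induced on square integrable sections -/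

namespace GSpace

variable {G₀ G Y : Type u} [MeasurableSpace G₀] [MeasurableSpace G] [MeasurableSpace Y]
  {𝒢 : BorelGroupoid G₀ G} {𝒴 : GSpace 𝒢 Y} {ν : Measure Y}
  (π : Representation 𝒴.semidirect ν) (W : Set Y)

variable {W} in
/-- The operator of the arrow `(y, γ)`. -/
def fibreL {γ : G} {y z : Y} (h : 𝒴.anchor y = 𝒢.r γ) (hz : 𝒴.invAct γ y h = z) :
    π.bundle.Fibre z →L[ℂ] π.bundle.Fibre y :=
  π.L ⟨(y, γ), h⟩ (show 𝒴.semidirect.r _ = y from rfl) (show 𝒴.semidirect.s _ = z from hz)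

open Classical in
/-- The translate `y ↦ L(y, γ) ζ(γ⁻¹ y)` of a section, where it makes sense. -/
def translate (γ : G) (ζ : ∀ y, π.bundle.Fibre y) (y : Y) : π.bundle.Fibre y :=
  if h : 𝒴.anchor y = 𝒢.r γ then
    if y ∈ W ∧ 𝒴.invAct γ y h ∈ W then fibreL π h rfl (ζ (𝒴.invAct γ y h)) else 0
  else 0

variable {π W}

theorem norm_fibreL (hπ : π.IsIsometricOn W) {γ : G} {y z : Y} (h : 𝒴.anchor y = 𝒢.r γ)
    (hz : 𝒴.invAct γ y h = z) (hy : y ∈ W) (hzW : z ∈ W) (v : π.bundle.Fibre z) :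
    ‖fibreL π h hz v‖ = ‖v‖ := hπ.norm_map ⟨(y, γ), h⟩ _ _ hy hzW v

theorem translate_eq {γ : G} (ζ : ∀ y, π.bundle.Fibre y) {y z : Y} (h : 𝒴.anchor y = 𝒢.r γ)
    (hz : 𝒴.invAct γ y h = z) (hy : y ∈ W) (hzW : z ∈ W) :
    translate π W γ ζ y = fibreL π h hz (ζ z) := by
  subst hz
  rw [translate, dif_pos h, if_pos ⟨hy, hzW⟩]

theorem translate_eq_zero {γ : G} (ζ : ∀ y, π.bundle.Fibre y) {y : Y}
    (h : ∀ h : 𝒴.anchor y = 𝒢.r γ, ¬ (y ∈ W ∧ 𝒴.invAct γ y h ∈ W)) :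
    translate π W γ ζ y = 0 := by
  by_cases h1 : 𝒴.anchor y = 𝒢.r γ
  · rw [translate, dif_pos h1, if_neg (h h1)]
  · rw [translate, dif_neg h1]

/-- Either the translate at a point is given by the representation, or it is zero for all
sections. -/
theorem translate_cases (π : Representation 𝒴.semidirect ν) (W : Set Y) (γ : G) (y : Y) :
    (∃ h : 𝒴.anchor y = 𝒢.r γ, y ∈ W ∧ 𝒴.invAct γ y h ∈ W ∧
      ∀ ζ, translate π W γ ζ y = fibreL π h rfl (ζ (𝒴.invAct γ y h))) ∨
    ∀ ζ, translate π W γ ζ y = 0 := by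
  by_cases h : ∃ h : 𝒴.anchor y = 𝒢.r γ, y ∈ W ∧ 𝒴.invAct γ y h ∈ W
  · obtain ⟨h1, h2, h3⟩ := h
    exact Or.inl ⟨h1, h2, h3, fun ζ => translate_eq ζ h1 rfl h2 h3⟩
  · exact Or.inr fun ζ => translate_eq_zero ζ fun h1 h2 => h ⟨h1, h2⟩

theorem norm_translate_le (hπ : π.IsIsometricOn W) (γ : G) {ζ : ∀ y, π.bundle.Fibre y} {C : ℝ}
    (hC : ∀ y, ‖ζ y‖ ≤ C) (y : Y) : ‖translate π W γ ζ y‖ ≤ C := by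
  rcases translate_cases π W γ y with ⟨h1, h2, h3, h4⟩ | h
  · rw [h4, norm_fibreL hπ _ _ h2 h3]
    exact hC _
  · rw [h, norm_zero]
    exact (norm_nonneg _).trans (hC y)

theorem translate_mul (hπ : π.IsIsometricOn W) {γ₁ γ₂ : G} (hc : 𝒢.s γ₁ = 𝒢.r γ₂)
    (ζ : ∀ y, π.bundle.Fibre y) {y : Y} (h₁ : 𝒴.anchor y = 𝒢.r γ₁) (hy : y ∈ W)
    (hz : 𝒴.invAct γ₁ y h₁ ∈ W)
    (hz' : 𝒴.invAct γ₂ (𝒴.invAct γ₁ y h₁) ((𝒴.anchor_invAct γ₁ y h₁).trans hc) ∈ W) :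
    translate π W (𝒢.mul γ₁ γ₂ hc) ζ y = translate π W γ₁ (translate π W γ₂ ζ) y := by
  rw [translate_eq ζ (h₁.trans (𝒢.r_mul γ₁ γ₂ hc).symm) (𝒴.invAct_mul γ₁ γ₂ y h₁ hc) hy hz',
    translate_eq _ h₁ rfl hy hz, translate_eq ζ _ rfl hz hz']
  have hm := hπ.mul (⟨(y, γ₁), h₁⟩ : 𝒴.Arrow)
    ⟨(𝒴.invAct γ₁ y h₁, γ₂), (𝒴.anchor_invAct γ₁ y h₁).trans hc⟩ (x := y)
    (y := 𝒴.invAct γ₁ y h₁)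
    (z := 𝒴.invAct γ₂ (𝒴.invAct γ₁ y h₁) ((𝒴.anchor_invAct γ₁ y h₁).trans hc))
    rfl rfl rfl rfl hy hz hz'
  exact DFunLike.congr_fun hm
    (ζ (𝒴.invAct γ₂ (𝒴.invAct γ₁ y h₁) ((𝒴.anchor_invAct γ₁ y h₁).trans hc)))

theorem translate_unit (hπ : π.IsIsometricOn W) (ζ : ∀ y, π.bundle.Fibre y) {y : Y} (hy : y ∈ W) :
    translate π W (𝒢.unit (𝒴.anchor y)) ζ y = ζ y := by
  rw [translate_eq ζ (𝒢.r_unit _).symm (𝒴.semidirect.s_unit y) hy hy]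
  exact hπ.unit hy (ζ y)

variable [StandardBorelSpace G₀]

/-- Measurability is joint in the point and the arrow, so that fibre integrals of translates depend
measurably on the arrow. -/
theorem measurable_inner_translate (hW : MeasurableSet W) {θ ζ : ∀ y, π.bundle.Fibre y}
    (hθ : π.bundle.IsBorel θ) (hζ : π.bundle.IsBorel ζ) :
    Measurable fun q : Y × G => Inner.inner ℂ (θ q.1) (translate π W q.2 ζ q.1) := by
  classical
  refine measurable_of_restrict_of_restrict_compl 𝒴.measurableSet_arrow ?_ ?_
  · have hm : MeasurableSet {q : 𝒴.Arrow | 𝒴.semidirect.r q ∈ W ∧ 𝒴.semidirect.s q ∈ W} :=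
      (𝒴.semidirect.measurable_r hW).inter (𝒴.semidirect.measurable_s hW)
    have h1 := (π.isBorel_apply (hζ.comap 𝒴.semidirect.measurable_s)).ite
      HilbertBundle.isBorel_zero hm
    refine Measurable.of_eq ((hθ.comap 𝒴.semidirect.measurable_r).measurable_inner h1) fun q => ?_
    obtain ⟨⟨y, γ⟩, hq⟩ := q
    have e : translate π W γ ζ y =
        if y ∈ W ∧ 𝒴.invAct γ y hq ∈ W then fibreL π hq rfl (ζ (𝒴.invAct γ y hq)) else 0 :=
      dif_pos hq
    exact congrArg (Inner.inner ℂ (θ y)) e.symm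
  · refine Measurable.of_eq (measurable_const (a := (0 : ℂ))) fun q => ?_
    obtain ⟨⟨y, γ⟩, hq⟩ := q
    have e : translate π W γ ζ y = 0 := dif_neg hq
    exact (inner_zero_right (θ y)).symm.trans (congrArg (Inner.inner ℂ (θ y)) e.symm)

/-- Translation as a linear map of bounded sections. -/
def translateₗ (hW : MeasurableSet W) (hπ : π.IsIsometricOn W) (γ : G) :
    π.bundle.boundedSections →ₗ[ℂ] π.bundle.boundedSections where
  toFun ζ := ⟨translate π W γ ζ.1,
    fun n => (measurable_inner_translate hW (HilbertBundle.isBorel_fund n) ζ.2.1).comp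
      measurable_prodMk_right, by
    obtain ⟨C, hC⟩ := ζ.2.2
    exact ⟨C, norm_translate_le hπ γ hC⟩⟩
  map_add' ζ ζ' := Subtype.ext <| funext fun y => by
    change translate π W γ (ζ.1 + ζ'.1) y = translate π W γ ζ.1 y + translate π W γ ζ'.1 y
    rcases translate_cases π W γ y with ⟨h1, h2, h3, h4⟩ | h
    · rw [h4, h4, h4, Pi.add_apply, map_add]
    · rw [h, h, h, add_zero]
  map_smul' c ζ := Subtype.ext <| funext fun y => by
    change translate π W γ (c • ζ.1) y = c • translate π W γ ζ.1 y
    rcases translate_cases π W γ y with ⟨h1, h2, h3, h4⟩ | h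
    · rw [h4, h4, Pi.smul_apply, map_smul]
    · rw [h, h, smul_zero]

theorem translateₗ_apply (hW : MeasurableSet W) (hπ : π.IsIsometricOn W) (γ : G)
    (ζ : π.bundle.boundedSections) (y : Y) :
    (translateₗ hW hπ γ ζ).1 y = translate π W γ ζ.1 y := rfl

end GSpace

/-- The points in whose fibre almost every point belongs to `W`. -/
def fibrewiseConull {X Y : Type u} [MeasurableSpace X] [MeasurableSpace Y] (ρ : Kernel X Y)
    (W : Set Y) : Set X := {x | ρ x Wᶜ = 0}

theorem measurableSet_fibrewiseConull {X Y : Type u} [MeasurableSpace X] [MeasurableSpace Y]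
    (ρ : Kernel X Y) {W : Set Y} (hW : MeasurableSet W) :
    MeasurableSet (fibrewiseConull ρ W) :=
  ρ.measurable_coe hW.compl (measurableSet_singleton 0)

theorem measure_compl_fibrewiseConull {X Y : Type u} [MeasurableSpace X] [MeasurableSpace Y]
    {ρ : Kernel X Y} {μ : Measure X} {W : Set Y} (hW0 : (μ.bind ρ) Wᶜ = 0) :
    μ (fibrewiseConull ρ W)ᶜ = 0 :=
  Measure.ae_ae_of_ae_comp (show ∀ᵐ y ∂μ.bind ρ, y ∈ W from hW0)

namespace FibreSystem

open GSpace HilbertBundle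

variable {G₀ G X Y : Type u} [MeasurableSpace G₀] [MeasurableSpace G] [MeasurableSpace X]
  [MeasurableSpace Y] [StandardBorelSpace G₀] {𝒢 : BorelGroupoid G₀ G} {𝒴 : GSpace 𝒢 Y}
  {𝒳 : GSpace 𝒢 X} {p : Y → X} {ρ : Kernel X Y} (hp : FibreSystem 𝒴 𝒳 p ρ) {μ : Measure X}
  {W : Set Y}
include hp

theorem measurePreserving_arrow (q : 𝒳.Arrow) {x x' : X} (hx : 𝒳.semidirect.r q = x)
    (hx' : 𝒳.semidirect.s q = x') :
    MeasurePreserving (𝒴.invActTotal q.1.2) (ρ x) (ρ x') := by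
  subst hx hx'
  exact hp.measurePreserving q.1.2 q.1.1 q.2

/-- Almost every point above `x` lies in `W`, and so does its image, because `γ⁻¹` carries `ρ x` to
`ρ x'`. The unspecified operators off `W` are thus invisible to the square integrable sections. -/
theorem ae_mem_arrow (q : 𝒳.Arrow) {x x' : X} (hx : 𝒳.semidirect.r q = x)
    (hx' : 𝒳.semidirect.s q = x') (hxW : x ∈ fibrewiseConull ρ W)
    (hxW' : x' ∈ fibrewiseConull ρ W) :
    ∀ᵐ y ∂ρ x, ∃ h : 𝒴.anchor y = 𝒢.r q.1.2, y ∈ W ∧ 𝒴.invAct q.1.2 y h ∈ W := by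
  have h1 : ∀ᵐ y ∂ρ x, y ∈ W := hxW
  have h2 : ∀ᵐ y ∂ρ x', y ∈ W := hxW'
  filter_upwards [h1, (hp.measurePreserving_arrow q hx hx').quasiMeasurePreserving.ae h2,
    hp.ae_eq x] with y hy1 hy2 hy3
  have h : 𝒴.anchor y = 𝒢.r q.1.2 := by
    rw [← hp.anchor, hy3, ← hx]
    exact q.2
  rw [𝒴.invActTotal_eq h] at hy2
  exact ⟨h, hy1, hy2⟩

variable [IsMarkovKernel ρ] {π : Representation 𝒴.semidirect (μ.bind ρ)}

theorem norm_mk_translate (hW : MeasurableSet W) (hπ : π.IsIsometricOn W) (q : 𝒳.Arrow) {x x' : X}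
    (hx : 𝒳.semidirect.r q = x) (hx' : 𝒳.semidirect.s q = x') (hxW : x ∈ fibrewiseConull ρ W)
    (hxW' : x' ∈ fibrewiseConull ρ W) (ζ : π.bundle.boundedSections) :
    ‖L2.mk (ρ x) (translateₗ hW hπ q.1.2 ζ)‖ = ‖L2.mk (ρ x') ζ‖ := by
  have hmp := hp.measurePreserving_arrow q hx hx'
  refine L2.norm_mk_congr ?_
  rw [← hmp.map_eq, integral_map hmp.measurable.aemeasurable
    (ζ.2.1.measurable_norm.pow_const 2).aestronglyMeasurable]
  refine integral_congr_ae ?_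
  filter_upwards [hp.ae_mem_arrow q hx hx' hxW hxW'] with y hy
  obtain ⟨h, hy1, hy2⟩ := hy
  rw [translateₗ_apply, translate_eq ζ.1 h rfl hy1 hy2, norm_fibreL hπ _ _ hy1 hy2,
    𝒴.invActTotal_eq h]

omit hp in
variable (ρ 𝒳) in
open Classical in
/-- The operators of the induced representation. -/
def inducedL (hW : MeasurableSet W) (hπ : π.IsIsometricOn W) (q : 𝒳.Arrow) {x x' : X}
    (_ : 𝒳.semidirect.r q = x) (_ : 𝒳.semidirect.s q = x') :
    π.bundle.L2 (ρ x') →L[ℂ] π.bundle.L2 (ρ x) :=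
  if x ∈ fibrewiseConull ρ W ∧ x' ∈ fibrewiseConull ρ W then
    Hilb.lift (π.bundle.l2Core (ρ x')) (L2.mk (ρ x) ∘ₗ translateₗ hW hπ q.1.2) else 0

theorem inducedL_mk (hW : MeasurableSet W) (hπ : π.IsIsometricOn W) (q : 𝒳.Arrow) {x x' : X}
    (hx : 𝒳.semidirect.r q = x) (hx' : 𝒳.semidirect.s q = x') (hxW : x ∈ fibrewiseConull ρ W)
    (hxW' : x' ∈ fibrewiseConull ρ W) (ζ : π.bundle.boundedSections) :
    inducedL 𝒳 ρ hW hπ q hx hx' (L2.mk (ρ x') ζ) = L2.mk (ρ x) (translateₗ hW hπ q.1.2 ζ) := by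
  rw [inducedL, if_pos ⟨hxW, hxW'⟩]
  exact Hilb.lift_mk _ _ (hp.norm_mk_translate hW hπ q hx hx' hxW hxW') ζ

theorem norm_inducedL (hW : MeasurableSet W) (hπ : π.IsIsometricOn W) (q : 𝒳.Arrow) {x x' : X}
    (hx : 𝒳.semidirect.r q = x) (hx' : 𝒳.semidirect.s q = x') (hxW : x ∈ fibrewiseConull ρ W)
    (hxW' : x' ∈ fibrewiseConull ρ W) (v : π.bundle.L2 (ρ x')) :
    ‖inducedL 𝒳 ρ hW hπ q hx hx' v‖ = ‖v‖ := by
  rw [inducedL, if_pos ⟨hxW, hxW'⟩]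
  exact Hilb.norm_lift _ _ (hp.norm_mk_translate hW hπ q hx hx' hxW hxW') v

theorem measurable_inner_inducedL (hW : MeasurableSet W) (hπ : π.IsIsometricOn W)
    (ζ ζ' : π.bundle.boundedSections) :
    Measurable fun q : 𝒳.Arrow => Inner.inner ℂ (L2.mk (ρ (𝒳.semidirect.r q)) ζ)
      (inducedL 𝒳 ρ hW hπ q rfl rfl (L2.mk (ρ (𝒳.semidirect.s q)) ζ')) := by
  classical
  have h1 : Measurable fun z : 𝒳.Arrow × Y =>
      Inner.inner ℂ (ζ.1 z.2) (translate π W z.1.1.2 ζ'.1 z.2) :=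
    (measurable_inner_translate hW ζ.2.1 ζ'.2.1).comp (measurable_snd.prodMk
      (measurable_snd.comp (measurable_subtype_coe.comp measurable_fst)))
  have h2 := (h1.stronglyMeasurable.integral_kernel_prod_right'
    (κ := ρ.comap 𝒳.semidirect.r 𝒳.semidirect.measurable_r)).measurable
  have hm : MeasurableSet {q : 𝒳.Arrow | 𝒳.semidirect.r q ∈ fibrewiseConull ρ W ∧
      𝒳.semidirect.s q ∈ fibrewiseConull ρ W} :=
    (𝒳.semidirect.measurable_r (measurableSet_fibrewiseConull ρ hW)).inter
      (𝒳.semidirect.measurable_s (measurableSet_fibrewiseConull ρ hW))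
  refine Measurable.of_eq (f := fun q : 𝒳.Arrow => if 𝒳.semidirect.r q ∈ fibrewiseConull ρ W ∧
      𝒳.semidirect.s q ∈ fibrewiseConull ρ W then
        ∫ y, Inner.inner ℂ (ζ.1 y) (translate π W q.1.2 ζ'.1 y) ∂ρ (𝒳.semidirect.r q) else 0)
    (Measurable.ite hm h2 measurable_const) fun q => ?_
  by_cases hq : 𝒳.semidirect.r q ∈ fibrewiseConull ρ W ∧ 𝒳.semidirect.s q ∈ fibrewiseConull ρ W
  · rw [if_pos hq, hp.inducedL_mk hW hπ q rfl rfl hq.1 hq.2, L2.inner_mk]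
    rfl
  · rw [if_neg hq, inducedL, if_neg hq]
    exact (inner_zero_right _).symm

/-- For almost every `y` all three points of the composite arrow lie in `W`, where the given
representation is multiplicative. -/
theorem mk_translate_mul (hW : MeasurableSet W) (hπ : π.IsIsometricOn W) (q₁ q₂ : 𝒳.Arrow)
    {x x' x'' : X} (hx : 𝒳.semidirect.r q₁ = x) (hx' : 𝒳.semidirect.s q₁ = x')
    (hr : 𝒳.semidirect.r q₂ = x') (hx'' : 𝒳.semidirect.s q₂ = x'')
    (hxW : x ∈ fibrewiseConull ρ W) (hxW' : x' ∈ fibrewiseConull ρ W)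
    (hxW'' : x'' ∈ fibrewiseConull ρ W) (ζ : π.bundle.boundedSections) :
    L2.mk (ρ x) (translateₗ hW hπ (𝒳.semidirect.mul q₁ q₂ (hx'.trans hr.symm)).1.2 ζ) =
      L2.mk (ρ x) (translateₗ hW hπ q₁.1.2 (translateₗ hW hπ q₂.1.2 ζ)) := by
  have hmp := hp.measurePreserving_arrow q₁ hx hx'
  have hc : 𝒢.s q₁.1.2 = 𝒢.r q₂.1.2 := by
    have h2 : 𝒳.anchor (𝒳.semidirect.r q₂) = 𝒢.r q₂.1.2 := q₂.2
    rw [← h2, hr, ← hx']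
    exact (𝒳.anchor_invAct q₁.1.2 q₁.1.1 q₁.2).symm
  refine L2.mk_congr ?_
  filter_upwards [hp.ae_mem_arrow q₁ hx hx' hxW hxW',
    hmp.quasiMeasurePreserving.ae (hp.ae_mem_arrow q₂ hr hx'' hxW' hxW'')] with y h1 h2
  obtain ⟨h, hy, hz⟩ := h1
  rw [𝒴.invActTotal_eq h] at h2
  obtain ⟨h', -, hz'⟩ := h2
  exact translate_mul hπ hc ζ.1 h hy hz hz'

/-- The representation of the groupoid of `X` induced by a representation of the groupoid
of `Y`. -/
def induced [MeasurableSpace.CountablyGenerated Y] (hW : MeasurableSet W) (hW0 : (μ.bind ρ) Wᶜ = 0) (hπ : π.IsIsometricOn W) :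
    Representation 𝒳.semidirect μ :=
  Representation.ofIsometric (π.bundle.l2 ρ) (inducedL 𝒳 ρ hW hπ)
    (fun m n => hp.measurable_inner_inducedL hW hπ (π.bundle.l2Fund m) (π.bundle.l2Fund n))
    (fibrewiseConull ρ W) (measurableSet_fibrewiseConull ρ hW) (measure_compl_fibrewiseConull hW0)
    (fun q _ _ hx hx' => hp.norm_inducedL hW hπ q hx hx')
    (fun q₁ q₂ x x' x'' hx hx' hr hx'' hxW hxW' hxW'' => by
      refine Hilb.ext_mk _ fun ζ => ?_
      refine (hp.inducedL_mk hW hπ _ _ _ hxW hxW'' ζ).trans ?_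
      rw [hp.mk_translate_mul hW hπ q₁ q₂ hx hx' hr hx'' hxW hxW' hxW'' ζ]
      refine (hp.inducedL_mk hW hπ q₁ hx hx' hxW hxW' _).symm.trans ?_
      exact congrArg _ (hp.inducedL_mk hW hπ q₂ hr hx'' hxW' hxW'' ζ).symm)
    (fun x hx => by
      refine Hilb.ext_mk _ fun ζ => ?_
      refine (hp.inducedL_mk hW hπ _ _ _ hx hx ζ).trans ?_
      refine L2.mk_congr ?_
      filter_upwards [show ∀ᵐ y ∂ρ x, y ∈ W from hx, hp.ae_eq x] with y hy hyx
      have e : (𝒳.semidirect.unit x).1.2 = 𝒢.unit (𝒴.anchor y) := by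
        rw [← hp.anchor, hyx]
        rfl
      rw [translateₗ_apply, e]
      exact translate_unit hπ ζ.1 hy)

end FibreSystem

/-! ### Pointwise realisation of sections of the bundle of square integrable sections -/

namespace HilbertBundle

variable {Y : Type u} [MeasurableSpace Y] {H : HilbertBundle Y}

theorem summable_norm_of_tsum_enorm {E : Type u} [NormedAddCommGroup E] {f : ℕ → E}
    (h : ∑' k, ‖f k‖ₑ ≠ ∞) : Summable fun k => ‖f k‖ :=
  (ENNReal.summable_toReal h).congr fun k => toReal_enorm (f k)

namespace L2

/-- The pointwise inequality `t ≤ a + t²/a` converts mean square smallness into smallness of the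
integral of the norm. The parameter `a` is left free, to be balanced at each stage of a series. -/
theorem lintegral_enorm_le (m : Measure Y) [IsProbabilityMeasure m] (ζ : H.boundedSections) {a : ℝ}
    (ha : 0 < a) : ∫⁻ y, ‖ζ.1 y‖ₑ ∂m ≤ ENNReal.ofReal (a + a⁻¹ * ‖mk m ζ‖ ^ 2) := by
  have hpt : ∀ y, ‖ζ.1 y‖ₑ ≤ ENNReal.ofReal a + ENNReal.ofReal a⁻¹ * ‖ζ.1 y‖ₑ ^ 2 := fun y => by
    rw [← ofReal_norm, ← ENNReal.ofReal_pow (norm_nonneg _), ← ENNReal.ofReal_mul (by positivity),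
      ← ENNReal.ofReal_add ha.le (by positivity)]
    refine ENNReal.ofReal_le_ofReal ?_
    set t := ‖ζ.1 y‖
    have ht : 0 ≤ t := norm_nonneg _
    have e : a + a⁻¹ * t ^ 2 - t = a⁻¹ * ((t - a) ^ 2 + a * t) := by
      field_simp
      ring
    have : 0 ≤ a⁻¹ * ((t - a) ^ 2 + a * t) := by positivity
    linarith
  calc ∫⁻ y, ‖ζ.1 y‖ₑ ∂m
      ≤ ∫⁻ y, (ENNReal.ofReal a + ENNReal.ofReal a⁻¹ * ‖ζ.1 y‖ₑ ^ 2) ∂m := lintegral_mono hpt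
    _ = ENNReal.ofReal a + ENNReal.ofReal a⁻¹ * ENNReal.ofReal (‖mk m ζ‖ ^ 2) := by
        rw [lintegral_add_left measurable_const, lintegral_const, measure_univ, mul_one,
          lintegral_const_mul' _ _ ENNReal.ofReal_ne_top, lintegral_enorm_sq]
    _ = ENNReal.ofReal (a + a⁻¹ * ‖mk m ζ‖ ^ 2) := by
        rw [← ENNReal.ofReal_mul (by positivity), ← ENNReal.ofReal_add ha.le (by positivity)]

theorem measurable_enorm (ζ : H.boundedSections) : Measurable fun y => ‖ζ.1 y‖ₑ := by
  simp only [← ofReal_norm]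
  exact ζ.2.1.measurable_norm.ennreal_ofReal

/-- A rapidly decreasing sequence of square integrable sections is summable almost everywhere. -/
theorem ae_tsum_enorm_ne_top (m : Measure Y) [IsProbabilityMeasure m] {ζ : ℕ → H.boundedSections}
    (h : ∀ k : ℕ, ‖mk m (ζ k)‖ ≤ 2 * (1 / 4) ^ k) : ∀ᵐ y ∂m, ∑' k, ‖(ζ k).1 y‖ₑ ≠ ∞ := by
  have hlt : ∫⁻ y, ∑' k, ‖(ζ k).1 y‖ₑ ∂m ≠ ∞ := by
    rw [lintegral_tsum fun k => (measurable_enorm (ζ k)).aemeasurable]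
    have hs : Summable fun k : ℕ => (1 / 2 : ℝ) ^ k + 4 * (1 / 8) ^ k :=
      (summable_geometric_of_lt_one (by norm_num) (by norm_num)).add
        ((summable_geometric_of_lt_one (by norm_num) (by norm_num)).mul_left 4)
    refine ne_top_of_le_ne_top hs.tsum_ofReal_ne_top (ENNReal.tsum_le_tsum fun k => ?_)
    -- With `a = 2⁻ᵏ` and norm at most `2·4⁻ᵏ`, the second term is at most `4·8⁻ᵏ`, and both series
    -- converge.
    refine (lintegral_enorm_le m (ζ k) (a := (1 / 2) ^ k) (by positivity)).trans ?_
    refine ENNReal.ofReal_le_ofReal (add_le_add_right ?_ _)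
    calc ((1 / 2 : ℝ) ^ k)⁻¹ * ‖mk m (ζ k)‖ ^ 2 ≤ ((1 / 2 : ℝ) ^ k)⁻¹ * (2 * (1 / 4) ^ k) ^ 2 := by
          have := pow_le_pow_left₀ (norm_nonneg _) (h k) 2
          gcongr
      _ = 4 * (1 / 8) ^ k := by
          rw [mul_pow, ← pow_mul, mul_comm k 2, pow_mul, ← inv_pow, mul_left_comm, ← mul_pow]
          norm_num
  filter_upwards [ae_lt_top' (AEMeasurable.tsum fun k =>
    (measurable_enorm (ζ k)).aemeasurable) hlt] with y hy using hy.ne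

/-- If a sequence of sections converges in the mean and converges to `0` almost everywhere, then the
limit is `0`. -/
theorem eq_zero_of_tendsto {m : Measure Y} [IsFiniteMeasure m] {ζ : ℕ → H.boundedSections}
    {v : H.L2 m} (hv : Tendsto (fun k => mk m (ζ k)) atTop (𝓝 v))
    (h : ∀ᵐ y ∂m, Tendsto (fun k => (ζ k).1 y) atTop (𝓝 0)) : v = 0 := by
  have hle : ∀ k, ‖mk m (ζ k)‖ ^ 2 ≤ ‖mk m (ζ k) - v‖ ^ 2 := fun k => by
    -- Fatou's lemma for `ζₖ - ζⱼ` as `j → ∞` gives `‖ζₖ‖ ≤ ‖ζₖ - v‖`; letting `k → ∞` gives `‖v‖ ≤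
    -- 0`.
    have h1 : ∫⁻ y, ‖(ζ k).1 y‖ₑ ^ 2 ∂m =
        ∫⁻ y, liminf (fun j => ‖(ζ k - ζ j).1 y‖ₑ ^ 2) atTop ∂m := by
      refine lintegral_congr_ae ?_
      filter_upwards [h] with y hy
      have h2 : Tendsto (fun j => ‖(ζ k).1 y - (ζ j).1 y‖ₑ ^ 2) atTop
          (𝓝 (‖(ζ k).1 y - 0‖ₑ ^ 2)) :=
        ((ENNReal.continuous_pow 2).tendsto _).comp
          ((continuous_enorm.tendsto _).comp (tendsto_const_nhds.sub hy))
      rw [sub_zero] at h2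
      exact h2.liminf_eq.symm
    have h3 : ∫⁻ y, liminf (fun j => ‖(ζ k - ζ j).1 y‖ₑ ^ 2) atTop ∂m ≤
        liminf (fun j => ∫⁻ y, ‖(ζ k - ζ j).1 y‖ₑ ^ 2 ∂m) atTop :=
      lintegral_liminf_le fun j => (measurable_enorm (ζ k - ζ j)).pow_const 2
    rw [← h1] at h3
    simp only [lintegral_enorm_sq, map_sub] at h3
    have h4 : Tendsto (fun j => ENNReal.ofReal (‖mk m (ζ k) - mk m (ζ j)‖ ^ 2)) atTop
        (𝓝 (ENNReal.ofReal (‖mk m (ζ k) - v‖ ^ 2))) :=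
      ENNReal.tendsto_ofReal (((tendsto_const_nhds.sub hv).norm).pow 2)
    rw [h4.liminf_eq] at h3
    exact (ENNReal.ofReal_le_ofReal_iff (sq_nonneg _)).1 h3
  have h5 := le_of_tendsto_of_tendsto' (hv.norm.pow 2) (((hv.sub_const v).norm).pow 2) hle
  rw [sub_self, norm_zero, zero_pow two_ne_zero] at h5
  exact norm_eq_zero.1 (pow_eq_zero_iff two_ne_zero |>.1 (le_antisymm h5 (sq_nonneg _)))

end L2

variable [MeasurableSpace.CountablyGenerated Y] {X : Type u} [MeasurableSpace X] {ρ : Kernel X Y}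
  [IsMarkovKernel ρ] {p : Y → X}

/-- A vector of the completion is not a function, so `u(x)` is approximated to within `4⁻ᵏ` by
actual bounded sections, with index chosen in a Borel way. Successive differences are at most
`2·4⁻ᵏ` in norm, so the approximants converge almost everywhere on every fibre, not merely on almost
every fibre. Substituting `x = p y` turns the limit into a Borel field over `Y`. -/
theorem exists_pointwise_limit {u : ∀ x, H.L2 (ρ x)} (hu : (H.l2 ρ).IsBorel u) (hp : Measurable p)
    (hfib : ∀ x, ∀ᵐ y ∂ρ x, p y = x) :
    ∃ (N : ℕ → X → ℕ) (η : ∀ y, H.Fibre y), H.IsBorel η ∧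
      (∀ k x, ‖u x - L2.mk (ρ x) (H.l2Dense (N k x))‖ ≤ (1 / 4) ^ k) ∧
      ∀ x, ∀ᵐ y ∂ρ x, Tendsto (fun k => (H.l2Dense (N k x)).1 y) atTop (𝓝 (η y)) := by
  classical
  choose N hN hNlt using fun k : ℕ => hu.exists_approx (ε := (1 / 4 : ℝ) ^ k) (by positivity)
  have hle : ∀ k x, ‖u x - L2.mk (ρ x) (H.l2Dense (N k x))‖ ≤ (1 / 4) ^ k := fun k x => by
    rw [mk_l2Dense]
    exact (hNlt k x).le
  have hz : ∀ k, H.IsBorel fun y => (H.l2Dense (N k (p y))).1 y := fun k =>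
    isBorel_select (fun n => (H.l2Dense n).2.1) ((hN k).comp hp)
  -- The Borel set where the successive differences are absolutely summable; the limit field is set
  -- to `0` elsewhere.
  set S : Set Y := {y | ∑' k, ‖(H.l2Dense (N (k + 1) (p y))).1 y -
    (H.l2Dense (N k (p y))).1 y‖ₑ ≠ ∞} with hS
  have hSm : MeasurableSet S := by
    have hm : Measurable fun y => ∑' k, ‖(H.l2Dense (N (k + 1) (p y))).1 y -
        (H.l2Dense (N k (p y))).1 y‖ₑ := by
      refine Measurable.tsum fun k => ?_
      simp only [← ofReal_norm]
      exact ((hz (k + 1)).sub (hz k)).measurable_norm.ennreal_ofReal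
    exact hm (measurableSet_singleton ∞).compl
  have hlim : ∀ y ∈ S, ∃ v, Tendsto (fun k => (H.l2Dense (N k (p y))).1 y) atTop (𝓝 v) :=
    fun y hy => by
      refine cauchySeq_tendsto_of_complete (cauchySeq_of_summable_dist ?_)
      refine (summable_norm_of_tsum_enorm hy).congr fun k => ?_
      rw [dist_eq_norm, norm_sub_rev]
  choose η₀ hη₀ using hlim
  have hηlim : ∀ y, Tendsto (fun k => if y ∈ S then (H.l2Dense (N k (p y))).1 y else 0) atTop
      (𝓝 (if h : y ∈ S then η₀ y h else 0)) := fun y => by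
    by_cases h : y ∈ S
    · simp only [h, if_true, dite_true]
      exact hη₀ y h
    · simp only [h, if_false, dite_false]
      exact tendsto_const_nhds
  refine ⟨N, fun y => if h : y ∈ S then η₀ y h else 0,
    isBorel_of_tendsto (fun k => (hz k).ite isBorel_zero hSm) hηlim, hle, fun x => ?_⟩
  have hd : ∀ᵐ y ∂ρ x, ∑' k, ‖(H.l2Dense (N (k + 1) x) - H.l2Dense (N k x)).1 y‖ₑ ≠ ∞ := by
    refine L2.ae_tsum_enorm_ne_top (ρ x) fun k => ?_
    have h1 := hle k x
    have h2 := hle (k + 1) x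
    have e : L2.mk (ρ x) (H.l2Dense (N (k + 1) x) - H.l2Dense (N k x)) =
        (u x - L2.mk (ρ x) (H.l2Dense (N k x))) - (u x - L2.mk (ρ x) (H.l2Dense (N (k + 1) x))) := by
      rw [map_sub, sub_sub_sub_cancel_left]
    rw [e]
    refine (norm_sub_le _ _).trans ?_
    have h3 : (1 / 4 : ℝ) ^ (k + 1) ≤ (1 / 4) ^ k :=
      pow_le_pow_of_le_one (by norm_num) (by norm_num) (Nat.le_succ k)
    linarith
  filter_upwards [hd, hfib x] with y hy hyx
  have hyS : y ∈ S := by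
    rw [hS, Set.mem_ofPred_eq, hyx]
    exact hy
  refine (hηlim y).congr fun k => ?_
  rw [if_pos hyS, hyx]

end HilbertBundle

/-! ### Ascent of property T -/

namespace FibreSystem

open GSpace HilbertBundle

variable {G₀ G X Y : Type u} [MeasurableSpace G₀] [MeasurableSpace G] [MeasurableSpace X]
  [MeasurableSpace Y] [StandardBorelSpace G₀] [StandardBorelSpace X] [StandardBorelSpace Y]
  {𝒢 : BorelGroupoid G₀ G} {𝒴 : GSpace 𝒢 Y}
  {𝒳 : GSpace 𝒢 X} {p : Y → X} {ρ : Kernel X Y} (hp : FibreSystem 𝒴 𝒳 p ρ) {μ : Measure X}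
  {W : Set Y} [IsMarkovKernel ρ] {π : Representation 𝒴.semidirect (μ.bind ρ)} {lam : HaarSystem 𝒢}

omit [StandardBorelSpace Y] [IsMarkovKernel ρ] in
theorem ae_mem_fibrewiseConull (hqX : QuasiInvariant (𝒳.haar lam) μ) (hW0 : (μ.bind ρ) Wᶜ = 0) :
    ∀ᵐ x ∂μ, ∀ᵐ γ ∂lam.kernel (𝒳.anchor x), ∀ h : 𝒳.anchor x = 𝒢.r γ,
      x ∈ fibrewiseConull ρ W ∧ 𝒳.invAct γ x h ∈ fibrewiseConull ρ W := by
  have hU : ∀ᵐ x ∂μ, x ∈ fibrewiseConull ρ W := measure_compl_fibrewiseConull hW0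
  exact 𝒳.ae_ae_of_ae_arrow lam ((ae_arrow_r (𝒳.haar lam) hU).and (hqX.ae_arrow_s hU))

include hp

/-- The class of `ξₙ` on a fibre has norm one because `ρ x` is a probability measure. Its coboundary
is the class of the fibrewise coboundaries, which are bounded and tend to `0`, so the mean square
norm tends to `0` as well. -/
theorem almostHasUnitInvariantSections_induced (hqX : QuasiInvariant (𝒳.haar lam) μ)
    (hqY : QuasiInvariant (𝒴.haar lam) (μ.bind ρ)) (hW : MeasurableSet W)
    (hW0 : (μ.bind ρ) Wᶜ = 0) (hπ : π.IsIsometricOn W)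
    (h : π.AlmostHasUnitInvariantSections (𝒴.haar lam)) :
    (hp.induced hW hW0 hπ).AlmostHasUnitInvariantSections (𝒳.haar lam) := by
  classical
  obtain ⟨ξ, hξ, hlim⟩ := h
  -- Unit sections have norm one only almost everywhere. Truncation yields globally bounded sections
  -- that agree with them almost everywhere.
  let b : ℕ → π.bundle.boundedSections := fun n =>
    ⟨fun y => if ‖(ξ n).toFun y‖ ≤ 1 then (ξ n).toFun y else 0,
      (ξ n).isBorel.ite isBorel_zero (measurableSet_le (ξ n).isBorel.measurable_norm
        measurable_const), 1, fun y => by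
      beta_reduce
      split_ifs with hy
      · exact hy
      · rw [norm_zero]
        exact zero_le_one⟩
  have hb1 : ∀ n y, ‖(b n).1 y‖ ≤ 1 := fun n y => by
    change ‖if ‖(ξ n).toFun y‖ ≤ 1 then (ξ n).toFun y else 0‖ ≤ 1
    split_ifs with hy
    · exact hy
    · rw [norm_zero]
      exact zero_le_one
  have hb : ∀ n y, ‖(ξ n).toFun y‖ = 1 → (b n).1 y = (ξ n).toFun y := fun n y hy => if_pos hy.le
  have hsec : ∀ n, (hp.induced hW hW0 hπ).bundle.IsBorel fun x => L2.mk (ρ x) (b n) :=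
    fun n => isBorel_l2_mk ρ (b n)
  have hξall : ∀ᵐ y ∂μ.bind ρ, ∀ n, ‖(ξ n).toFun y‖ = 1 := ae_all_iff.2 hξ
  refine ⟨fun n => (hsec n).toSection, fun n => ?_, ?_⟩
  · filter_upwards [Measure.ae_ae_of_ae_comp (hξ n)] with x hx
    have h1 : ‖L2.mk (ρ x) (b n)‖ ^ 2 = 1 := by
      rw [L2.norm_mk_sq]
      have : ∫ y, ‖(b n).1 y‖ ^ 2 ∂ρ x = ∫ _, (1 : ℝ) ∂ρ x := by
        refine integral_congr_ae ?_
        filter_upwards [hx] with y hy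
        rw [hb n y hy, hy, one_pow]
      rw [this]
      simp
    exact (pow_eq_one_iff_of_nonneg (norm_nonneg _) two_ne_zero).1 h1
  · have hm : MeasurableSet {q | Tendsto (fun n =>
        ‖(hp.induced hW hW0 hπ).coboundary (hsec n).toSection q‖) atTop (𝓝 0)} :=
      measurableSet_tendsto _ fun n =>
        (hp.induced hW hW0 hπ).measurable_norm_coboundary (hsec n).toSection
    refine 𝒳.ae_arrow_of_ae_ae lam hm ?_
    have hgood := (hlim.and (ae_arrow_r (𝒴.haar lam) hξall)).and (hqY.ae_arrow_s hξall)
    filter_upwards [hp.ae_ae_ae lam hgood, ae_mem_fibrewiseConull hqX hW0] with x hx hx2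
    filter_upwards [hx, hx2] with γ hγ hγ2 h
    have e : ∀ n, (hp.induced hW hW0 hπ).coboundary (hsec n).toSection ⟨(x, γ), h⟩ =
        L2.mk (ρ x) (b n - translateₗ hW hπ γ (b n)) := fun n => by
      rw [map_sub]
      exact congrArg (fun v => L2.mk (ρ x) (b n) - v)
        (hp.inducedL_mk hW hπ ⟨(x, γ), h⟩ rfl rfl (hγ2 h).1 (hγ2 h).2 (b n))
    simp only [e]
    refine L2.tendsto_norm_mk (C := 2) (fun n y => ?_) ?_
    · have h1 := hb1 n y
      have h2 := norm_translate_le hπ γ (hb1 n) y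
      refine (norm_sub_le ((b n).1 y) (translate π W γ (b n).1 y)).trans ?_
      linarith
    · filter_upwards [hγ, hp.ae_mem_arrow ⟨(x, γ), h⟩ rfl rfl (hγ2 h).1 (hγ2 h).2] with y hy hy2
      obtain ⟨h', hyW, hzW⟩ := hy2
      obtain ⟨⟨h1, h2⟩, h3⟩ := hy h'
      refine h1.congr fun n => congrArg _ ?_
      change (ξ n).toFun y - fibreL π h' rfl ((ξ n).toFun (𝒴.invAct γ y h')) =
        (b n).1 y - translate π W γ (b n).1 y
      rw [translate_eq (b n).1 h' rfl hyW hzW, hb n y (h2 n), hb n (𝒴.invAct γ y h') (h3 n)]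

-- The approximant at `x` and the translate of the approximant at `γ⁻¹x` lie within `2·4⁻ᵏ` in mean
-- square, since the induced operator is isometric and fixes `u`. Their difference therefore tends
-- to `0` almost everywhere, and continuity of the single operators passes invariance to the
-- pointwise limit.
omit [StandardBorelSpace X] in
theorem fibreL_eq_of_inducedL_eq (hW : MeasurableSet W) (hπ : π.IsIsometricOn W)
    {u : ∀ x, π.bundle.L2 (ρ x)} {N : ℕ → X → ℕ} {η : ∀ y, π.bundle.Fibre y}
    (hN : ∀ k x, ‖u x - L2.mk (ρ x) (π.bundle.l2Dense (N k x))‖ ≤ (1 / 4) ^ k)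
    (hη : ∀ x, ∀ᵐ y ∂ρ x, Tendsto (fun k => (π.bundle.l2Dense (N k x)).1 y) atTop (𝓝 (η y)))
    {x : X} {γ : G} (h : 𝒳.anchor x = 𝒢.r γ) (hx : x ∈ fibrewiseConull ρ W)
    (hx' : 𝒳.invAct γ x h ∈ fibrewiseConull ρ W)
    (hu : inducedL 𝒳 ρ hW hπ ⟨(x, γ), h⟩ (x := x) (x' := 𝒳.invAct γ x h) rfl rfl (u (𝒳.invAct γ x h)) = u x) :
    ∀ᵐ y ∂ρ x, ∀ h' : 𝒴.anchor y = 𝒢.r γ,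
      fibreL π h' rfl (η (𝒴.invAct γ y h')) = η y := by
  set x' := 𝒳.invAct γ x h with hx'def
  have hd : ∀ᵐ y ∂ρ x, ∑' k, ‖(π.bundle.l2Dense (N k x) -
      translateₗ hW hπ γ (π.bundle.l2Dense (N k x'))).1 y‖ₑ ≠ ∞ := by
    refine L2.ae_tsum_enorm_ne_top (ρ x) fun k => ?_
    have e : L2.mk (ρ x) (π.bundle.l2Dense (N k x) -
        translateₗ hW hπ γ (π.bundle.l2Dense (N k x'))) =
        inducedL 𝒳 ρ hW hπ ⟨(x, γ), h⟩ (x := x) (x' := x') rfl rfl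
          (u x' - L2.mk (ρ x') (π.bundle.l2Dense (N k x'))) -
        (u x - L2.mk (ρ x) (π.bundle.l2Dense (N k x))) := by
      rw [map_sub, map_sub]
      have e2 := hp.inducedL_mk hW hπ ⟨(x, γ), h⟩ (x := x) (x' := x') rfl rfl hx hx' (π.bundle.l2Dense (N k x'))
      refine Eq.trans ?_ (congrArg₂ (fun a c => a - c - (u x - L2.mk (ρ x)
        (π.bundle.l2Dense (N k x)))) hu e2).symm
      abel
    rw [e]
    refine (norm_sub_le _ _).trans ?_
    have h1 := hN k x
    have h2 := hN k x'
    have h3 := hp.norm_inducedL hW hπ ⟨(x, γ), h⟩ (x := x) (x' := x') rfl rfl hx hx'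
      (u x' - L2.mk (ρ x') (π.bundle.l2Dense (N k x')))
    refine (add_le_add (h3.le.trans h2) h1).trans (le_of_eq ?_)
    ring
  have hη' := (hp.measurePreserving γ x h).quasiMeasurePreserving.ae (hη x')
  filter_upwards [hd, hη x, hη', hp.ae_mem_arrow ⟨(x, γ), h⟩ rfl rfl hx hx'] with y h1 h2 h3 h4 h'
  obtain ⟨h'', hyW, hzW⟩ := h4
  rw [𝒴.invActTotal_eq h'] at h3
  have h5 := (summable_norm_of_tsum_enorm h1).tendsto_atTop_zero
  have h6 := tendsto_zero_iff_norm_tendsto_zero.2 h5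
  have h7 := h2.sub h6
  rw [sub_zero] at h7
  refine tendsto_nhds_unique (((fibreL π h' rfl).continuous.tendsto _).comp h3) (h7.congr fun k => ?_)
  change (π.bundle.l2Dense (N k x)).1 y - ((π.bundle.l2Dense (N k x)).1 y -
    translate π W γ (π.bundle.l2Dense (N k x')).1 y) = _
  rw [sub_sub_cancel, translate_eq _ h' rfl hyW hzW]
  rfl

/-- Property T ascends along measure preserving maps. -/
theorem hasPropertyT_extension (hqX : QuasiInvariant (𝒳.haar lam) μ)
    (hqY : QuasiInvariant (𝒴.haar lam) (μ.bind ρ)) (herg : IsErgodic 𝒴.semidirect (μ.bind ρ))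
    (hT : HasPropertyT (𝒳.haar lam) μ) : HasPropertyT (𝒴.haar lam) (μ.bind ρ) := by
  intro π hπ'
  obtain ⟨W, hW, hW0, hiso, hmul⟩ := π.conull
  have hπ : π.IsIsometricOn W := ⟨fun γ x y hx hy h1 h2 => (hiso γ hx hy h1 h2).1, hmul⟩
  obtain ⟨u, hu1, hu2⟩ := hT (hp.induced hW hW0 hπ)
    (hp.almostHasUnitInvariantSections_induced hqX hqY hW hW0 hπ hπ')
  obtain ⟨N, η, hηB, hN, hη⟩ :=
    exists_pointwise_limit (H := π.bundle) (ρ := ρ) u.isBorel hp.measurable hp.ae_eq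
  refine Representation.hasUnitInvariantSection_of_invariant hqY herg hηB ?_ fun h0 => ?_
  · have hm : MeasurableSet {q | ‖π.coboundary hηB.toSection q‖ = 0} :=
      π.measurable_norm_coboundary hηB.toSection (measurableSet_singleton 0)
    have h2 : ∀ᵐ q ∂arrowMeasure (𝒴.haar lam) (μ.bind ρ), ‖π.coboundary hηB.toSection q‖ = 0 := by
      refine (hp.ae_arrow_iff lam hm).2 ?_
      filter_upwards [𝒳.ae_ae_of_ae_arrow lam hu2, ae_mem_fibrewiseConull hqX hW0] with x h3 h4
      filter_upwards [h3, h4, lam.ae_r_eq (𝒳.anchor x)] with γ h5 h6 h7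
      have h : 𝒳.anchor x = 𝒢.r γ := h7.symm
      have h8 : inducedL 𝒳 ρ hW hπ ⟨(x, γ), h⟩ rfl rfl (u.toFun (𝒳.invAct γ x h)) = u.toFun x :=
        (sub_eq_zero.1 (h5 h)).symm
      filter_upwards [hp.fibreL_eq_of_inducedL_eq hW hπ hN hη h (h6 h).1 (h6 h).2 h8] with y hy h'
      exact norm_eq_zero.2 (sub_eq_zero.2 (hy h').symm)
    filter_upwards [h2] with q hq
    exact (sub_eq_zero.1 (norm_eq_zero.1 hq)).symm
  -- If `η` vanished almost everywhere, the approximants of `u(x)` would tend to `0` both almost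
  -- everywhere and, in the mean, to `u(x)`. Then `u(x) = 0`, against `‖u(x)‖ = 1`, so `μ` must be
  -- zero.
  · have hfalse : ∀ᵐ _x ∂μ, False := by
      filter_upwards [Measure.ae_ae_of_ae_comp h0, hu1] with x hx hx1
      let v : π.bundle.L2 (ρ x) := u.toFun x
      have hlim : Tendsto (fun k => L2.mk (ρ x) (π.bundle.l2Dense (N k x))) atTop (𝓝 v) := by
        rw [tendsto_iff_norm_sub_tendsto_zero]
        refine squeeze_zero (fun _ => norm_nonneg _) (fun k => ?_)
          (tendsto_pow_atTop_nhds_zero_of_lt_one (r := (1 / 4 : ℝ)) (by norm_num) (by norm_num))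
        rw [norm_sub_rev]
        exact hN k x
      have hz : v = 0 := by
        refine L2.eq_zero_of_tendsto hlim ?_
        filter_upwards [hη x, hx] with y h1 h2
        rwa [h2] at h1
      exact zero_ne_one ((norm_eq_zero.2 hz).symm.trans hx1)
    rw [ae_eq_bot.1 (eventually_false_iff_eq_bot.1 hfalse), Measure.bind_zero_left]

end FibreSystem

end MeasGpd

end

/-! ### The theorem -/

theorem theorem5 {G₀ G X Y : Type u}
    [MeasurableSpace G₀] [StandardBorelSpace G₀] [MeasurableSpace G] [StandardBorelSpace G]
    [MeasurableSpace X] [StandardBorelSpace X] [MeasurableSpace Y] [StandardBorelSpace Y]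
    (𝒢 : MeasGpd.BorelGroupoid G₀ G) (lam : MeasGpd.HaarSystem 𝒢)
    (𝒴 : MeasGpd.GSpace 𝒢 Y) (𝒳 : MeasGpd.GSpace 𝒢 X)
    (ν : Measure Y) (μ : Measure X) [SFinite ν] [SFinite μ] (p : Y → X)
    (hpair : MeasGpd.IsMeasuredPair lam 𝒴 𝒳 ν μ p)
    (hpres : MeasGpd.IsMeasurePreservingPair 𝒴 𝒳 ν μ p)
    (hY : MeasGpd.IsErgodic 𝒴.semidirect ν) (hX : MeasGpd.IsErgodic 𝒳.semidirect μ) :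
    (MeasGpd.HasPropertyT (𝒳.haar lam) μ →
      MeasGpd.HasPropertyT (𝒴.haar lam) ν) ∧
    (𝒢.IsRDiscrete → MeasGpd.HasPropertyT (𝒴.haar lam) ν →
      MeasGpd.HasPropertyT (𝒳.haar lam) μ) := by
  obtain ⟨ρ, hρ, hfib, hinv, rfl⟩ := hpres
  have hp : MeasGpd.FibreSystem 𝒴 𝒳 p ρ :=
    ⟨hpair.measurable_p, hpair.anchor_p, hpair.equivariant, hfib, hinv⟩
  exact ⟨hp.hasPropertyT_extension hpair.quasiInvariant_μ hpair.quasiInvariant_ν hY,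
    fun hd => hp.hasPropertyT_of_extension hd hpair.quasiInvariant_ν hpair.quasiInvariant_μ hX⟩
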